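/- For $\beta\in[0,1]$, $e\in[0,1)$ and $\omega\in\mathbf U=\{z\in\mathbb C:|z|=1\}$ let $$A(\beta,e)=-\frac{d^2}{dt^2}-1+\frac{\beta}{1+e\cos t}$$ be the operator in $L^2([0,2\pi],\mathbb C)$ with domain $\{y\in W^{2,2}([0,2\pi],\mathbb C): y(2\pi)=\omega y(0),\ \dot y(2\pi)=\omega\dot y(0)\}$. Let $\phi_\omega(A(\beta,e))$ be its Morse index (the maximal dimension of a subspace of the domain on which $\langle A(\beta,e)\,\cdot,\cdot\rangle$ is negative definite) and $\nu_\omega(A(\beta,e))=\dim\ker A(\beta,e)$. Let $\gamma_{\beta,e}:[0,2\pi]\to \mathrm{Sp}(2)$ be the solution of $$\dot\gamma=J\begin{pmatrix}1&0\\0&1-\frac{\beta}{1+e\cos t}\end{pmatrix}\gamma,\qquad \gamma(0)=I,\qquad J=\begin{pmatrix}0&-1\\1&0\end{pmatrix},$$ and $\nu_\omega(\gamma_{\beta,e})=\dim_{\mathbb C}\ker(\gamma_{\beta,e}(2\pi)-\omega I)$. The index $i_\omega(\gamma)\in\mathbb Z$ of a continuous path $\gamma:[0,2\pi]\to\mathrm{Sp}(2)$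 with $\gamma(0)=I$ is defined as follows. Let $\mathrm{Sp}(2)^0_\omega=\{M\in\mathrm{Sp}(2):\det(M-\omega I)=0\}$, co-oriented at its regular points $M$ by the direction $\frac{d}{ds}Me^{sJ}|_{s=0}$. If $\gamma(2\pi)\notin \mathrm{Sp}(2)^0_\omega$, then $i_\omega(\gamma)$ is the homotopy intersection number with $\mathrm{Sp}(2)^0_\omega$ of the path that first follows $\xi(t)=\mathrm{diag}\big(2-\tfrac t{2\pi},(2-\tfrac t{2\pi})^{-1}\big)$, $0\le t\le2\pi$, and then $\gamma$, that is, the signed number of crossings of a path homotopic to it with fixed endpoints which meets $\mathrm{Sp}(2)^0_\omega$ only transversally and at regular points. If $\gamma(2\pi)\in \mathrm{Sp}(2)^0_\omega$, then $i_\omega(\gamma)$ is the index of the path $t\mapsto\gamma(t)e^{-\epsilon tJ/(2\pi)}$ for all sufficiently small $\epsilon>0$. Fix $e\in[0,1)$. The indices $i_\omega(\gamma_{\beta,e})$ are well defined, and: 1. For every $\omega\in\mathbf U$, the functions $\beta\mapsto\phi_\omega(A(\beta,e))$ and $\beta\mapsto i_\omega(\gamma_{\beta,e})$ are non-increasing on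 $[0,1]$. 2. For $\omega=1$, $\phi_1(A(\beta,e))=i_1(\gamma_{\beta,e})=1$ for all $\beta\in[0,1)$, and $\nu_1(A(\beta,e))=\nu_1(\gamma_{\beta,e})=0$ for all $\beta\in(0,1)$. 3. For $\omega\in\mathbf U\setminus\{1\}$, both indices decrease from $2$ to $0$: they equal $2$ at $\beta=0$ and for all sufficiently small $\beta>0$, and they equal $0$ at $\beta=1$ and for all $\beta<1$ sufficiently close to $1$. -/

import Mathlib

open MeasureTheory Set Filter Topology
open scoped Real ComplexConjugate

noncomputable section

namespace SturmIndex

/-! ### Morse index and nullity of a densely defined operator -/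

section Abstract

variable {H : Type*} [NormedAddCommGroup H] [InnerProductSpace ℂ H]

/-- `V` is a negative definite subspace (of the domain) for the form `⟨T y, y⟩`.
For symmetric `T` the form is real, so taking the real part changes nothing. -/
def IsNegDef (T : H →ₗ.[ℂ] H) (V : Submodule ℂ T.domain) : Prop :=
  ∀ y ∈ V, y ≠ 0 → (inner ℂ (T y) (y : H)).re < 0

/-- The Morse index `φ(T)`: the maximal complex dimension of a negative definite subspace of the
form `⟨T y, y⟩` on the domain of `T` (with the value `⊤` if these dimensions are unbounded). -/
def morseIndex (T : H →ₗ.[ℂ] H) : ℕ∞ :=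
  ⨆ V : {V : Submodule ℂ T.domain // IsNegDef T V}, Cardinal.toENat (Module.rank ℂ V.1)

/-- The nullity `ν(T) = dim ker T` (with the value `⊤` if the kernel is infinite-dimensional). -/
def nullity (T : H →ₗ.[ℂ] H) : ℕ∞ :=
  Cardinal.toENat (Module.rank ℂ (LinearMap.ker T.toFun))

end Abstract

/-! ### The operator `A(β,e)` -/

/-- Lebesgue measure on `[0,2π]` (the endpoints carry no mass). -/
abbrev muT : Measure ℝ := volume.restrict (Ioc 0 (2 * π))

/-- The Hilbert space `L²([0,2π],ℂ)`. -/
abbrev L2 : Type := Lp ℂ 2 muT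

/-- `u ∈ W^{2,2}([0,2π],ℂ)` with first derivative `v` and weak second derivative `w`:
`u` is `C¹` on `[0,2π]` with derivative `v`, and `v` is absolutely continuous with
a.e. derivative `w ∈ L²`. -/
structure IsW22 (u v w : ℝ → ℂ) : Prop where
  memLp : MemLp w 2 muT
  left_eq : ∀ t ∈ Icc (0 : ℝ) (2 * π), u t = u 0 + ∫ s in (0 : ℝ)..t, v s
  mid_eq : ∀ t ∈ Icc (0 : ℝ) (2 * π), v t = v 0 + ∫ s in (0 : ℝ)..t, w s

lemma two_pi_nonneg : (0 : ℝ) ≤ 2 * π := by positivity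

lemma IsW22.intervalIntegrable_w {u v w : ℝ → ℂ} (h : IsW22 u v w) :
    IntervalIntegrable w volume 0 (2 * π) := by
  rw [intervalIntegrable_iff_integrableOn_Ioc_of_le two_pi_nonneg]
  exact h.memLp.integrable (by norm_num)

lemma continuousOn_of_primitive {f g : ℝ → ℂ} (hg : IntervalIntegrable g volume 0 (2 * π))
    (h : ∀ t ∈ Icc (0 : ℝ) (2 * π), f t = f 0 + ∫ s in (0 : ℝ)..t, g s) :
    ContinuousOn f (Icc 0 (2 * π)) := by
  have h1 : ContinuousOn (fun t => ∫ s in (0 : ℝ)..t, g s) (Icc 0 (2 * π)) := by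
    have := intervalIntegral.continuousOn_primitive_interval' hg (left_mem_uIcc)
    rwa [uIcc_of_le two_pi_nonneg] at this
  exact (continuousOn_const.add h1).congr h

lemma IsW22.continuousOn_v {u v w : ℝ → ℂ} (h : IsW22 u v w) :
    ContinuousOn v (Icc 0 (2 * π)) :=
  continuousOn_of_primitive h.intervalIntegrable_w h.mid_eq

lemma IsW22.intervalIntegrable_v {u v w : ℝ → ℂ} (h : IsW22 u v w) :
    IntervalIntegrable v volume 0 (2 * π) := by
  apply ContinuousOn.intervalIntegrable
  rw [uIcc_of_le two_pi_nonneg]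
  exact h.continuousOn_v

lemma IsW22.continuousOn_u {u v w : ℝ → ℂ} (h : IsW22 u v w) :
    ContinuousOn u (Icc 0 (2 * π)) :=
  continuousOn_of_primitive h.intervalIntegrable_v h.left_eq

lemma intervalIntegrable_sub {g : ℝ → ℂ} (hg : IntervalIntegrable g volume 0 (2 * π))
    {t : ℝ} (ht : t ∈ Icc (0 : ℝ) (2 * π)) : IntervalIntegrable g volume 0 t :=
  hg.mono_set (by
    rw [uIcc_of_le two_pi_nonneg, uIcc_of_le ht.1]; exact Icc_subset_Icc_right ht.2)

lemma IsW22.zero : IsW22 0 0 0 := ⟨by simp, by simp, by simp⟩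

lemma IsW22.add {u v w u' v' w' : ℝ → ℂ} (h : IsW22 u v w) (h' : IsW22 u' v' w') :
    IsW22 (u + u') (v + v') (w + w') := by
  refine ⟨h.memLp.add h'.memLp, fun t ht => ?_, fun t ht => ?_⟩
  · simp only [Pi.add_apply]
    rw [intervalIntegral.integral_add (intervalIntegrable_sub h.intervalIntegrable_v ht)
      (intervalIntegrable_sub h'.intervalIntegrable_v ht), h.left_eq t ht, h'.left_eq t ht]
    ring
  · simp only [Pi.add_apply]
    rw [intervalIntegral.integral_add (intervalIntegrable_sub h.intervalIntegrable_w ht)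
      (intervalIntegrable_sub h'.intervalIntegrable_w ht), h.mid_eq t ht, h'.mid_eq t ht]
    ring

lemma IsW22.smul {u v w : ℝ → ℂ} (c : ℂ) (h : IsW22 u v w) :
    IsW22 (c • u) (c • v) (c • w) := by
  refine ⟨h.memLp.const_smul c, fun t ht => ?_, fun t ht => ?_⟩
  · simp only [Pi.smul_apply, intervalIntegral.integral_smul, h.left_eq t ht, smul_add]
  · simp only [Pi.smul_apply, intervalIntegral.integral_smul, h.mid_eq t ht, smul_add]

/-- The graph of `A(β,e) = -d²/dt² - 1 + β/(1+e cos t)` on the domain of all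
`y ∈ W^{2,2}([0,2π],ℂ)` with `y(2π) = ω y(0)` and `y'(2π) = ω y'(0)`. -/
def graphA (ω : ℂ) (β e : ℝ) : Submodule ℂ (L2 × L2) where
  carrier := {p | ∃ u v w : ℝ → ℂ, IsW22 u v w ∧
    u (2 * π) = ω * u 0 ∧ v (2 * π) = ω * v 0 ∧
    (p.1 : ℝ → ℂ) =ᵐ[muT] u ∧
    (p.2 : ℝ → ℂ) =ᵐ[muT]
      fun t => -w t - u t + ((β / (1 + e * Real.cos t) : ℝ) : ℂ) * u t}
  zero_mem' := by
    refine ⟨0, 0, 0, IsW22.zero, by simp, by simp, ?_, ?_⟩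
    · exact Lp.coeFn_zero _ _ _
    · filter_upwards [Lp.coeFn_zero ℂ 2 muT] with t ht
      simpa using ht
  add_mem' := by
    rintro p q ⟨u, v, w, h, h1, h2, h3, h4⟩ ⟨u', v', w', h', h1', h2', h3', h4'⟩
    refine ⟨u + u', v + v', w + w', h.add h', ?_, ?_, ?_, ?_⟩
    · simp only [Pi.add_apply, h1, h1']; ring
    · simp only [Pi.add_apply, h2, h2']; ring
    · filter_upwards [Lp.coeFn_add p.1 q.1, h3, h3'] with t ht a b
      rw [Prod.fst_add, ht, Pi.add_apply, Pi.add_apply, a, b]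
    · filter_upwards [Lp.coeFn_add p.2 q.2, h4, h4'] with t ht a b
      rw [Prod.snd_add, ht, Pi.add_apply, a, b]
      simp only [Pi.add_apply]; ring
  smul_mem' := by
    rintro c p ⟨u, v, w, h, h1, h2, h3, h4⟩
    refine ⟨c • u, c • v, c • w, h.smul c, ?_, ?_, ?_, ?_⟩
    · simp only [Pi.smul_apply, smul_eq_mul, h1]; ring
    · simp only [Pi.smul_apply, smul_eq_mul, h2]; ring
    · filter_upwards [Lp.coeFn_smul c p.1, h3] with t ht a
      rw [Prod.smul_fst, ht, Pi.smul_apply, Pi.smul_apply, a]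
    · filter_upwards [Lp.coeFn_smul c p.2, h4] with t ht a
      rw [Prod.smul_snd, ht, Pi.smul_apply, a]
      simp only [Pi.smul_apply, smul_eq_mul]; ring

/-- The operator `A(β,e)` on the `ω`-periodic domain, as an unbounded operator in `L²`. -/
def opA (ω : ℂ) (β e : ℝ) : L2 →ₗ.[ℂ] L2 := (graphA ω β e).toLinearPMap

lemma primitive_zero {f g : ℝ → ℂ} (hg : IntervalIntegrable g volume 0 (2 * π))
    (h : ∀ t ∈ Icc (0 : ℝ) (2 * π), f t = f 0 + ∫ s in (0 : ℝ)..t, g s)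
    (hf : ∀ t ∈ Icc (0 : ℝ) (2 * π), f t = 0) : g =ᵐ[muT] 0 := by
  have key := hg.ae_hasDerivAt_integral
  have h0 : ∀ᵐ t ∂(volume : Measure ℝ), t ≠ 2 * π := by
    simp [ae_iff, measure_singleton]
  rw [EventuallyEq, ae_restrict_iff' measurableSet_Ioc]
  filter_upwards [key, h0] with t ht hne hmem
  have hd := ht (by rw [uIcc_of_le two_pi_nonneg]; exact Ioc_subset_Icc_self hmem) 0
    (left_mem_uIcc)
  have hz : (fun x => ∫ s in (0 : ℝ)..x, g s) =ᶠ[𝓝 t] fun _ => (0 : ℂ) := by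
    filter_upwards [Ioo_mem_nhds hmem.1 (lt_of_le_of_ne hmem.2 hne)] with x hx
    have hx' := Ioo_subset_Icc_self hx
    have := h x hx'
    rw [hf x hx', hf 0 ⟨le_rfl, two_pi_nonneg⟩] at this
    simpa using this.symm
  exact hd.unique ((hasDerivAt_const t (0 : ℂ)).congr_of_eventuallyEq hz)

/-- `graphA` really is the graph of an operator. -/
lemma graphA_single_valued (ω : ℂ) (β e : ℝ) :
    ∀ p ∈ graphA ω β e, p.1 = 0 → p.2 = 0 := by
  rintro p ⟨u, v, w, h, -, -, h3, h4⟩ hp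
  have hu : u =ᵐ[muT] 0 := by
    filter_upwards [h3, Lp.coeFn_zero ℂ 2 muT] with t a b
    rw [hp] at a
    rw [← a, b]
  have hu0 : ∀ t ∈ Icc (0 : ℝ) (2 * π), u t = 0 := by
    have h1 : u =ᵐ[volume.restrict (Icc 0 (2 * π))] 0 := by
      rwa [← Measure.restrict_congr_set (Ioc_ae_eq_Icc (μ := volume))]
    exact Measure.eqOn_Icc_of_ae_eq volume (by positivity) h1 h.continuousOn_u continuousOn_const
  have hv : v =ᵐ[muT] 0 := primitive_zero h.intervalIntegrable_v h.left_eq hu0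
  have hv0 : ∀ t ∈ Icc (0 : ℝ) (2 * π), v t = 0 := by
    have h1 : v =ᵐ[volume.restrict (Icc 0 (2 * π))] 0 := by
      rwa [← Measure.restrict_congr_set (Ioc_ae_eq_Icc (μ := volume))]
    exact Measure.eqOn_Icc_of_ae_eq volume (by positivity) h1 h.continuousOn_v continuousOn_const
  have hw : w =ᵐ[muT] 0 := primitive_zero h.intervalIntegrable_w h.mid_eq hv0
  apply Lp.ext
  filter_upwards [h4, hu, hw, Lp.coeFn_zero ℂ 2 muT] with t a b c d
  rw [a, b, c, d]; simp

lemma opA_graph (ω : ℂ) (β e : ℝ) : (opA ω β e).graph = graphA ω β e :=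
  Submodule.toLinearPMap_graph_eq _ (graphA_single_valued ω β e)

/-- The Morse index `φ_ω(A(β,e))`. -/
def phi (ω : ℂ) (β e : ℝ) : ℕ∞ := morseIndex (opA ω β e)

/-- The nullity `ν_ω(A(β,e))`. -/
def nuA (ω : ℂ) (β e : ℝ) : ℕ∞ := nullity (opA ω β e)

/-! ### Symplectic paths and the `ω`-index -/

/-- The standard symplectic matrix. -/
def J2 : Matrix (Fin 2) (Fin 2) ℝ := !![0, -1; 1, 0]

/-- The group `Sp(2)`; see `symplectic_iff_det`. -/
abbrev Sp2 : Type := Matrix.SpecialLinearGroup (Fin 2) ℝ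

/-- A real `2 × 2` matrix is symplectic iff its determinant is one. -/
lemma symplectic_iff_det (M : Matrix (Fin 2) (Fin 2) ℝ) :
    M.transpose * J2 * M = J2 ↔ M.det = 1 := by
  rw [Matrix.det_fin_two]
  constructor
  · intro h
    have := congrFun (congrFun h 1) 0
    simp [J2, Matrix.mul_apply, Fin.sum_univ_two] at this
    linarith
  · intro h
    ext i j
    fin_cases i <;> fin_cases j <;>
      simp [J2, Matrix.mul_apply, Fin.sum_univ_two] <;> linarith

/-- The rotation `R(s) = exp(s J)`. -/
def rot (s : ℝ) : Sp2 :=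
  ⟨!![Real.cos s, -Real.sin s; Real.sin s, Real.cos s], by
    rw [Matrix.det_fin_two_of]; nlinarith [Real.sin_sq_add_cos_sq s]⟩

/-- `M - ω I` as a complex matrix. -/
def shiftMat (ω : ℂ) (M : Sp2) : Matrix (Fin 2) (Fin 2) ℂ :=
  M.1.map (fun x : ℝ => (x : ℂ)) - ω • (1 : Matrix (Fin 2) (Fin 2) ℂ)

/-- The function `D_ω(M) = ω̄ det(M - ω I)`. It is real-valued for `|ω| = 1`
(see `coe_Dfun`), and is recorded as a real number. -/
def Dfun (ω : ℂ) (M : Sp2) : ℝ := (conj ω * (shiftMat ω M).det).re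

lemma coe_Dfun {ω : ℂ} (hω : ‖ω‖ = 1) (M : Sp2) :
    (Dfun ω M : ℂ) = conj ω * (shiftMat ω M).det := by
  have h1 : ω.re * ω.re + ω.im * ω.im = 1 := by
    rw [← Complex.normSq_apply, Complex.normSq_eq_norm_sq, hω]; norm_num
  have h2 := M.2
  rw [Matrix.det_fin_two] at h2
  have him : (conj ω * (shiftMat ω M).det).im = 0 := by
    simp [shiftMat, Matrix.det_fin_two]
    linear_combination (-ω.im) * h2 + ω.im * h1
  apply Complex.ext
  · simp [Dfun]
  · rw [him]; simp

/-- The nullity `ν_ω(M) = dim_ℂ ker_ℂ (M - ω I)`. -/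
def nuM (ω : ℂ) (M : Sp2) : ℕ := Module.finrank ℂ (LinearMap.ker (shiftMat ω M).toLin')

/-- `Sp(2)_ω^0`, the set of `ω`-degenerate matrices. -/
def Sp0 (ω : ℂ) : Set Sp2 := {M | Dfun ω M = 0}

/-- The rate of change of `D_ω` at `M` in the direction `d/dt (M exp(tJ))|_{t=0}`, which
orients `Sp(2)_ω^0` at its regular points, i.e. where this rate does not vanish. -/
def orientRate (ω : ℂ) (M : Sp2) : ℝ := deriv (fun s : ℝ => Dfun ω (M * rot s)) 0

/-- The rate of change of `D_ω` along the path `σ` at time `t`. -/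
def crossRate (ω : ℂ) {M N : Sp2} (σ : Path M N) (t : ℝ) : ℝ :=
  deriv (fun s : ℝ => Dfun ω (σ.extend s)) t

/-- The times at which the path `σ` meets `Sp(2)_ω^0`. -/
def crossings (ω : ℂ) {M N : Sp2} (σ : Path M N) : Set ℝ :=
  {t | t ∈ Ioo (0 : ℝ) 1 ∧ σ.extend t ∈ Sp0 ω}

/-- `σ` has its endpoints off `Sp(2)_ω^0` and meets `Sp(2)_ω^0` only transversally and at
regular points. (By compactness it then meets it only finitely often.) -/
def IsTransversal (ω : ℂ) {M N : Sp2} (σ : Path M N) : Prop :=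
  M ∉ Sp0 ω ∧ N ∉ Sp0 ω ∧
    ∀ t ∈ crossings ω σ, orientRate ω (σ.extend t) ≠ 0 ∧ crossRate ω σ t ≠ 0

/-- The signed number of crossings of a transversal path: a crossing counts `+1` if the path goes
through `Sp(2)_ω^0` to the side to which `M exp(tJ)`, `t > 0`, points, and `-1` otherwise. -/
def crossingNumber (ω : ℂ) {M N : Sp2} (σ : Path M N) : ℤ :=
  ∑ᶠ t ∈ crossings ω σ, (SignType.sign (orientRate ω (σ.extend t) * crossRate ω σ t) : ℤ)

/-- `k` is the homotopy intersection number `[Sp(2)_ω^0 : σ]`: the signed number of crossings of a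
transversal path homotopic to `σ` in `Sp(2)` with fixed endpoints. -/
def IsIntersectionNumber (ω : ℂ) {M N : Sp2} (σ : Path M N) (k : ℤ) : Prop :=
  ∃ τ : Path M N, σ.Homotopic τ ∧ IsTransversal ω τ ∧ crossingNumber ω τ = k

/-- The diagonal matrix `D(a) = diag(a, a⁻¹)` (for `a ≠ 0`). -/
def diagM (a : ℝ) (ha : a ≠ 0) : Sp2 :=
  ⟨!![a, 0; 0, a⁻¹], by rw [Matrix.det_fin_two_of]; simp [ha]⟩

/-- The path `ξ` from `diag(2, 1/2)` to `I`, with time rescaled from `[0,2π]` to `[0,1]`: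
`ξ(s) = diag(2 - s, (2 - s)⁻¹)`. -/
def xi : Path (diagM 2 two_ne_zero) (1 : Sp2) where
  toFun s := diagM (2 - (s : ℝ)) (by have := s.2.2; linarith)
  continuous_toFun := by
    refine Continuous.subtype_mk ?_ _
    refine continuous_matrix fun i j => ?_
    have h : Continuous fun s : unitInterval => (2 - (s : ℝ))⁻¹ :=
      (continuous_const.sub continuous_subtype_val).inv₀
        (fun s => by have h2 : 0 < 2 - (s : ℝ) := (by have := s.2.2; linarith)
                     exact h2.ne')
    fin_cases i <;> fin_cases j <;> simp <;> fun_prop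
  source' := by ext i j; fin_cases i <;> fin_cases j <;> simp [diagM]
  target' := by ext i j; fin_cases i <;> fin_cases j <;> simp [diagM] <;> norm_num

lemma continuous_rot : Continuous rot := by
  refine Continuous.subtype_mk ?_ _
  refine continuous_matrix fun i j => ?_
  fin_cases i <;> fin_cases j <;> simp <;> fun_prop

lemma rot_zero : rot 0 = 1 := by
  ext i j; fin_cases i <;> fin_cases j <;> simp [rot]

/-- The left rotation perturbation `p_{-ε}(s) = p(s) exp(-ε s J)` of a path starting at `I`. -/
def leftRot {M : Sp2} (p : Path (1 : Sp2) M) (ε : ℝ) : Path (1 : Sp2) (M * rot (-ε)) where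
  toFun s := p s * rot (-(ε * s))
  continuous_toFun := p.continuous.mul (continuous_rot.comp (by fun_prop))
  source' := by simp [rot_zero]
  target' := by simp

/-- `k` is the `ω`-index `i_ω(p)` of a path `p` in `Sp(2)` starting at `I`. If `p` is
`ω`-nondegenerate it is the intersection number `[Sp(2)_ω^0 : p ∗ ξ]`, where `p ∗ ξ` runs through
`ξ` first; if `p` is `ω`-degenerate it is the index of the left rotation perturbation `p_{-ε}`
for all small `ε > 0`. -/
def IsOmegaIndex (ω : ℂ) {M : Sp2} (p : Path (1 : Sp2) M) (k : ℤ) : Prop :=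
  (M ∉ Sp0 ω ∧ IsIntersectionNumber ω (xi.trans p) k) ∨
  (M ∈ Sp0 ω ∧ ∀ᶠ ε : ℝ in 𝓝[>] 0,
    M * rot (-ε) ∉ Sp0 ω ∧ IsIntersectionNumber ω (xi.trans (leftRot p ε)) k)

open scoped Classical in
/-- The `ω`-index `i_ω(p)`. -/
def omegaIndex (ω : ℂ) {M : Sp2} (p : Path (1 : Sp2) M) : ℤ :=
  if h : ∃ k, IsOmegaIndex ω p k then h.choose else 0

/-! ### The fundamental solution `γ_{β,e}` -/

/-- The coefficient matrix `B_{β,e}(t)`. -/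
def Bmat (β e t : ℝ) : Matrix (Fin 2) (Fin 2) ℝ :=
  !![1, 0; 0, 1 - β / (1 + e * Real.cos t)]

/-- `γ` solves `γ' = J B_{β,e} γ`, `γ(0) = I` on `[0,2π]`. -/
structure IsFundamentalSolution (β e : ℝ) (γ : ℝ → Matrix (Fin 2) (Fin 2) ℝ) : Prop where
  init : γ 0 = 1
  ode : ∀ t ∈ Icc (0 : ℝ) (2 * π), ∀ i j, HasDerivWithinAt (fun s => γ s i j)
    ((J2 * Bmat β e t * γ t) i j) (Icc 0 (2 * π)) t

/-- Truncation of a real number to `[-R, R]`. -/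
def clip (R y : ℝ) : ℝ := max (-R) (min R y)

lemma clip_lip (R x y : ℝ) : |clip R x - clip R y| ≤ |x - y| := by
  unfold clip
  rw [max_comm (-R), max_comm (-R), min_comm R, min_comm R]
  exact (abs_max_sub_max_le_abs _ _ _).trans (abs_min_sub_min_le_max x R y R |>.trans (by simp))

lemma clip_le (R y : ℝ) (hR : 0 ≤ R) : |clip R y| ≤ R := by
  unfold clip
  rw [abs_le]
  exact ⟨le_max_left _ _, max_le (by linarith) (min_le_left _ _)⟩

lemma clip_eq (R y : ℝ) (h : |y| ≤ R) : clip R y = y := by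
  unfold clip
  rw [abs_le] at h
  rw [min_eq_right h.2, max_eq_right h.1]

lemma clip_abs (R y : ℝ) (hR : 0 ≤ R) : |clip R y| ≤ |y| := by
  have := clip_lip R y 0
  rwa [clip_eq R 0 (by simpa using hR), sub_zero, sub_zero] at this

/-- Existence on `[0,T]` for the linear equation `v' = k x`, `x' = v`. -/
lemma exists_linear_solution (k : ℝ → ℝ) (hk : Continuous k) (T : ℝ) (hT : 0 ≤ T)
    (v₀ x₀ : ℝ) : ∃ v x : ℝ → ℝ, v 0 = v₀ ∧ x 0 = x₀ ∧ ∀ t ∈ Icc 0 T,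
      HasDerivWithinAt v (k t * x t) (Icc 0 T) t ∧ HasDerivWithinAt x (v t) (Icc 0 T) t := by
  obtain ⟨C₀, hC₀⟩ := isCompact_Icc.exists_bound_of_continuousOn
    (s := Icc 0 T) hk.continuousOn
  set C : ℝ := max C₀ 1
  have hC1 : 1 ≤ C := le_max_right _ _
  have hC0 : 0 ≤ C := by linarith
  have hC : ∀ t ∈ Icc 0 T, |k t| ≤ C := fun t ht => (hC₀ t ht).trans (le_max_left _ _)
  set z₀ : ℝ × ℝ := (v₀, x₀)
  set R : ℝ := ‖z₀‖ * Real.exp (C * T)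
  have hR : 0 ≤ R := by positivity
  let f : ℝ → ℝ × ℝ → ℝ × ℝ := fun t z => (k t * clip R z.2, clip R z.1)
  have hbd : ∀ t ∈ Icc 0 T, ∀ z, ‖f t z‖ ≤ C * R := by
    intro t ht z
    rw [Prod.norm_def]
    refine max_le ?_ ?_
    · rw [Real.norm_eq_abs, abs_mul]
      exact mul_le_mul (hC t ht) (clip_le R _ hR) (abs_nonneg _) hC0
    · exact (clip_le R _ hR).trans (by nlinarith)
  have hgr : ∀ t ∈ Icc 0 T, ∀ z, ‖f t z‖ ≤ C * ‖z‖ := by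
    intro t ht z
    rw [Prod.norm_def]
    have h1 : |z.1| ≤ ‖z‖ := norm_fst_le z
    have h2 : |z.2| ≤ ‖z‖ := norm_snd_le z
    refine max_le ?_ ?_
    · rw [Real.norm_eq_abs, abs_mul]
      exact mul_le_mul (hC t ht) ((clip_abs R _ hR).trans h2) (abs_nonneg _) hC0
    · exact ((clip_abs R _ hR).trans h1).trans (by nlinarith [norm_nonneg z])
  have hPL : IsPicardLindelof f (tmin := 0) (tmax := T) ⟨0, le_rfl, hT⟩ z₀
      ⟨C * R * T, by positivity⟩ 0 ⟨C * R, by positivity⟩ ⟨C, hC0⟩ := by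
    refine ⟨fun t ht => ?_, fun z _ => ?_, fun t ht z _ => hbd t ht z, ?_⟩
    · refine (LipschitzWith.of_dist_le_mul fun z y => ?_).lipschitzOnWith
      have h1 : |z.1 - y.1| ≤ ‖z - y‖ := norm_fst_le (z - y)
      have h2 : |z.2 - y.2| ≤ ‖z - y‖ := norm_snd_le (z - y)
      rw [dist_eq_norm, dist_eq_norm, Prod.norm_def]
      refine max_le ?_ ?_
      · change |k t * clip R z.2 - k t * clip R y.2| ≤ C * ‖z - y‖
        rw [← mul_sub, abs_mul]
        exact mul_le_mul (hC t ht) ((clip_lip R _ _).trans h2) (abs_nonneg _) hC0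
      · change |clip R z.1 - clip R y.1| ≤ C * ‖z - y‖
        exact ((clip_lip R _ _).trans h1).trans (by nlinarith [norm_nonneg (z - y)])
    · exact ((hk.mul continuous_const).prodMk continuous_const).continuousOn
    · have : max (T - 0) (0 - 0 : ℝ) = T := by simp [hT]
      change C * R * max (T - 0) (0 - 0 : ℝ) ≤ C * R * T - 0
      rw [this, sub_zero]
  obtain ⟨α, hα0, hα⟩ := hPL.exists_eq_forall_mem_Icc_hasDerivWithinAt₀
  change α 0 = z₀ at hα0
  have hαR : ∀ t ∈ Icc 0 T, ‖α t‖ ≤ R := by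
    intro t ht
    have h1 := norm_le_gronwallBound_of_norm_deriv_right_le (f := α)
      (f' := fun t => f t (α t)) (δ := ‖z₀‖) (K := C) (ε := 0) (a := 0) (b := T)
      (fun t ht => (hα t ht).continuousWithinAt)
      (fun t ht => (hα t (Ico_subset_Icc_self ht)).mono_of_mem_nhdsWithin
        (Icc_mem_nhdsGE_of_mem ht))
      (by rw [hα0])
      (fun t ht => by simpa using hgr t (Ico_subset_Icc_self ht) (α t)) t ht
    rw [gronwallBound_ε0, sub_zero] at h1
    refine h1.trans ?_
    have : C * t ≤ C * T := mul_le_mul_of_nonneg_left ht.2 hC0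
    exact mul_le_mul_of_nonneg_left (Real.exp_le_exp.2 this) (norm_nonneg _)
  refine ⟨fun t => (α t).1, fun t => (α t).2, by simp [hα0, z₀], by simp [hα0, z₀],
    fun t ht => ?_⟩
  have h1 : clip R (α t).1 = (α t).1 := clip_eq _ _ ((norm_fst_le _).trans (hαR t ht))
  have h2 : clip R (α t).2 = (α t).2 := clip_eq _ _ ((norm_snd_le _).trans (hαR t ht))
  have hd := hα t ht
  have hf : f t (α t) = (k t * (α t).2, (α t).1) := by simp only [f, h1, h2]
  rw [hf] at hd
  exact ⟨hd.fst, hd.snd⟩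

lemma denom_pos {e : ℝ} (he : e ∈ Ico (0 : ℝ) 1) (t : ℝ) : 0 < 1 + e * Real.cos t := by
  nlinarith [Real.neg_one_le_cos t, he.1, he.2]

lemma JB_mul (β e t : ℝ) (M : Matrix (Fin 2) (Fin 2) ℝ) : J2 * Bmat β e t * M =
    !![-(1 - β / (1 + e * Real.cos t)) * M 1 0, -(1 - β / (1 + e * Real.cos t)) * M 1 1;
      M 0 0, M 0 1] := by
  ext i j
  revert i j
  simp [Fin.forall_fin_two, J2, Bmat, Matrix.mul_apply, Fin.sum_univ_two]

lemma exists_fundamentalSolution (β : ℝ) {e : ℝ} (he : e ∈ Ico (0 : ℝ) 1) :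
    ∃ γ, IsFundamentalSolution β e γ := by
  have hk : Continuous fun t => -(1 - β / (1 + e * Real.cos t)) :=
    (continuous_const.sub (continuous_const.div (by fun_prop)
      fun t => (denom_pos he t).ne')).neg
  obtain ⟨a, c, ha, hc, h⟩ := exists_linear_solution _ hk (2 * π) two_pi_nonneg 1 0
  obtain ⟨b, d, hb, hd, h'⟩ := exists_linear_solution _ hk (2 * π) two_pi_nonneg 0 1
  refine ⟨fun t => !![a t, b t; c t, d t], ?_, fun t ht i j => ?_⟩
  · ext i j; fin_cases i <;> fin_cases j <;> simp [ha, hb, hc, hd]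
  · have h1 := h t ht
    have h2 := h' t ht
    rw [JB_mul]
    revert i j
    simp only [Fin.forall_fin_two]
    exact ⟨⟨h1.1, h2.1⟩, ⟨h1.2, h2.2⟩⟩

lemma IsFundamentalSolution.continuousOn {β e : ℝ} {γ : ℝ → Matrix (Fin 2) (Fin 2) ℝ}
    (h : IsFundamentalSolution β e γ) (i j : Fin 2) :
    ContinuousOn (fun t => γ t i j) (Icc 0 (2 * π)) :=
  fun t ht => (h.ode t ht i j).continuousWithinAt

lemma IsFundamentalSolution.det {β e : ℝ} {γ : ℝ → Matrix (Fin 2) (Fin 2) ℝ}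
    (h : IsFundamentalSolution β e γ) {t : ℝ} (ht : t ∈ Icc (0 : ℝ) (2 * π)) :
    (γ t).det = 1 := by
  have hd : ∀ s ∈ Icc (0 : ℝ) (2 * π),
      HasDerivWithinAt (fun s => (γ s).det) 0 (Icc 0 (2 * π)) s := by
    intro s hs
    have := ((h.ode s hs 0 0).mul (h.ode s hs 1 1)).sub ((h.ode s hs 0 1).mul (h.ode s hs 1 0))
    simp only [Matrix.det_fin_two]
    refine this.congr_deriv ?_
    simp only [JB_mul, Matrix.of_apply, Matrix.cons_val', Matrix.cons_val_zero,
      Matrix.cons_val_one, Matrix.cons_val_fin_one]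
    ring
  have := constant_of_has_deriv_right_zero (f := fun s => (γ s).det) (a := 0) (b := 2 * π)
    (fun s hs => (hd s hs).continuousWithinAt)
    (fun s hs => (hd s (Ico_subset_Icc_self hs)).mono_of_mem_nhdsWithin
      (Icc_mem_nhdsGE_of_mem hs)) t ht
  simpa [h.init] using this

/-- The fundamental solution `γ_{β,e}` on `[0,2π]`. -/
def fundSol (β : ℝ) {e : ℝ} (he : e ∈ Ico (0 : ℝ) 1) : ℝ → Matrix (Fin 2) (Fin 2) ℝ :=
  (exists_fundamentalSolution β he).choose

lemma fundSol_spec (β : ℝ) {e : ℝ} (he : e ∈ Ico (0 : ℝ) 1) :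
    IsFundamentalSolution β e (fundSol β he) :=
  (exists_fundamentalSolution β he).choose_spec

lemma scaled_mem (s : unitInterval) : 2 * π * (s : ℝ) ∈ Icc (0 : ℝ) (2 * π) :=
  ⟨mul_nonneg two_pi_nonneg s.2.1, mul_le_of_le_one_right two_pi_nonneg s.2.2⟩

/-- `γ_{β,e}(2π)`. -/
def monodromy (β : ℝ) {e : ℝ} (he : e ∈ Ico (0 : ℝ) 1) : Sp2 :=
  ⟨fundSol β he (2 * π), (fundSol_spec β he).det ⟨two_pi_nonneg, le_rfl⟩⟩

/-- `γ_{β,e}` as a path in `Sp(2)`, with time rescaled from `[0,2π]` to `[0,1]`. -/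
def gammaPath (β : ℝ) {e : ℝ} (he : e ∈ Ico (0 : ℝ) 1) : Path (1 : Sp2) (monodromy β he) where
  toFun s := ⟨fundSol β he (2 * π * s), (fundSol_spec β he).det (scaled_mem s)⟩
  continuous_toFun := by
    refine Continuous.subtype_mk ?_ _
    refine continuous_matrix fun i j => ?_
    exact ((fundSol_spec β he).continuousOn i j).comp_continuous (by fun_prop) scaled_mem
  source' := by
    apply Subtype.ext
    simp [(fundSol_spec β he).init]
  target' := by
    apply Subtype.ext
    simp [monodromy]

/-- The index `i_ω(γ_{β,e})`. -/
def iGamma (ω : ℂ) (β : ℝ) {e : ℝ} (he : e ∈ Ico (0 : ℝ) 1) : ℤ :=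
  omegaIndex ω (gammaPath β he)

/-- The nullity `ν_ω(γ_{β,e}) = ν_ω(γ_{β,e}(2π))`. -/
def nuGamma (ω : ℂ) (β : ℝ) {e : ℝ} (he : e ∈ Ico (0 : ℝ) 1) : ℕ := nuM ω (monodromy β he)

end SturmIndex

end

/-!
Two independent arguments, one for the paths `γ_{β,e}` and one for the operators `A(β,e)`.

*The index.* Identify `ℝ²` with `ℂ` and write `M ∈ Sp(2)` as `v ↦ c v + ζ v̄`, where
`|c|² = 1 + |ζ|²`. Then `ω̄ det(M - ω) = 2 (Re ω - Re c)`, the co-orienting direction is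
multiplication of `c` by `e^{is}`, and `(arg c, ζ)` are coordinates on the universal covering. A
path is determined up to homotopy by its total angle (`IsAngle.end_eq`, `IsAngle.homotopic`), and
numbering the components of the complement of `{Re c = Re ω}` in the covering by an integer `level`
turns the signed number of crossings into the level of the end point (`crossingNumber_eq`,
`isIntersectionNumber_iff`). Hence the `ω`-index is the limit of the level from below in the angle
(`isOmegaIndex_of_eventually`).

A solution of `ÿ = -q y` with `q = 1 - β/(1 + e cos t)` has a Prüfer angle, whose end value
decreases strictly in `β` by Sturm comparison (`turn_lt_turn`). For `β = 0` each direction turns by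
`2π`. For `β = 1` the positive periodic solution `1 + e cos t` shows that the monodromy is a shear,
with small positive angle. For `0 < β < 1` all directions turn by angles in `(0, 2π)`, which leaves
the values `0, 1, 2` for the index. Where all directions turn by less than `π`, or all by more than
`π`, the trace is strictly monotone in `β` (`trace_lt_trace`), and so the value `0` persists for
larger `β` and the value `2` for smaller `β` (`lower_persists`, `upper_persists`).

*The operator.* On `W^{2,2}` with quasi-periodic boundary values the form of `A(β,e)` is
`∫ |u'|² - q |u|²` (`re_inner_opA`), which increases with `β`, so the Morse index is non-increasing
(`antitone_phi`). For `β = 0` it is bounded above by Wirtinger's inequality (`phi_zero_le`). Test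
functions give lower bounds: for `ω = 1` the function `1 + e cos t`, mapped by `A(β,e)` to the
constant `β - 1`, and for `ω = e^{2πis} ≠ 1` the exponentials `e^{ist}` and `e^{i(s-1)t}`. For
`β = 1` the form is a square, `∫ |u' - (p'/p) u|²` with `p = 1 + e cos t` (`integral_jacobi`), and
for `ω ≠ 1` it is coercive (`exists_coercive`), which makes the form nonnegative for `β` close to
one. A periodic kernel function for `0 < β < 1` is orthogonal to the constants, and Wirtinger's
inequality forces it to vanish (`nuA_one`).
-/

noncomputable section

namespace SturmIndex

/-! ### Complex coordinates on `Sp(2)` -/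

/-- The complex linear part `c` of `M ∈ Sp(2)`: identifying `ℝ²` with `ℂ`, `M` is the map
`v ↦ c v + ζ v̄` with `ζ = antiPart M`. -/
def linPart (M : Sp2) : ℂ := ⟨(M 0 0 + M 1 1) / 2, (M 1 0 - M 0 1) / 2⟩

/-- The conjugate linear part `ζ` of `M ∈ Sp(2)`; see `linPart`. -/
def antiPart (M : Sp2) : ℂ := ⟨(M 0 0 - M 1 1) / 2, (M 0 1 + M 1 0) / 2⟩

lemma Sp2.det_eq (M : Sp2) : M 0 0 * M 1 1 - M 0 1 * M 1 0 = 1 := by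
  have h := M.2
  rwa [Matrix.det_fin_two] at h

lemma norm_linPart_sq (M : Sp2) : ‖linPart M‖ ^ 2 = 1 + ‖antiPart M‖ ^ 2 := by
  rw [← Complex.normSq_eq_norm_sq, ← Complex.normSq_eq_norm_sq]
  simp only [Complex.normSq_apply, linPart, antiPart]
  linear_combination M.det_eq

lemma one_le_norm_linPart (M : Sp2) : 1 ≤ ‖linPart M‖ := by
  nlinarith [norm_linPart_sq M, norm_nonneg (linPart M), sq_nonneg ‖antiPart M‖]

lemma linPart_ne_zero (M : Sp2) : linPart M ≠ 0 :=
  norm_pos_iff.1 (zero_lt_one.trans_le (one_le_norm_linPart M))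

lemma continuous_entry (i j : Fin 2) : Continuous fun M : Sp2 => M i j :=
  (continuous_apply_apply i j).comp continuous_subtype_val

lemma continuous_linPart : Continuous linPart := by
  have h : linPart = fun M : Sp2 => (((M 0 0 + M 1 1) / 2 : ℝ) : ℂ) +
      (((M 1 0 - M 0 1) / 2 : ℝ) : ℂ) * Complex.I := by
    funext M; apply Complex.ext <;> simp [linPart]
  rw [h]
  have := continuous_entry
  fun_prop

lemma continuous_antiPart : Continuous antiPart := by
  have h : antiPart = fun M : Sp2 => (((M 0 0 - M 1 1) / 2 : ℝ) : ℂ) +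
      (((M 0 1 + M 1 0) / 2 : ℝ) : ℂ) * Complex.I := by
    funext M; apply Complex.ext <;> simp [antiPart]
  rw [h]
  have := continuous_entry
  fun_prop

lemma Sp2.ext_parts {M N : Sp2} (h1 : linPart M = linPart N) (h2 : antiPart M = antiPart N) :
    M = N := by
  have a := congrArg Complex.re h1
  have b := congrArg Complex.im h1
  have c := congrArg Complex.re h2
  have d := congrArg Complex.im h2
  simp only [linPart, antiPart] at a b c d
  ext i j
  fin_cases i <;> fin_cases j <;> simp <;> linarith

lemma Sp2.mul_apply (M N : Sp2) (i j : Fin 2) :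
    (M * N) i j = M i 0 * N 0 j + M i 1 * N 1 j := by
  change (M.1 * N.1) i j = _
  rw [Matrix.mul_apply, Fin.sum_univ_two]

lemma linPart_mul_rot (M : Sp2) (s : ℝ) :
    linPart (M * rot s) = linPart M * Complex.exp (s * Complex.I) := by
  apply Complex.ext <;>
  simp only [linPart, Sp2.mul_apply] <;> simp [rot, Complex.exp_ofReal_mul_I_re,
    Complex.exp_ofReal_mul_I_im] <;> ring

lemma linPart_one : linPart 1 = 1 := by
  apply Complex.ext <;> simp [linPart]

lemma Dfun_eq {ω : ℂ} (hω : ‖ω‖ = 1) (M : Sp2) : Dfun ω M = 2 * (ω.re - (linPart M).re) := by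
  have h1 : ω.re * ω.re + ω.im * ω.im = 1 := by
    rw [← Complex.normSq_apply, Complex.normSq_eq_norm_sq, hω]; norm_num
  have h2 := M.det_eq
  simp [Dfun, shiftMat, Matrix.det_fin_two, linPart]
  linear_combination ω.re * h2 + (ω.re - M.1 0 0 - M.1 1 1) * h1

lemma mem_Sp0_iff {ω : ℂ} (hω : ‖ω‖ = 1) (M : Sp2) : M ∈ Sp0 ω ↔ (linPart M).re = ω.re := by
  simp only [Sp0, mem_ofPred_eq, Dfun_eq hω]
  constructor <;> intro h <;> linarith

lemma orientRate_eq {ω : ℂ} (hω : ‖ω‖ = 1) (M : Sp2) :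
    orientRate ω M = 2 * (linPart M).im := by
  have h : (fun s : ℝ => Dfun ω (M * rot s)) = fun s : ℝ =>
      2 * (ω.re - ((linPart M).re * Real.cos s - (linPart M).im * Real.sin s)) := by
    funext s
    rw [Dfun_eq hω, linPart_mul_rot]
    simp [Complex.exp_ofReal_mul_I_re, Complex.exp_ofReal_mul_I_im]
  rw [orientRate, h]
  simp

/-! ### Angles along paths, and homotopy classes -/

/-- `θ` is a continuous choice of the argument of the complex linear part along `σ`. -/
def IsAngle {M N : Sp2} (σ : Path M N) (θ : unitInterval → ℝ) : Prop :=
  Continuous θ ∧ ∀ t, linPart (σ t) = ‖linPart (σ t)‖ * Complex.exp (θ t * Complex.I)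

/-- The direction of the complex linear part, as a point of the circle. -/
def direction (M : Sp2) : Circle :=
  ⟨linPart M / ‖linPart M‖, by
    rw [← SetLike.mem_coe, Submonoid.coe_unitSphere, mem_sphere_zero_iff_norm, norm_div,
      Complex.norm_real, norm_norm, div_self (norm_ne_zero_iff.2 (linPart_ne_zero M))]⟩

lemma continuous_direction : Continuous direction := by
  refine Continuous.subtype_mk (continuous_linPart.div ?_ fun M => ?_) _
  · exact Complex.continuous_ofReal.comp continuous_linPart.norm
  · exact_mod_cast norm_ne_zero_iff.2 (linPart_ne_zero M)

lemma linPart_eq_iff (M : Sp2) (φ : ℝ) :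
    linPart M = ‖linPart M‖ * Complex.exp (φ * Complex.I) ↔ direction M = Circle.exp φ := by
  have h : (‖linPart M‖ : ℂ) ≠ 0 := by exact_mod_cast norm_ne_zero_iff.2 (linPart_ne_zero M)
  rw [Circle.ext_iff, Circle.coe_exp]
  change _ ↔ linPart M / ‖linPart M‖ = _
  rw [div_eq_iff h, mul_comm]

lemma exists_angle {M N : Sp2} (σ : Path M N) {φ₀ : ℝ}
    (h : linPart M = ‖linPart M‖ * Complex.exp (φ₀ * Complex.I)) :
    ∃ θ, IsAngle σ θ ∧ θ 0 = φ₀ := by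
  have h0 : (⟨fun t => direction (σ t), continuous_direction.comp σ.continuous⟩ :
      C(unitInterval, Circle)) 0 = Circle.exp φ₀ := by
    simpa using (linPart_eq_iff M φ₀).1 h
  obtain ⟨Γ, h1, h2⟩ := Circle.isCoveringMap_exp.exists_path_lifts _ φ₀ h0
  refine ⟨Γ, ⟨Γ.continuous, fun t => ?_⟩, h2⟩
  rw [linPart_eq_iff]
  exact (congrFun h1 t).symm

/-- Homotopy lifting: the total angle is an invariant of the homotopy class. -/
lemma IsAngle.end_eq {M N : Sp2} {σ τ : Path M N} (hh : σ.Homotopic τ)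
    {θ θ' : unitInterval → ℝ} (h : IsAngle σ θ) (h' : IsAngle τ θ') (h0 : θ 0 = θ' 0) :
    θ 1 = θ' 1 := by
  let D : C(Sp2, Circle) := ⟨direction, continuous_direction⟩
  have key : (D.comp σ.toContinuousMap).HomotopicRel (D.comp τ.toContinuousMap) {0, 1} :=
    ContinuousMap.HomotopicRel.comp_continuousMap hh D
  have e1 : (D.comp σ.toContinuousMap) 0 = Circle.exp (θ 0) := (linPart_eq_iff _ _).1 (h.2 0)
  have e2 : (D.comp τ.toContinuousMap) 0 = Circle.exp (θ 0) := by
    rw [h0]; exact (linPart_eq_iff _ _).1 (h'.2 0)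
  have l1 := (Circle.isCoveringMap_exp.eq_liftPath_iff (γ_0 := e1) (Γ := θ)).2
    ⟨h.1, funext fun t => ((linPart_eq_iff _ _).1 (h.2 t)).symm, rfl⟩
  have l2 := (Circle.isCoveringMap_exp.eq_liftPath_iff (γ_0 := e2) (Γ := θ')).2
    ⟨h'.1, funext fun t => ((linPart_eq_iff _ _).1 (h'.2 t)).symm, h0.symm⟩
  rw [l1, l2]
  exact Circle.isCoveringMap_exp.liftPath_apply_one_eq_of_homotopicRel key _ e1 e2

/-- The universal covering `ℝ × ℂ → Sp(2)`: the matrix whose complex linear part has argument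
`p.1` and whose conjugate linear part is `p.2`. -/
def ofPolar (p : ℝ × ℂ) : Sp2 :=
  ⟨!![√(1 + ‖p.2‖ ^ 2) * Real.cos p.1 + p.2.re, p.2.im - √(1 + ‖p.2‖ ^ 2) * Real.sin p.1;
      p.2.im + √(1 + ‖p.2‖ ^ 2) * Real.sin p.1, √(1 + ‖p.2‖ ^ 2) * Real.cos p.1 - p.2.re], by
    have h1 : √(1 + ‖p.2‖ ^ 2) ^ 2 = 1 + ‖p.2‖ ^ 2 := Real.sq_sqrt (by positivity)
    have h2 : ‖p.2‖ ^ 2 = p.2.re * p.2.re + p.2.im * p.2.im := by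
      rw [← Complex.normSq_eq_norm_sq, Complex.normSq_apply]
    rw [Matrix.det_fin_two_of]
    linear_combination √(1 + ‖p.2‖ ^ 2) ^ 2 * Real.sin_sq_add_cos_sq p.1 + h1 + h2⟩

lemma continuous_ofPolar : Continuous ofPolar := by
  refine Continuous.subtype_mk (continuous_matrix fun i j => ?_) _
  have := Complex.continuous_re
  have := Complex.continuous_im
  fin_cases i <;> fin_cases j <;> simp <;> fun_prop

lemma linPart_ofPolar (p : ℝ × ℂ) :
    linPart (ofPolar p) = √(1 + ‖p.2‖ ^ 2) * Complex.exp (p.1 * Complex.I) := by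
  apply Complex.ext <;>
  simp [linPart, ofPolar, Complex.exp_ofReal_mul_I_re, Complex.exp_ofReal_mul_I_im]

lemma antiPart_ofPolar (p : ℝ × ℂ) : antiPart (ofPolar p) = p.2 := by
  apply Complex.ext <;> simp [antiPart, ofPolar]

lemma sqrt_one_add_norm_antiPart (M : Sp2) : √(1 + ‖antiPart M‖ ^ 2) = ‖linPart M‖ := by
  rw [← norm_linPart_sq, Real.sqrt_sq (norm_nonneg _)]

lemma ofPolar_antiPart {M : Sp2} {φ : ℝ}
    (h : linPart M = ‖linPart M‖ * Complex.exp (φ * Complex.I)) :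
    ofPolar (φ, antiPart M) = M := by
  refine Sp2.ext_parts ?_ (antiPart_ofPolar _)
  rw [linPart_ofPolar, sqrt_one_add_norm_antiPart]
  exact h.symm

/-- Two paths with the same endpoints and the same total angle are homotopic, by the image of the
straight line homotopy in the universal covering. -/
lemma IsAngle.homotopic {M N : Sp2} {σ τ : Path M N} {θ θ' : unitInterval → ℝ}
    (h : IsAngle σ θ) (h' : IsAngle τ θ') (h0 : θ 0 = θ' 0) (h1 : θ 1 = θ' 1) :
    σ.Homotopic τ := by
  have hc := h.1
  have hc' := h'.1
  have co : Continuous fun x : ℝ => (x : ℂ) := Complex.continuous_ofReal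
  have cσ : Continuous fun t => antiPart (σ t) := continuous_antiPart.comp σ.continuous
  have cτ : Continuous fun t => antiPart (τ t) := continuous_antiPart.comp τ.continuous
  refine ⟨⟨⟨⟨fun q => ofPolar ((1 - (q.1 : ℝ)) * θ q.2 + (q.1 : ℝ) * θ' q.2,
      (1 - ((q.1 : ℝ) : ℂ)) * antiPart (σ q.2) + ((q.1 : ℝ) : ℂ) * antiPart (τ q.2)), ?_⟩,
    fun t => ?_, fun t => ?_⟩, fun s t ht => ?_⟩⟩
  · have c1 := hc.comp (continuous_snd (X := unitInterval) (Y := unitInterval))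
    have c2 := hc'.comp (continuous_snd (X := unitInterval) (Y := unitInterval))
    have c3 := cσ.comp (continuous_snd (X := unitInterval) (Y := unitInterval))
    have c4 := cτ.comp (continuous_snd (X := unitInterval) (Y := unitInterval))
    have c5 := continuous_subtype_val.comp (continuous_fst (X := unitInterval) (Y := unitInterval))
    have c6 := co.comp c5
    exact continuous_ofPolar.comp ((((continuous_const.sub c5).mul c1).add (c5.mul c2)).prodMk
      (((continuous_const.sub c6).mul c3).add (c6.mul c4)))
  · simpa using ofPolar_antiPart (h.2 t)
  · simpa using ofPolar_antiPart (h'.2 t)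
  · rcases ht with rfl | rfl
    · have := ofPolar_antiPart (h.2 0)
      simp only [Path.source] at this
      simpa [← h0, ← add_mul] using this
    · have := ofPolar_antiPart (h.2 1)
      simp only [Path.target] at this
      simpa [← h1, ← add_mul] using this

/-! ### The level function and its jumps -/

/-- The number of the component of the complement of the lifted wall `{x = κ}` in the universal
covering of `Sp(2)` that contains a point with real part `x` and angle `φ` of its complex linear
part. The components are numbered in the direction of increasing angle; the even ones are
those with `x > κ`. -/
def level (κ x φ : ℝ) : ℤ :=
  if κ < x then 2 * round (φ / (2 * π)) else 2 * ⌊φ / (2 * π)⌋ + 1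

lemma round_angle {φ : ℝ} {k : ℤ} (h1 : 2 * π * k - π < φ) (h2 : φ < 2 * π * k + π) :
    round (φ / (2 * π)) = k := by
  have hp : 0 < 2 * π := by positivity
  rw [round_eq, Int.floor_eq_iff]
  constructor
  · have : (k : ℝ) - 1 / 2 < φ / (2 * π) := by rw [lt_div_iff₀ hp]; linarith
    linarith
  · have : φ / (2 * π) < k + 1 / 2 := by rw [div_lt_iff₀ hp]; linarith
    linarith

lemma floor_angle {φ : ℝ} {k : ℤ} (h1 : 2 * π * k ≤ φ) (h2 : φ < 2 * π * k + 2 * π) :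
    ⌊φ / (2 * π)⌋ = k := by
  have hp : 0 < 2 * π := by positivity
  rw [Int.floor_eq_iff]
  constructor
  · rw [le_div_iff₀ hp]; linarith
  · rw [div_lt_iff₀ hp]; linarith

lemma exists_angle_mem_Ico (φ : ℝ) :
    ∃ k : ℤ, 2 * π * k ≤ φ ∧ φ < 2 * π * k + 2 * π := by
  have hp : 0 < 2 * π := by positivity
  refine ⟨⌊φ / (2 * π)⌋, ?_, ?_⟩
  · have := Int.floor_le (φ / (2 * π)); rw [le_div_iff₀ hp] at this; linarith
  · have := Int.lt_floor_add_one (φ / (2 * π)); rw [div_lt_iff₀ hp] at this; linarith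

lemma cos_sub_angle (φ : ℝ) (k : ℤ) : Real.cos (φ - 2 * π * k) = Real.cos φ := by
  rw [mul_comm (2 * π)]; exact Real.cos_sub_int_mul_two_pi φ k

lemma sin_sub_angle (φ : ℝ) (k : ℤ) : Real.sin (φ - 2 * π * k) = Real.sin φ := by
  rw [mul_comm (2 * π)]; exact Real.sin_sub_int_mul_two_pi φ k

lemma exists_angle_of_sin_pos {φ : ℝ} (h : 0 < Real.sin φ) :
    ∃ k : ℤ, 2 * π * k < φ ∧ φ < 2 * π * k + π := by
  obtain ⟨k, h1, h2⟩ := exists_angle_mem_Ico φ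
  rw [← sin_sub_angle φ k] at h
  refine ⟨k, ?_, ?_⟩
  · rcases h1.lt_or_eq with h' | h'
    · exact h'
    · rw [← h'] at h; simp at h
  · by_contra! h3
    have : Real.sin (φ - 2 * π * k) ≤ 0 := by
      rw [← Real.sin_sub_two_pi]
      exact Real.sin_nonpos_of_nonpos_of_neg_pi_le (by linarith) (by linarith)
    linarith

lemma exists_angle_of_sin_neg {φ : ℝ} (h : Real.sin φ < 0) :
    ∃ k : ℤ, 2 * π * k + π < φ ∧ φ < 2 * π * k + 2 * π := by
  have h' : 0 < Real.sin (φ - π) := by rw [Real.sin_sub_pi]; linarith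
  obtain ⟨k, h1, h2⟩ := exists_angle_of_sin_pos h'
  exact ⟨k, by linarith, by linarith⟩

lemma exists_angle_of_cos_ne_one {φ : ℝ} (h : Real.cos φ ≠ 1) :
    ∃ k : ℤ, 2 * π * k < φ ∧ φ < 2 * π * k + 2 * π := by
  obtain ⟨k, h1, h2⟩ := exists_angle_mem_Ico φ
  refine ⟨k, lt_of_le_of_ne h1 fun h' => h ?_, h2⟩
  rw [← cos_sub_angle φ k, ← h']; simp

lemma exists_angle_of_cos_ne_neg_one {φ : ℝ} (h : Real.cos φ ≠ -1) :
    ∃ k : ℤ, 2 * π * k - π < φ ∧ φ < 2 * π * k + π := by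
  have h' : Real.cos (φ + π) ≠ 1 := by
    rw [Real.cos_add_pi]; intro h'; exact h (by linarith)
  obtain ⟨k, h1, h2⟩ := exists_angle_of_cos_ne_one h'
  exact ⟨k, by linarith, by linarith⟩

/-- A function that is locally constant off a finite set and has prescribed jumps on it changes by
the sum of the jumps. -/
lemma sub_eq_sum_jumps (j : ℝ → ℤ) {a b : ℝ} (hab : a ≤ b) (S : Finset ℝ) :
    ∀ f : ℝ → ℤ, (∀ t ∈ S, t ∈ Ioo a b) →
    (∀ t ∈ Icc a b, t ∉ S → ∀ᶠ u in 𝓝 t, f u = f t) →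
    (∀ t ∈ S, ∃ v, (∀ᶠ u in 𝓝[<] t, f u = v) ∧ ∀ᶠ u in 𝓝[>] t, f u = v + j t) →
    f b - f a = ∑ t ∈ S, j t := by
  induction S using Finset.induction_on with
  | empty =>
    intro f _ hf _
    have hc : ContinuousOn f (Icc a b) := fun t ht =>
      (continuousAt_const.congr (EventuallyEq.symm (hf t ht (by simp)))).continuousWithinAt
    have := isPreconnected_Icc.constant hc (left_mem_Icc.2 hab) (right_mem_Icc.2 hab)
    simp [this]
  | insert s S hs ih =>
    intro f hS hf hj
    obtain ⟨v, hv1, hv2⟩ := hj s (Finset.mem_insert_self _ _)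
    -- remove the jump at `s`
    set g : ℝ → ℤ := fun t => if t < s then f t else if t = s then v else f t - j s with hg
    have hlt : ∀ t, t < s → ∀ᶠ u in 𝓝 t, g u = f u := fun t ht => by
      filter_upwards [Iio_mem_nhds ht] with u hu
      exact if_pos hu
    have hgt : ∀ t, s < t → ∀ᶠ u in 𝓝 t, g u = f u - j s := fun t ht => by
      filter_upwards [Ioi_mem_nhds ht] with u hu
      simp only [hg]
      rw [if_neg (not_lt.2 (le_of_lt hu)), if_neg (ne_of_gt hu)]
    have hsab := hS s (Finset.mem_insert_self _ _)
    have key := ih g (fun t ht => hS t (Finset.mem_insert_of_mem ht)) ?_ ?_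
    · rw [Finset.sum_insert hs, ← key, (hlt a hsab.1).self_of_nhds, (hgt b hsab.2).self_of_nhds]
      ring
    · intro t ht htS
      rcases lt_trichotomy t s with h | h | h
      · filter_upwards [hlt t h, hf t ht (by simp [h.ne, htS])] with u h1 h2
        rw [h1, h2, (hlt t h).self_of_nhds]
      · subst h
        have hgt' : g t = v := by simp [hg]
        rw [hgt', ← nhdsNE_sup_pure, ← Iio_union_Ioi, nhdsWithin_union, eventually_sup,
          eventually_sup]
        refine ⟨⟨?_, ?_⟩, ?_⟩
        · filter_upwards [hv1, self_mem_nhdsWithin] with u h1 h2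
          rw [← h1]; exact if_pos h2
        · filter_upwards [hv2, self_mem_nhdsWithin] with u h1 h2
          simp only [hg]
          rw [if_neg (not_lt.2 (le_of_lt h2)), if_neg (ne_of_gt h2), h1]; ring
        · simpa using hgt'
      · filter_upwards [hgt t h, hf t ht (by simp [h.ne', htS])] with u h1 h2
        rw [h1, h2, (hgt t h).self_of_nhds]
    · intro t ht
      have hne : t ≠ s := fun h => hs (h ▸ ht)
      obtain ⟨v', h1, h2⟩ := hj t (Finset.mem_insert_of_mem ht)
      rcases hne.lt_or_gt with h | h
      · refine ⟨v', ?_, ?_⟩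
        · filter_upwards [h1, (hlt t h).filter_mono nhdsWithin_le_nhds] with u a b
          rw [b, a]
        · filter_upwards [h2, (hlt t h).filter_mono nhdsWithin_le_nhds] with u a b
          rw [b, a]
      · refine ⟨v' - j s, ?_, ?_⟩
        · filter_upwards [h1, (hgt t h).filter_mono nhdsWithin_le_nhds] with u a b
          rw [b, a]
        · filter_upwards [h2, (hgt t h).filter_mono nhdsWithin_le_nhds] with u a b
          rw [b, a]; ring

/-- A zero with non-vanishing derivative is isolated, and the function changes sign there. -/
lemma eventually_of_deriv_pos {X : ℝ → ℝ} {κ t d : ℝ} (hX : HasDerivAt X d t) (h0 : X t = κ)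
    (hd : 0 < d) : (∀ᶠ u in 𝓝[<] t, X u < κ) ∧ ∀ᶠ u in 𝓝[>] t, κ < X u := by
  have h := (hasDerivAt_iff_tendsto_slope.1 hX).eventually (lt_mem_nhds hd)
  rw [← Iio_union_Ioi, nhdsWithin_union, eventually_sup] at h
  refine ⟨?_, ?_⟩
  · filter_upwards [h.1, self_mem_nhdsWithin] with u h1 h2
    rw [slope_def_field, div_pos_iff] at h1
    have : u < t := h2
    rcases h1 with h1 | h1 <;> linarith [h1.1, h1.2]
  · filter_upwards [h.2, self_mem_nhdsWithin] with u h1 h2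
    rw [slope_def_field, div_pos_iff] at h1
    have : t < u := h2
    rcases h1 with h1 | h1 <;> linarith [h1.1, h1.2]

lemma eventually_of_deriv_neg {X : ℝ → ℝ} {κ t d : ℝ} (hX : HasDerivAt X d t) (h0 : X t = κ)
    (hd : d < 0) : (∀ᶠ u in 𝓝[<] t, κ < X u) ∧ ∀ᶠ u in 𝓝[>] t, X u < κ := by
  have := eventually_of_deriv_pos (κ := -κ) hX.neg (by simp [h0]) (neg_pos.2 hd)
  simpa using this

section LevelAlongPath

variable {κ : ℝ} {R Θ : ℝ → ℝ}

/-- Off the wall the level is locally constant. -/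
lemma level_eventually_eq (hκ : κ ∈ Icc (-1 : ℝ) 1) (hR : ∀ t, 1 ≤ R t) (cR : Continuous R)
    (cΘ : Continuous Θ) {t : ℝ} (ht : R t * Real.cos (Θ t) ≠ κ) :
    ∀ᶠ u in 𝓝 t, level κ (R u * Real.cos (Θ u)) (Θ u) = level κ (R t * Real.cos (Θ t)) (Θ t) := by
  have cX : Continuous fun t => R t * Real.cos (Θ t) := by fun_prop
  rcases ht.lt_or_gt with h | h
  · have hc : Real.cos (Θ t) ≠ 1 := fun hc => by
      rw [hc] at h; linarith [hR t, hκ.2]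
    obtain ⟨k, h1, h2⟩ := exists_angle_of_cos_ne_one hc
    filter_upwards [cX.continuousAt.eventually (gt_mem_nhds h),
      cΘ.continuousAt.eventually (lt_mem_nhds h1), cΘ.continuousAt.eventually (gt_mem_nhds h2)]
      with u a b c
    rw [level, level, if_neg (not_lt.2 a.le), if_neg (not_lt.2 h.le), floor_angle b.le c,
      floor_angle h1.le h2]
  · have hc : Real.cos (Θ t) ≠ -1 := fun hc => by
      rw [hc] at h; linarith [hR t, hκ.1]
    obtain ⟨k, h1, h2⟩ := exists_angle_of_cos_ne_neg_one hc
    filter_upwards [cX.continuousAt.eventually (lt_mem_nhds h),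
      cΘ.continuousAt.eventually (lt_mem_nhds h1), cΘ.continuousAt.eventually (gt_mem_nhds h2)]
      with u a b c
    rw [level, level, if_pos a, if_pos h, round_angle b c, round_angle h1 h2]

/-- At a transversal crossing of a regular point of the wall the level jumps by one, upwards
exactly if the crossing is counterclockwise. -/
lemma level_jump (cΘ : Continuous Θ) {t : ℝ} (ht : R t * Real.cos (Θ t) = κ)
    (hs : Real.sin (Θ t) ≠ 0) (hd : deriv (fun t => R t * Real.cos (Θ t)) t ≠ 0) :
    ∃ v, (∀ᶠ u in 𝓝[<] t, level κ (R u * Real.cos (Θ u)) (Θ u) = v) ∧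
      ∀ᶠ u in 𝓝[>] t, level κ (R u * Real.cos (Θ u)) (Θ u) =
        v + (SignType.sign (-(Real.sin (Θ t) * deriv (fun t => R t * Real.cos (Θ t)) t)) : ℤ) := by
  have hX := (differentiableAt_of_deriv_ne_zero hd).hasDerivAt
  have up : ∀ {u x : ℝ} {k : ℤ}, 2 * π * k < u → u < 2 * π * k + π → κ < x →
      level κ x u = 2 * k := fun h1 h2 h3 => by
    rw [level, if_pos h3, round_angle (by linarith [Real.pi_pos]) h2]
  have lo : ∀ {u x : ℝ} {k : ℤ}, 2 * π * k + π < u → u < 2 * π * k + 2 * π → κ < x →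
      level κ x u = 2 * k + 2 := fun {u x k} h1 h2 h3 => by
    rw [level, if_pos h3, round_angle (k := k + 1) (by push_cast; linarith)
      (by push_cast; linarith [Real.pi_pos])]
    ring
  have ne : ∀ {u x : ℝ} {k : ℤ}, 2 * π * k < u → u < 2 * π * k + 2 * π → x < κ →
      level κ x u = 2 * k + 1 := fun h1 h2 h3 => by
    rw [level, if_neg (not_lt.2 h3.le), floor_angle h1.le h2]
  have near : ∀ {α β : ℝ} (s : Set ℝ), α < Θ t → Θ t < β →
      ∀ᶠ u in 𝓝[s] t, α < Θ u ∧ Θ u < β := fun s h1 h2 =>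
    ((cΘ.continuousAt.eventually (lt_mem_nhds h1)).and
      (cΘ.continuousAt.eventually (gt_mem_nhds h2))).filter_mono nhdsWithin_le_nhds
  rcases hs.lt_or_gt with hs | hs
  · obtain ⟨k, h1, h2⟩ := exists_angle_of_sin_neg hs
    have hp := Real.pi_pos
    rcases hd.lt_or_gt with hd | hd
    · rw [sign_neg (by nlinarith)]
      obtain ⟨l, r⟩ := eventually_of_deriv_neg hX ht hd
      refine ⟨2 * k + 2, ?_, ?_⟩
      · filter_upwards [l, near _ h1 h2] with u a b using lo b.1 b.2 a
      · filter_upwards [r, near _ h1 h2] with u a b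
        rw [ne (k := k) (by linarith) b.2 a]; simp; ring
    · rw [sign_pos (by nlinarith)]
      obtain ⟨l, r⟩ := eventually_of_deriv_pos hX ht hd
      refine ⟨2 * k + 1, ?_, ?_⟩
      · filter_upwards [l, near _ h1 h2] with u a b using ne (by linarith) b.2 a
      · filter_upwards [r, near _ h1 h2] with u a b
        rw [lo b.1 b.2 a]; simp; ring
  · obtain ⟨k, h1, h2⟩ := exists_angle_of_sin_pos hs
    have hp := Real.pi_pos
    rcases hd.lt_or_gt with hd | hd
    · rw [sign_pos (by nlinarith)]
      obtain ⟨l, r⟩ := eventually_of_deriv_neg hX ht hd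
      refine ⟨2 * k, ?_, ?_⟩
      · filter_upwards [l, near _ h1 h2] with u a b using up b.1 b.2 a
      · filter_upwards [r, near _ h1 h2] with u a b
        rw [ne b.1 (by linarith) a]; simp
    · rw [sign_neg (by nlinarith)]
      obtain ⟨l, r⟩ := eventually_of_deriv_pos hX ht hd
      refine ⟨2 * k + 1, ?_, ?_⟩
      · filter_upwards [l, near _ h1 h2] with u a b using ne b.1 (by linarith) a
      · filter_upwards [r, near _ h1 h2] with u a b
        rw [up b.1 b.2 a]; simp

lemma finite_crossings {X : ℝ → ℝ} (cX : Continuous X) {a b : ℝ}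
    (ha : X a ≠ κ) (hb : X b ≠ κ) (h : ∀ t ∈ Ioo a b, X t = κ → deriv X t ≠ 0) :
    {t | t ∈ Ioo a b ∧ X t = κ}.Finite := by
  by_contra hinf
  obtain ⟨t, ht, hacc⟩ := Set.Infinite.exists_accPt_of_subset_isCompact hinf
    (K := Icc a b ∩ X ⁻¹' {κ}) (isCompact_Icc.inter_right (isClosed_singleton.preimage cX))
    (fun u hu => ⟨Ioo_subset_Icc_self hu.1, hu.2⟩)
  have hκ : X t = κ := ht.2
  have hta : t ≠ a := fun h => ha (h ▸ hκ)
  have htb : t ≠ b := fun h => hb (h ▸ hκ)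
  have hd := h t ⟨lt_of_le_of_ne ht.1.1 hta.symm, lt_of_le_of_ne ht.1.2 htb⟩ hκ
  have hne := (differentiableAt_of_deriv_ne_zero hd).hasDerivAt.eventually_ne (c := κ) hd
  rw [accPt_iff_frequently] at hacc
  rw [eventually_nhdsWithin_iff] at hne
  obtain ⟨u, ⟨h1, h2⟩, h3⟩ := (hacc.and_eventually hne).exists
  exact h3 h1 h2.2

/-- The signed number of crossings is the change of the level. -/
lemma finsum_crossings (hκ : κ ∈ Icc (-1 : ℝ) 1) (hR : ∀ t, 1 ≤ R t) (cR : Continuous R)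
    (cΘ : Continuous Θ) {a b : ℝ} (hab : a ≤ b) (ha : R a * Real.cos (Θ a) ≠ κ)
    (hb : R b * Real.cos (Θ b) ≠ κ)
    (h : ∀ t ∈ Ioo a b, R t * Real.cos (Θ t) = κ →
      Real.sin (Θ t) ≠ 0 ∧ deriv (fun t => R t * Real.cos (Θ t)) t ≠ 0) :
    ∑ᶠ t ∈ {t | t ∈ Ioo a b ∧ R t * Real.cos (Θ t) = κ},
      (SignType.sign (-(Real.sin (Θ t) * deriv (fun t => R t * Real.cos (Θ t)) t)) : ℤ) =
    level κ (R b * Real.cos (Θ b)) (Θ b) - level κ (R a * Real.cos (Θ a)) (Θ a) := by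
  have cX : Continuous fun t => R t * Real.cos (Θ t) := by fun_prop
  have hfin := finite_crossings cX ha hb fun t h1 h2 => (h t h1 h2).2
  rw [finsum_mem_eq_finite_toFinset_sum _ hfin]
  symm
  refine sub_eq_sum_jumps
    (fun t => (SignType.sign (-(Real.sin (Θ t) * deriv (fun t => R t * Real.cos (Θ t)) t)) : ℤ))
    hab _ (fun t => level κ (R t * Real.cos (Θ t)) (Θ t)) ?_ ?_ ?_
  · intro t ht
    rw [Finite.mem_toFinset] at ht
    exact ht.1
  · intro t ht htS
    refine level_eventually_eq hκ hR cR cΘ fun he => htS ?_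
    rw [Finite.mem_toFinset]
    refine ⟨⟨lt_of_le_of_ne ht.1 ?_, lt_of_le_of_ne ht.2 ?_⟩, he⟩
    · rintro rfl; exact ha he
    · rintro rfl; exact hb he
  · intro t ht
    rw [Finite.mem_toFinset] at ht
    obtain ⟨h1, h2⟩ := h t ht.1 ht.2
    exact level_jump cΘ ht.2 h1 h2

end LevelAlongPath

/-! ### The intersection number as a change of level -/

lemma re_linPart_eq {M : Sp2} {φ : ℝ}
    (h : linPart M = ‖linPart M‖ * Complex.exp (φ * Complex.I)) :
    (linPart M).re = ‖linPart M‖ * Real.cos φ := by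
  have := congrArg Complex.re h
  rwa [Complex.re_ofReal_mul, Complex.exp_ofReal_mul_I_re] at this

lemma im_linPart_eq {M : Sp2} {φ : ℝ}
    (h : linPart M = ‖linPart M‖ * Complex.exp (φ * Complex.I)) :
    (linPart M).im = ‖linPart M‖ * Real.sin φ := by
  have := congrArg Complex.im h
  rwa [Complex.im_ofReal_mul, Complex.exp_ofReal_mul_I_im] at this

lemma re_mem_Icc {ω : ℂ} (hω : ‖ω‖ = 1) : ω.re ∈ Icc (-1 : ℝ) 1 :=
  abs_le.1 ((Complex.abs_re_le_norm ω).trans hω.le)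

lemma crossRate_eq {ω : ℂ} (hω : ‖ω‖ = 1) {M N : Sp2} (σ : Path M N) (t : ℝ) :
    crossRate ω σ t = -(2 * deriv (fun s => (linPart (σ.extend s)).re) t) := by
  have h : (fun s => Dfun ω (σ.extend s)) =
      fun s => 2 * (ω.re - (linPart (σ.extend s)).re) := funext fun s => Dfun_eq hω _
  rw [crossRate, h, deriv_const_mul_field, deriv_const_sub]
  ring

lemma crossingNumber_eq {ω : ℂ} (hω : ‖ω‖ = 1) {M N : Sp2} {σ : Path M N}
    {θ : unitInterval → ℝ} (hθ : IsAngle σ θ) (hσ : IsTransversal ω σ) :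
    crossingNumber ω σ =
      level ω.re (linPart N).re (θ 1) - level ω.re (linPart M).re (θ 0) := by
  set R : ℝ → ℝ := fun t => ‖linPart (σ.extend t)‖
  set Θ : ℝ → ℝ := fun t => θ (projIcc 0 1 zero_le_one t)
  have hext : ∀ t, linPart (σ.extend t) = ‖linPart (σ.extend t)‖ * Complex.exp (Θ t * Complex.I) :=
    fun t => hθ.2 _
  have hre : (fun t => (linPart (σ.extend t)).re) = fun t => R t * Real.cos (Θ t) :=
    funext fun t => re_linPart_eq (hext t)
  have hcr : crossings ω σ = {t | t ∈ Ioo (0 : ℝ) 1 ∧ R t * Real.cos (Θ t) = ω.re} := by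
    ext t
    simp only [crossings, mem_ofPred_eq, mem_Sp0_iff hω]
    rw [congrFun hre t]
  have hR : ∀ t, 1 ≤ R t := fun t => one_le_norm_linPart _
  have cR : Continuous R := (continuous_linPart.comp σ.continuous_extend).norm
  have cΘ : Continuous Θ := hθ.1.comp continuous_projIcc
  have h0 : R 0 * Real.cos (Θ 0) = (linPart M).re := by rw [← congrFun hre 0]; simp
  have h1 : R 1 * Real.cos (Θ 1) = (linPart N).re := by rw [← congrFun hre 1]; simp
  have hΘ0 : Θ 0 = θ 0 := by simp [Θ]
  have hΘ1 : Θ 1 = θ 1 := by simp [Θ]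
  have hsign : ∀ t, (SignType.sign (orientRate ω (σ.extend t) * crossRate ω σ t) : ℤ) =
      SignType.sign (-(Real.sin (Θ t) * deriv (fun t => R t * Real.cos (Θ t)) t)) := by
    intro t
    rw [orientRate_eq hω, crossRate_eq hω, hre, im_linPart_eq (hext t)]
    have : 2 * (‖linPart (σ.extend t)‖ * Real.sin (Θ t)) *
        -(2 * deriv (fun t => R t * Real.cos (Θ t)) t) = (4 * R t) *
        -(Real.sin (Θ t) * deriv (fun t => R t * Real.cos (Θ t)) t) := by ring
    rw [this, sign_mul, sign_pos (by linarith [hR t]), one_mul]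
  rw [crossingNumber, hcr]
  simp only [hsign]
  rw [finsum_crossings (re_mem_Icc hω) hR cR cΘ zero_le_one, h0, h1, hΘ0, hΘ1]
  · rw [h0, Ne, ← mem_Sp0_iff hω]; exact hσ.1
  · rw [h1, Ne, ← mem_Sp0_iff hω]; exact hσ.2.1
  · intro t ht hx
    obtain ⟨ho, hc⟩ := hσ.2.2 t (by rw [hcr]; exact ⟨ht, hx⟩)
    rw [orientRate_eq hω, im_linPart_eq (hext t)] at ho
    rw [crossRate_eq hω, hre] at hc
    exact ⟨fun h => ho (by rw [h]; ring), fun h => hc (by rw [h]; ring)⟩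

/-- The real number closest to `s` in `[0,1]`. -/
def clamp (s : ℝ) : ℝ := max 0 (min s 1)

lemma continuous_clamp : Continuous clamp := by unfold clamp; fun_prop

lemma clamp_of_nonpos {s : ℝ} (h : s ≤ 0) : clamp s = 0 := by
  rw [clamp, max_eq_left ((min_le_left _ _).trans h)]

lemma clamp_of_one_le {s : ℝ} (h : 1 ≤ s) : clamp s = 1 := by
  rw [clamp, min_eq_right h, max_eq_right zero_le_one]

lemma clamp_of_mem {s : ℝ} (h : s ∈ Icc (0 : ℝ) 1) : clamp s = s := by
  rw [clamp, min_eq_left h.2, max_eq_right h.1]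

lemma clamp_mem (s : ℝ) : clamp s ∈ Icc (0 : ℝ) 1 :=
  ⟨le_max_left _ _, max_le zero_le_one (min_le_right _ _)⟩

lemma linPart_diagM {a : ℝ} (ha : a ≠ 0) : linPart (diagM a ha) = ((a + a⁻¹) / 2 : ℝ) := by
  apply Complex.ext <;> simp [linPart, diagM]

lemma antiPart_diagM {a : ℝ} (ha : a ≠ 0) : antiPart (diagM a ha) = ((a - a⁻¹) / 2 : ℝ) := by
  apply Complex.ext <;> simp [antiPart, diagM]

lemma ofPolar_diagM_two : ofPolar (0, ((3 / 4 : ℝ) : ℂ)) = diagM 2 two_ne_zero := by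
  have h : ((3 / 4 : ℝ) : ℂ) = antiPart (diagM 2 two_ne_zero) := by
    rw [antiPart_diagM]; norm_num
  rw [h]
  refine ofPolar_antiPart ?_
  rw [linPart_diagM, Complex.norm_real, Real.norm_of_nonneg (by norm_num)]
  simp

/-- The axis `K` of a component of the complement of the lifted wall: a multiple of `2π` if `x > κ`
(`ε = 1`), and an odd multiple of `π` if `x < κ` (`ε = -1`). -/
lemma exists_centre {κ x φ ρ : ℝ} (hκ : κ ∈ Icc (-1 : ℝ) 1) (hρ : 1 ≤ ρ) (hx : x = ρ * Real.cos φ)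
    (hne : x ≠ κ) : ∃ K ε : ℝ, (ε = 1 ∨ ε = -1) ∧ (∀ s, Real.cos (K + s) = ε * Real.cos s) ∧
      |φ - K| ≤ π ∧ 0 < ε * (x - κ) := by
  rcases hne.lt_or_gt with h | h
  · have hc : Real.cos φ ≠ 1 := fun hc => by
      rw [hx, hc] at h; linarith [hκ.2]
    obtain ⟨k, h1, h2⟩ := exists_angle_of_cos_ne_one hc
    refine ⟨2 * π * k + π, -1, Or.inr rfl, fun s => ?_, ?_, by linarith⟩
    · rw [← cos_sub_angle _ k, show 2 * π * k + π + s - 2 * π * k = s + π by ring,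
        Real.cos_add_pi]; ring
    · rw [abs_le]; constructor <;> linarith
  · have hc : Real.cos φ ≠ -1 := fun hc => by
      rw [hx, hc] at h; linarith [hκ.1]
    obtain ⟨k, h1, h2⟩ := exists_angle_of_cos_ne_neg_one hc
    refine ⟨2 * π * k, 1, Or.inl rfl, fun s => ?_, ?_, by linarith⟩
    · rw [← cos_sub_angle _ k, show 2 * π * k + s - 2 * π * k = s by ring, one_mul]
    · rw [abs_le]; constructor <;> linarith

/-- A transversal path from `diag(2,1/2)` to a nondegenerate matrix with prescribed total angle:
with the conjugate linear part of constant modulus `3/4`, so that the linear part runs on the circle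
of radius `5/4`, it turns to the axis of the component of the end point (this is where all
crossings occur), and then stays in that component. -/
lemma exists_transversal {ω : ℂ} (hω : ‖ω‖ = 1) {N : Sp2} {φ : ℝ}
    (hN : linPart N = ‖linPart N‖ * Complex.exp (φ * Complex.I)) (hne : N ∉ Sp0 ω) :
    ∃ (τ : Path (diagM 2 two_ne_zero) N) (θ : unitInterval → ℝ),
      IsAngle τ θ ∧ θ 0 = 0 ∧ θ 1 = φ ∧ IsTransversal ω τ := by
  have hκ := re_mem_Icc hω
  have hne' : (linPart N).re ≠ ω.re := fun h => hne ((mem_Sp0_iff hω N).2 h)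
  obtain ⟨K, ε, hε, hK, hφ, hx⟩ := exists_centre hκ (one_le_norm_linPart N) (re_linPart_eq hN) hne'
  set r := ‖antiPart N‖
  have hr : 0 ≤ r := norm_nonneg _
  set α := Complex.arg (antiPart N)
  set Φ : ℝ → ℝ := fun t => K * clamp (3 * t) + (φ - K) * clamp (3 * t - 2) with hΦ
  set ρ : ℝ → ℝ := fun t => 3 / 4 + (r - 3 / 4) * clamp (3 * t - 1) with hρ
  set F : ℝ → ℝ × ℂ := fun t =>
    (Φ t, (ρ t : ℂ) * Complex.exp ((α * clamp (3 * t) : ℝ) * Complex.I)) with hF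
  have hc := continuous_clamp
  have cΦ : Continuous Φ := by fun_prop
  have cF : Continuous F := by fun_prop
  have hρ0 : ∀ t, 0 ≤ ρ t := fun t => by
    have := clamp_mem (3 * t - 1)
    simp only [hρ]; nlinarith [this.1, this.2]
  have hnF : ∀ t, ‖(F t).2‖ = ρ t := fun t => by
    simp only [hF]
    rw [norm_mul, Complex.norm_exp_ofReal_mul_I, mul_one, Complex.norm_real,
      Real.norm_of_nonneg (hρ0 t)]
  have hlin : ∀ t, linPart (ofPolar (F t)) = √(1 + ρ t ^ 2) * Complex.exp (Φ t * Complex.I) :=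
    fun t => by rw [linPart_ofPolar, hnF]
  have hre : ∀ t, (linPart (ofPolar (F t))).re = √(1 + ρ t ^ 2) * Real.cos (Φ t) := fun t => by
    rw [hlin, Complex.re_ofReal_mul, Complex.exp_ofReal_mul_I_re]
  have him : ∀ t, (linPart (ofPolar (F t))).im = √(1 + ρ t ^ 2) * Real.sin (Φ t) := fun t => by
    rw [hlin, Complex.im_ofReal_mul, Complex.exp_ofReal_mul_I_im]
  have hF0 : ofPolar (F 0) = diagM 2 two_ne_zero := by
    rw [← ofPolar_diagM_two]
    have a : clamp 0 = 0 := clamp_of_nonpos le_rfl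
    have b : clamp (-2) = 0 := clamp_of_nonpos (by norm_num)
    have c : clamp (-1) = 0 := clamp_of_nonpos (by norm_num)
    simp [hF, hΦ, hρ, a, b, c]
  have hF1 : ofPolar (F 1) = N := by
    rw [← ofPolar_antiPart hN]
    have a : clamp 3 = 1 := clamp_of_one_le (by norm_num)
    have b : clamp (3 - 2) = 1 := clamp_of_one_le (by norm_num)
    have c : clamp (3 - 1) = 1 := clamp_of_one_le (by norm_num)
    simp [hF, hΦ, hρ, a, b, c, r, α, Complex.norm_mul_exp_arg_mul_I]
  let τ : Path (diagM 2 two_ne_zero) N :=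
    { toFun := fun s => ofPolar (F s)
      continuous_toFun := continuous_ofPolar.comp (cF.comp continuous_subtype_val)
      source' := hF0
      target' := hF1 }
  have hext : ∀ t ∈ Icc (0 : ℝ) 1, τ.extend t = ofPolar (F t) := fun t ht => by
    rw [Path.extend_apply _ ht]; rfl
  have hN' : √(1 + r ^ 2) = ‖linPart N‖ := sqrt_one_add_norm_antiPart N
  have hεκ : ε * ω.re ≤ 1 := by rcases hε with rfl | rfl <;> linarith [hκ.1, hκ.2]
  have hεε : ε * ε = 1 := by rcases hε with rfl | rfl <;> norm_num
  have hs0 : √(1 + (3 / 4) ^ 2) = 5 / 4 := by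
    rw [show (1 + (3 / 4) ^ 2 : ℝ) = (5 / 4) ^ 2 by norm_num, Real.sqrt_sq (by norm_num)]
  -- the second and third phases stay in one component
  have hlate : ∀ t, 1 / 3 ≤ t → √(1 + ρ t ^ 2) * Real.cos (Φ t) ≠ ω.re := by
    intro t ht heq
    have h1 : clamp (3 * t) = 1 := clamp_of_one_le (by linarith)
    have hm := clamp_mem (3 * t - 2)
    have hcos : Real.cos (Φ t) = ε * Real.cos ((φ - K) * clamp (3 * t - 2)) := by
      simp only [hΦ]; rw [h1, mul_one, hK]
    have hend : ε * (linPart N).re = ‖linPart N‖ * Real.cos (φ - K) := by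
      rw [re_linPart_eq hN, show φ = K + (φ - K) by ring, hK]
      rw [show K + (φ - K) - K = φ - K by ring]
      linear_combination (‖linPart N‖ * Real.cos (φ - K)) * hεε
    have hval : ε * ω.re = √(1 + ρ t ^ 2) * Real.cos ((φ - K) * clamp (3 * t - 2)) := by
      rw [← heq, hcos]
      linear_combination (√(1 + ρ t ^ 2) * Real.cos ((φ - K) * clamp (3 * t - 2))) * hεε
    rcases le_total t (2 / 3) with h | h
    · rw [clamp_of_nonpos (by linarith), mul_zero, Real.cos_zero, mul_one] at hval
      have hm' := clamp_mem (3 * t - 1)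
      have hlt : ε * ω.re < ‖linPart N‖ := by
        have := Real.cos_le_one (φ - K)
        nlinarith [one_le_norm_linPart N]
      rw [hval, ← hN', Real.sqrt_lt_sqrt_iff (by positivity)] at hlt
      have hle : √(1 + ρ t ^ 2) ≤ √1 := by rw [Real.sqrt_one, ← hval]; exact hεκ
      rw [Real.sqrt_le_sqrt_iff zero_le_one] at hle
      have : ρ t = 0 := by nlinarith [hρ0 t]
      have h2 : 0 < r := by
        rcases hr.lt_or_eq with h | h
        · exact h
        · rw [← h, this] at hlt; norm_num at hlt
      simp only [hρ] at this
      nlinarith [hm'.1, hm'.2]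
    · have h2 : ρ t = r := by
        simp only [hρ]; rw [clamp_of_one_le (by linarith)]; ring
      rw [h2, hN'] at hval
      have : Real.cos (φ - K) ≤ Real.cos ((φ - K) * clamp (3 * t - 2)) := by
        rw [← Real.cos_abs, ← Real.cos_abs (_ * _)]
        refine Real.cos_le_cos_of_nonneg_of_le_pi (abs_nonneg _) hφ ?_
        rw [abs_mul, abs_of_nonneg hm.1]
        exact mul_le_of_le_one_right (abs_nonneg _) hm.2
      nlinarith [one_le_norm_linPart N]
  refine ⟨τ, fun s => Φ s, ⟨cΦ.comp continuous_subtype_val, fun s => ?_⟩, ?_, ?_, ?_, hne, ?_⟩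
  · change linPart (ofPolar (F s)) = ‖linPart (ofPolar (F s))‖ * _
    rw [hlin, norm_mul, Complex.norm_exp_ofReal_mul_I, mul_one, Complex.norm_real,
      Real.norm_of_nonneg (Real.sqrt_nonneg _)]
  · simp [hΦ, clamp_of_nonpos]
  · have a : clamp 3 = 1 := clamp_of_one_le (by norm_num)
    have b : clamp (3 - 2) = 1 := clamp_of_one_le (by norm_num)
    simp [hΦ, a, b]
  · rw [mem_Sp0_iff hω, linPart_diagM, Complex.ofReal_re]
    intro h
    norm_num at h
    linarith [hκ.2]
  · rintro t ⟨ht, hmem⟩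
    rw [mem_Sp0_iff hω, hext t (Ioo_subset_Icc_self ht), hre] at hmem
    have ht3 : t < 1 / 3 := by
      by_contra! h
      exact hlate t h hmem
    have hloc : ∀ u ∈ Ioo (0 : ℝ) (1 / 3), Φ u = K * (3 * u) ∧ √(1 + ρ u ^ 2) = 5 / 4 := by
      intro u hu
      have h1 : clamp (3 * u) = 3 * u := clamp_of_mem ⟨by linarith [hu.1], by linarith [hu.2]⟩
      have h2 : clamp (3 * u - 2) = 0 := clamp_of_nonpos (by linarith [hu.2])
      have h3 : clamp (3 * u - 1) = 0 := clamp_of_nonpos (by linarith [hu.2])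
      refine ⟨by simp only [hΦ, h1, h2]; ring, ?_⟩
      simp only [hρ, h3, mul_zero, add_zero, hs0]
    obtain ⟨e1, e2⟩ := hloc t ⟨ht.1, ht3⟩
    rw [e1, e2] at hmem
    have hsin : Real.sin (K * (3 * t)) ≠ 0 := by
      intro h
      have := Real.sin_sq_add_cos_sq (K * (3 * t))
      rw [h] at this
      nlinarith [hκ.1, hκ.2]
    have hK0 : K ≠ 0 := by
      rintro rfl
      simp at hsin
    constructor
    · rw [orientRate_eq hω, hext t (Ioo_subset_Icc_self ht), him, e1, e2]
      simpa using hsin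
    · rw [crossRate_eq hω]
      have hev : (fun s => (linPart (τ.extend s)).re) =ᶠ[𝓝 t]
          fun s => 5 / 4 * Real.cos (K * (3 * s)) := by
        filter_upwards [Ioo_mem_nhds ht.1 ht3] with u hu
        rw [hext u ⟨hu.1.le, by linarith [hu.2]⟩, hre, (hloc u hu).1, (hloc u hu).2]
      have hd : HasDerivAt (fun s => 5 / 4 * Real.cos (K * (3 * s)))
          (5 / 4 * (-Real.sin (K * (3 * t)) * (K * (3 * 1)))) t :=
        ((((hasDerivAt_id t).const_mul 3).const_mul K).cos).const_mul (5 / 4)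
      rw [hev.deriv_eq, hd.deriv]
      simp [hsin, hK0]

lemma isAngle_xi : IsAngle xi fun _ => 0 := by
  refine ⟨continuous_const, fun t => ?_⟩
  have h : (0 : ℝ) < 2 - t := by have := t.2.2; linarith
  change linPart (diagM (2 - (t : ℝ)) h.ne') = ‖linPart (diagM (2 - (t : ℝ)) h.ne')‖ * _
  rw [linPart_diagM, Complex.norm_real, Real.norm_of_nonneg (by positivity)]
  simp

/-- Angles of concatenated paths. -/
lemma IsAngle.trans {M N P : Sp2} {σ : Path M N} {τ : Path N P} {θ θ' : unitInterval → ℝ}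
    (h : IsAngle σ θ) (h' : IsAngle τ θ') (he : θ 1 = θ' 0) :
    ∃ θ'', IsAngle (σ.trans τ) θ'' ∧ θ'' 0 = θ 0 ∧ θ'' 1 = θ' 1 := by
  let a : Path (θ 0) (θ 1) := ⟨⟨θ, h.1⟩, rfl, rfl⟩
  let b : Path (θ 1) (θ' 1) := ⟨⟨θ', h'.1⟩, he.symm, rfl⟩
  refine ⟨a.trans b, ⟨(a.trans b).continuous, fun t => ?_⟩, (a.trans b).source, (a.trans b).target⟩
  rw [Path.trans_apply, Path.trans_apply]
  split_ifs
  · exact h.2 _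
  · exact h'.2 _

/-- The intersection number of `p ∗ ξ` is the level of the end point, for the angle that vanishes
at the start of `p`. -/
lemma isIntersectionNumber_iff {ω : ℂ} (hω : ‖ω‖ = 1) {N : Sp2} {p : Path (1 : Sp2) N}
    {θ : unitInterval → ℝ} (hθ : IsAngle p θ) (h0 : θ 0 = 0) (hN : N ∉ Sp0 ω) (k : ℤ) :
    IsIntersectionNumber ω (xi.trans p) k ↔ k = level ω.re (linPart N).re (θ 1) := by
  obtain ⟨θ'', h1, h2, h3⟩ := isAngle_xi.trans hθ h0.symm
  have hstart : level ω.re (linPart (diagM 2 two_ne_zero)).re 0 = 0 := by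
    rw [level, linPart_diagM, Complex.ofReal_re, if_pos (by linarith [(re_mem_Icc hω).2])]
    simp
  constructor
  · rintro ⟨τ, hh, hτ, rfl⟩
    have hs : linPart (diagM 2 two_ne_zero) =
        ‖linPart (diagM 2 two_ne_zero)‖ * Complex.exp ((0 : ℝ) * Complex.I) := by
      have := isAngle_xi.2 0
      rwa [xi.source] at this
    obtain ⟨θτ, a, b⟩ := exists_angle τ hs
    rw [crossingNumber_eq hω a hτ, b, hstart, sub_zero, ← h3, h1.end_eq hh a (by rw [h2, b])]
  · rintro rfl
    have he := hθ.2 1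
    rw [p.target] at he
    obtain ⟨τ, θτ, a, b, c, d⟩ := exists_transversal hω he hN
    refine ⟨τ, h1.homotopic a (by rw [h2, b]) (by rw [h3, c]), d, ?_⟩
    rw [crossingNumber_eq hω a d, b, hstart, sub_zero, c]

lemma IsAngle.leftRot {N : Sp2} {p : Path (1 : Sp2) N} {θ : unitInterval → ℝ}
    (h : IsAngle p θ) (ε : ℝ) : IsAngle (leftRot p ε) fun s => θ s - ε * s := by
  have hc := h.1
  refine ⟨by fun_prop, fun s => ?_⟩
  change linPart (p s * rot (-(ε * s))) = ‖linPart (p s * rot (-(ε * s)))‖ * _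
  rw [linPart_mul_rot, norm_mul, Complex.norm_exp_ofReal_mul_I, mul_one]
  conv_lhs => rw [h.2 s]
  rw [mul_assoc, ← Complex.exp_add]
  congr 2
  push_cast
  ring

lemma re_linPart_mul_rot_neg {N : Sp2} {φ : ℝ}
    (h : linPart N = ‖linPart N‖ * Complex.exp (φ * Complex.I)) (ε : ℝ) :
    (linPart (N * rot (-ε))).re = ‖linPart N‖ * Real.cos (φ - ε) := by
  rw [linPart_mul_rot, h, mul_assoc, ← Complex.exp_add, norm_mul, Complex.norm_real, norm_norm,
    Complex.norm_exp_ofReal_mul_I, mul_one,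
    show φ * Complex.I + ((-ε : ℝ) : ℂ) * Complex.I = ((φ - ε : ℝ) : ℂ) * Complex.I by
      push_cast; ring, Complex.re_ofReal_mul, Complex.exp_ofReal_mul_I_re]

/-- The `ω`-index is the left limit of the level in the angle. -/
lemma isOmegaIndex_of_eventually {ω : ℂ} (hω : ‖ω‖ = 1) {N : Sp2} {p : Path (1 : Sp2) N}
    {θ : unitInterval → ℝ} (hθ : IsAngle p θ) (h0 : θ 0 = 0) {k : ℤ}
    (hk : ∀ᶠ ε : ℝ in 𝓝[>] 0, ‖linPart N‖ * Real.cos (θ 1 - ε) ≠ ω.re ∧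
      level ω.re (‖linPart N‖ * Real.cos (θ 1 - ε)) (θ 1 - ε) = k) : IsOmegaIndex ω p k := by
  have he := hθ.2 1
  rw [p.target] at he
  by_cases hN : N ∈ Sp0 ω
  · refine Or.inr ⟨hN, hk.mono fun ε hε => ?_⟩
    have hn : N * rot (-ε) ∉ Sp0 ω := by
      rw [mem_Sp0_iff hω, re_linPart_mul_rot_neg he]; exact hε.1
    refine ⟨hn, ?_⟩
    rw [isIntersectionNumber_iff hω (hθ.leftRot ε) (by simp [h0]) hn, re_linPart_mul_rot_neg he]
    simpa using hε.2.symm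
  · refine Or.inl ⟨hN, ?_⟩
    rw [isIntersectionNumber_iff hω hθ h0 hN]
    have hne : ‖linPart N‖ * Real.cos (θ 1 - 0) ≠ ω.re := by
      rw [sub_zero, ← re_linPart_eq he, Ne, ← mem_Sp0_iff hω]; exact hN
    have hev := (level_eventually_eq (κ := ω.re) (R := fun _ => ‖linPart N‖)
      (Θ := fun ε => θ 1 - ε) (re_mem_Icc hω) (fun _ => one_le_norm_linPart N) continuous_const
      (by fun_prop) hne).filter_mono (nhdsWithin_le_nhds (s := Ioi 0))
    obtain ⟨ε, h1, h2⟩ := (hev.and hk).exists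
    rw [← h2.2, h1, sub_zero, re_linPart_eq he]

lemma IsOmegaIndex.unique {ω : ℂ} (hω : ‖ω‖ = 1) {N : Sp2} {p : Path (1 : Sp2) N} {k l : ℤ}
    (hk : IsOmegaIndex ω p k) (hl : IsOmegaIndex ω p l) : k = l := by
  obtain ⟨θ, hθ, h0⟩ := exists_angle p (φ₀ := 0) (by simp [linPart_one])
  rcases hk with ⟨hN, hk⟩ | ⟨hN, hk⟩ <;> rcases hl with ⟨hN', hl⟩ | ⟨hN', hl⟩
  · rw [isIntersectionNumber_iff hω hθ h0 hN] at hk hl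
    rw [hk, hl]
  · exact absurd hN' hN
  · exact absurd hN hN'
  · obtain ⟨ε, h1, h2⟩ := (hk.and hl).exists
    have h3 := h1.2
    have h4 := h2.2
    rw [isIntersectionNumber_iff hω (hθ.leftRot ε) (by simp [h0]) h1.1] at h3 h4
    rw [h3, h4]

lemma IsOmegaIndex.omegaIndex_eq {ω : ℂ} (hω : ‖ω‖ = 1) {N : Sp2} {p : Path (1 : Sp2) N} {k : ℤ}
    (hk : IsOmegaIndex ω p k) : omegaIndex ω p = k := by
  have h : ∃ k, IsOmegaIndex ω p k := ⟨k, hk⟩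
  rw [omegaIndex, dif_pos h]
  exact h.choose_spec.unique hω hk

/-! ### The action on directions -/

/-- The action of `M ∈ Sp(2)` on `ℝ² = ℂ`. -/
def act (M : Sp2) (v : ℂ) : ℂ := linPart M * v + antiPart M * conj v

lemma act_re (M : Sp2) (v : ℂ) : (act M v).re = M 0 0 * v.re + M 0 1 * v.im := by
  simp [act, linPart, antiPart]; ring

lemma act_im (M : Sp2) (v : ℂ) : (act M v).im = M 1 0 * v.re + M 1 1 * v.im := by
  simp [act, linPart, antiPart]; ring

/-- The quotient by which the directions are turned in addition to the linear part. -/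
def tilt (M : Sp2) (a : ℝ) : ℂ :=
  antiPart M / linPart M * Complex.exp ((-2 * a : ℝ) * Complex.I)

lemma norm_tilt_lt (M : Sp2) (a : ℝ) : ‖tilt M a‖ < 1 := by
  rw [tilt, norm_mul, Complex.norm_exp_ofReal_mul_I, mul_one, norm_div,
    div_lt_one (norm_pos_iff.2 (linPart_ne_zero M))]
  have := norm_linPart_sq M
  exact lt_of_pow_lt_pow_left₀ 2 (norm_nonneg _) (by linarith)

lemma re_one_add_tilt_pos (M : Sp2) (a : ℝ) : 0 < (1 + tilt M a).re := by
  have h1 := norm_tilt_lt M a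
  have h2 := abs_le.1 (Complex.abs_re_le_norm (tilt M a))
  rw [Complex.add_re, Complex.one_re]
  linarith [h2.1]

/-- The lift to the universal covering of the action of `M` on directions: if `φ` is an argument of
the linear part of `M`, then `rotAngle M φ a` is an argument of `M e^{ia}`. -/
def rotAngle (M : Sp2) (φ a : ℝ) : ℝ := φ + a + Complex.arg (1 + tilt M a)

lemma abs_rotAngle_sub_lt (M : Sp2) (φ a : ℝ) : |rotAngle M φ a - a - φ| < π / 2 := by
  have h : rotAngle M φ a - a - φ = Complex.arg (1 + tilt M a) := by unfold rotAngle; ring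
  rw [h, Complex.abs_arg_lt_pi_div_two_iff]
  exact Or.inl (re_one_add_tilt_pos M a)

lemma act_exp (M : Sp2) (a : ℝ) :
    act M (Complex.exp (a * Complex.I)) =
      linPart M * Complex.exp (a * Complex.I) * (1 + tilt M a) := by
  have h := linPart_ne_zero M
  have hc : conj (Complex.exp (a * Complex.I)) =
      Complex.exp (a * Complex.I) * Complex.exp ((-2 * a : ℝ) * Complex.I) := by
    rw [← Complex.exp_conj, ← Complex.exp_add]
    congr 1
    simp
    ring
  rw [act, hc, tilt]
  field_simp

lemma act_exp_ne_zero (M : Sp2) (a : ℝ) : act M (Complex.exp (a * Complex.I)) ≠ 0 := by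
  rw [act_exp]
  refine mul_ne_zero (mul_ne_zero (linPart_ne_zero M) (Complex.exp_ne_zero _)) fun h => ?_
  have := re_one_add_tilt_pos M a
  rw [h] at this
  simp at this

lemma act_exp_eq {M : Sp2} {φ : ℝ} (h : linPart M = ‖linPart M‖ * Complex.exp (φ * Complex.I))
    (a : ℝ) : act M (Complex.exp (a * Complex.I)) =
      ‖act M (Complex.exp (a * Complex.I))‖ * Complex.exp (rotAngle M φ a * Complex.I) := by
  rw [act_exp, norm_mul, norm_mul, Complex.norm_exp_ofReal_mul_I, mul_one]
  conv_lhs => rw [h, ← Complex.norm_mul_exp_arg_mul_I (1 + tilt M a)]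
  rw [rotAngle]
  push_cast
  rw [add_mul, add_mul, Complex.exp_add, Complex.exp_add]
  ring

lemma exists_mul_exp_eq {z u : ℂ} (h : ‖z‖ = ‖u‖) :
    ∃ a : ℝ, z * Complex.exp ((-2 * a : ℝ) * Complex.I) = u := by
  refine ⟨(z.arg - u.arg) / 2, ?_⟩
  calc z * Complex.exp ((-2 * ((z.arg - u.arg) / 2) : ℝ) * Complex.I)
      = ‖z‖ * Complex.exp (z.arg * Complex.I) *
          Complex.exp ((-2 * ((z.arg - u.arg) / 2) : ℝ) * Complex.I) := by
        rw [Complex.norm_mul_exp_arg_mul_I]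
    _ = ‖u‖ * Complex.exp (u.arg * Complex.I) := by
        rw [mul_assoc, ← Complex.exp_add, h]
        congr 2
        push_cast
        ring
    _ = u := Complex.norm_mul_exp_arg_mul_I u

/-- Some direction is turned exactly by the angle of the linear part. -/
lemma exists_rotAngle_eq (M : Sp2) (φ : ℝ) : ∃ a, rotAngle M φ a = a + φ := by
  obtain ⟨a, ha⟩ := exists_mul_exp_eq (z := antiPart M / linPart M)
    (u := (‖antiPart M / linPart M‖ : ℝ)) (by simp)
  refine ⟨a, ?_⟩
  rw [rotAngle, tilt, ha, ← Complex.ofReal_one, ← Complex.ofReal_add,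
    Complex.arg_ofReal_of_nonneg (by positivity)]
  ring

lemma antiPart_eq_zero_of_rotAngle {M : Sp2} {φ : ℝ} (h : ∀ a, rotAngle M φ a = a + φ) :
    antiPart M = 0 := by
  obtain ⟨a, ha⟩ := exists_mul_exp_eq (z := antiPart M / linPart M)
    (u := (‖antiPart M / linPart M‖ : ℝ) * Complex.I) (by simp)
  have h1 : Complex.arg (1 + tilt M a) = 0 := by have := h a; rw [rotAngle] at this; linarith
  rw [tilt, ha, Complex.arg_eq_zero_iff] at h1
  have h2 := h1.2
  simp only [Complex.add_im, Complex.one_im, Complex.im_ofReal_mul,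
    Complex.I_im, mul_one, zero_add] at h2
  rw [norm_eq_zero, div_eq_zero_iff] at h2
  exact h2.resolve_right (linPart_ne_zero M)

lemma act_mul_conj {M : Sp2} {φ : ℝ} (h : linPart M = ‖linPart M‖ * Complex.exp (φ * Complex.I))
    (a : ℝ) : act M (Complex.exp (a * Complex.I)) * Complex.exp ((-a : ℝ) * Complex.I) =
      ‖act M (Complex.exp (a * Complex.I))‖ *
        Complex.exp ((rotAngle M φ a - a : ℝ) * Complex.I) := by
  conv_lhs => rw [act_exp_eq h]
  rw [mul_assoc, ← Complex.exp_add]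
  congr 2
  push_cast
  ring

lemma act_mul_conj' (M : Sp2) (a : ℝ) :
    act M (Complex.exp (a * Complex.I)) * Complex.exp ((-a : ℝ) * Complex.I) =
      linPart M + antiPart M * Complex.exp ((-2 * a : ℝ) * Complex.I) := by
  rw [act, ← Complex.exp_conj, add_mul, mul_assoc, mul_assoc, ← Complex.exp_add,
    ← Complex.exp_add]
  congr 2
  · simp
  · congr 2
    simp
    ring

/-- If the trace is at least two there is a positive eigenvalue, and the direction of its
eigenvector is turned by a multiple of `2π`. -/
lemma exists_rotAngle_eq_two_pi_mul {M : Sp2} {φ : ℝ}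
    (h : linPart M = ‖linPart M‖ * Complex.exp (φ * Complex.I)) (hx : 1 ≤ (linPart M).re) :
    ∃ (a : ℝ) (k : ℤ), rotAngle M φ a - a = k * (2 * π) := by
  have hn := norm_linPart_sq M
  have hc : ‖linPart M‖ ^ 2 = (linPart M).re ^ 2 + (linPart M).im ^ 2 := by
    rw [← Complex.normSq_eq_norm_sq, Complex.normSq_apply]; ring
  set s := √(‖antiPart M‖ ^ 2 - (linPart M).im ^ 2)
  have hs : s ^ 2 = ‖antiPart M‖ ^ 2 - (linPart M).im ^ 2 := Real.sq_sqrt (by nlinarith)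
  obtain ⟨a, ha⟩ := exists_mul_exp_eq (z := antiPart M) (u := ⟨s, -(linPart M).im⟩) (by
    rw [← sq_eq_sq₀ (norm_nonneg _) (norm_nonneg _), ← Complex.normSq_eq_norm_sq ⟨s, _⟩,
      Complex.normSq_apply]
    simp only
    linarith)
  have h1 := act_mul_conj h a
  rw [act_mul_conj', ha] at h1
  have hpos : 0 < ‖act M (Complex.exp (a * Complex.I))‖ := norm_pos_iff.2 (act_exp_ne_zero M a)
  have him := congrArg Complex.im h1
  have hre := congrArg Complex.re h1
  rw [Complex.im_ofReal_mul, Complex.exp_ofReal_mul_I_im, Complex.add_im] at him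
  rw [Complex.re_ofReal_mul, Complex.exp_ofReal_mul_I_re, Complex.add_re] at hre
  simp only [add_neg_cancel] at him hre
  have hsin : Real.sin (rotAngle M φ a - a) = 0 := by
    rcases mul_eq_zero.1 him.symm with h' | h'
    · exact absurd h' hpos.ne'
    · exact h'
  have hcos : 0 < Real.cos (rotAngle M φ a - a) := by
    have : 0 < ‖act M (Complex.exp (a * Complex.I))‖ * Real.cos (rotAngle M φ a - a) := by
      rw [← hre]; have : 0 ≤ s := Real.sqrt_nonneg _; linarith
    exact pos_of_mul_pos_right this hpos.le
  have hone : Real.cos (rotAngle M φ a - a) = 1 := by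
    have := Real.sin_sq_add_cos_sq (rotAngle M φ a - a)
    rw [hsin] at this
    nlinarith
  obtain ⟨k, hk⟩ := (Real.cos_eq_one_iff _).1 hone
  exact ⟨a, k, hk.symm⟩

/-! ### Prüfer angles -/

/-- The derivative of a continuous argument along a differentiable curve. -/
lemma hasDerivWithinAt_of_argument {Z : ℝ → ℂ} {α : ℝ → ℝ} {s : Set ℝ} {t : ℝ} {Z' : ℂ}
    (hZ : HasDerivWithinAt Z Z' s t) (hα : ContinuousWithinAt α s t)
    (h : ∀ u ∈ s, Z u = ‖Z u‖ * Complex.exp (α u * Complex.I)) (hne : Z t ≠ 0) (ht : t ∈ s) :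
    HasDerivWithinAt α (Z' / Z t).im s t := by
  have h1 : HasDerivWithinAt (fun u => Z u / Z t) (Z' / Z t) s t := hZ.div_const _
  have h2 : HasDerivWithinAt (fun u => Complex.log (Z u / Z t)) (Z' / Z t) s t := by
    have := h1.clog_real (by simp [div_self hne])
    simpa [div_self hne] using this
  have h3 : HasDerivWithinAt (fun u => (Complex.log (Z u / Z t)).im) (Z' / Z t).im s t :=
    Complex.imCLM.hasFDerivAt.comp_hasDerivWithinAt t h2
  have h4 := h3.const_add (α t)
  refine h4.congr_of_eventuallyEq ?_ (by simp [div_self hne])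
  have e1 : ∀ᶠ u in 𝓝[s] t, |α u - α t| < π := by
    have := hα.eventually (Metric.ball_mem_nhds (α t) Real.pi_pos)
    simpa [Real.dist_eq] using this
  have e2 : ∀ᶠ u in 𝓝[s] t, Z u ≠ 0 := hZ.continuousWithinAt.eventually_ne hne
  filter_upwards [e1, e2, self_mem_nhdsWithin] with u h5 h6 h7
  have hq : Z u / Z t = (‖Z u‖ / ‖Z t‖ : ℝ) * Complex.exp ((α u - α t : ℝ) * Complex.I) := by
    conv_lhs => rw [h u h7, h t ht]
    rw [mul_div_mul_comm, ← Complex.exp_sub]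
    push_cast
    congr 2
    ring
  have hp : 0 < ‖Z u‖ / ‖Z t‖ := div_pos (norm_pos_iff.2 h6) (norm_pos_iff.2 hne)
  rw [abs_lt] at h5
  rw [Complex.log_im, hq, Complex.exp_mul_I, ← Complex.ofReal_cos, ← Complex.ofReal_sin]
  rw [Complex.ofReal_cos, Complex.ofReal_sin, Complex.arg_mul_cos_add_sin_mul_I hp
    ⟨by linarith [h5.1], by linarith [h5.2]⟩]
  ring

/-- The coefficient in `ÿ = - q y`. -/
def qfun (β e t : ℝ) : ℝ := 1 - β / (1 + e * Real.cos t)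

lemma continuous_qfun (β : ℝ) {e : ℝ} (he : e ∈ Ico (0 : ℝ) 1) : Continuous (qfun β e) :=
  continuous_const.sub (continuous_const.div (by fun_prop) fun t => (denom_pos he t).ne')

/-- The scaled path `γ_{β,e}`, extended to all times by constants. -/
def gammaAt (β : ℝ) {e : ℝ} (he : e ∈ Ico (0 : ℝ) 1) (t : ℝ) : Sp2 :=
  (gammaPath β he).extend (t / (2 * π))

lemma div_two_pi_mem {t : ℝ} (ht : t ∈ Icc (0 : ℝ) (2 * π)) : t / (2 * π) ∈ Icc (0 : ℝ) 1 :=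
  ⟨div_nonneg ht.1 two_pi_nonneg, div_le_one_of_le₀ ht.2 two_pi_nonneg⟩

lemma gammaAt_apply (β : ℝ) {e : ℝ} (he : e ∈ Ico (0 : ℝ) 1) {t : ℝ}
    (ht : t ∈ Icc (0 : ℝ) (2 * π)) (i j : Fin 2) : gammaAt β he t i j = fundSol β he t i j := by
  rw [gammaAt, Path.extend_apply _ (div_two_pi_mem ht)]
  change fundSol β he (2 * π * (t / (2 * π))) i j = _
  rw [mul_div_cancel₀ _ (by positivity)]

/-- The vector `γ_{β,e}(t) e^{ia}` solves the system. -/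
lemma hasDerivWithinAt_act (β : ℝ) {e : ℝ} (he : e ∈ Ico (0 : ℝ) 1) (a : ℝ) {t : ℝ}
    (ht : t ∈ Icc (0 : ℝ) (2 * π)) :
    HasDerivWithinAt (fun t => act (gammaAt β he t) (Complex.exp (a * Complex.I)))
      ⟨-(qfun β e t) * (act (gammaAt β he t) (Complex.exp (a * Complex.I))).im,
        (act (gammaAt β he t) (Complex.exp (a * Complex.I))).re⟩ (Icc 0 (2 * π)) t := by
  have hs := (fundSol_spec β he).ode t ht
  simp only [JB_mul] at hs
  have h1 : HasDerivWithinAt (fun t => (act (gammaAt β he t) (Complex.exp (a * Complex.I))).re)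
      (-(qfun β e t) * (act (gammaAt β he t) (Complex.exp (a * Complex.I))).im)
      (Icc 0 (2 * π)) t := by
    have := ((hs 0 0).mul_const (Real.cos a)).add ((hs 0 1).mul_const (Real.sin a))
    refine (this.congr_deriv ?_).congr (fun u hu => ?_) ?_
    · simp only [act_im, gammaAt_apply β he ht, Complex.exp_ofReal_mul_I_re,
        Complex.exp_ofReal_mul_I_im, qfun]
      simp
      ring
    · simp [act_re, gammaAt_apply β he hu, Complex.exp_ofReal_mul_I_re,
        Complex.exp_ofReal_mul_I_im]
    · simp [act_re, gammaAt_apply β he ht, Complex.exp_ofReal_mul_I_re,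
        Complex.exp_ofReal_mul_I_im]
  have h2 : HasDerivWithinAt (fun t => (act (gammaAt β he t) (Complex.exp (a * Complex.I))).im)
      (act (gammaAt β he t) (Complex.exp (a * Complex.I))).re (Icc 0 (2 * π)) t := by
    have := ((hs 1 0).mul_const (Real.cos a)).add ((hs 1 1).mul_const (Real.sin a))
    refine (this.congr_deriv ?_).congr (fun u hu => ?_) ?_
    · simp [act_re, gammaAt_apply β he ht, Complex.exp_ofReal_mul_I_re,
        Complex.exp_ofReal_mul_I_im]
    · simp [act_im, gammaAt_apply β he hu, Complex.exp_ofReal_mul_I_re,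
        Complex.exp_ofReal_mul_I_im]
    · simp [act_im, gammaAt_apply β he ht, Complex.exp_ofReal_mul_I_re,
        Complex.exp_ofReal_mul_I_im]
  have h3 := h1.ofReal_comp.add (h2.ofReal_comp.mul_const Complex.I)
  refine (h3.congr_deriv ?_).congr (fun u _ => ?_) ?_
  · apply Complex.ext <;> simp
  · exact (Complex.re_add_im _).symm
  · exact (Complex.re_add_im _).symm

/-- The Prüfer angle of the solution with initial direction `a`. -/
lemma exists_pruefer (β : ℝ) {e : ℝ} (he : e ∈ Ico (0 : ℝ) 1) {θ : unitInterval → ℝ}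
    (hθ : IsAngle (gammaPath β he) θ) (h0 : θ 0 = 0) (a : ℝ) :
    ∃ α : ℝ → ℝ, Continuous α ∧ α 0 = a ∧ α (2 * π) = rotAngle (monodromy β he) (θ 1) a ∧
      (∀ t ∈ Icc (0 : ℝ) (2 * π), HasDerivWithinAt α
        (Real.cos (α t) ^ 2 + qfun β e t * Real.sin (α t) ^ 2) (Icc 0 (2 * π)) t) ∧
      ∀ t, act (gammaAt β he t) (Complex.exp (a * Complex.I)) =
        ‖act (gammaAt β he t) (Complex.exp (a * Complex.I))‖ *
          Complex.exp (α t * Complex.I) := by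
  have hlin : ∀ t, linPart (gammaAt β he t) = ‖linPart (gammaAt β he t)‖ *
      Complex.exp (θ (projIcc 0 1 zero_le_one (t / (2 * π))) * Complex.I) := fun t => hθ.2 _
  set α : ℝ → ℝ := fun t =>
    rotAngle (gammaAt β he t) (θ (projIcc 0 1 zero_le_one (t / (2 * π)))) a with hα
  have cγ : Continuous (gammaAt β he) :=
    (gammaPath β he).continuous_extend.comp (continuous_id.div_const _)
  have ctilt : Continuous fun t => 1 + tilt (gammaAt β he t) a := by
    unfold tilt
    exact continuous_const.add ((((continuous_antiPart.comp cγ).div (continuous_linPart.comp cγ)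
      fun t => linPart_ne_zero _)).mul continuous_const)
  have carg : Continuous fun t => Complex.arg (1 + tilt (gammaAt β he t) a) :=
    continuous_iff_continuousAt.2 fun t =>
      (Complex.continuousAt_arg (Or.inl (re_one_add_tilt_pos (gammaAt β he t) a))).comp
        (f := fun t => 1 + tilt (gammaAt β he t) a) ctilt.continuousAt
  have cα : Continuous α :=
    ((hθ.1.comp (continuous_projIcc.comp (continuous_id.div_const _))).add
      continuous_const).add carg
  have hact := fun t => act_exp_eq (hlin t) a
  refine ⟨α, cα, ?_, ?_, fun t ht => ?_, hact⟩
  · have h1 : gammaAt β he 0 = 1 := by simp [gammaAt]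
    have h2 : antiPart 1 = 0 := by apply Complex.ext <;> simp [antiPart]
    simp [hα, h1, rotAngle, tilt, h2, h0]
  · simp [hα, gammaAt]
  · have hd := hasDerivWithinAt_of_argument (hasDerivWithinAt_act β he a ht)
      cα.continuousWithinAt (fun u _ => hact u) (act_exp_ne_zero _ _) ht
    refine hd.congr_deriv ?_
    set Z := act (gammaAt β he t) (Complex.exp (a * Complex.I)) with hZ
    have hZne : Z ≠ 0 := act_exp_ne_zero _ _
    have hre : Z.re = ‖Z‖ * Real.cos (α t) := by
      have := congrArg Complex.re (hact t)
      rwa [Complex.re_ofReal_mul, Complex.exp_ofReal_mul_I_re] at this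
    have him : Z.im = ‖Z‖ * Real.sin (α t) := by
      have := congrArg Complex.im (hact t)
      rwa [Complex.im_ofReal_mul, Complex.exp_ofReal_mul_I_im] at this
    have hn : ‖Z‖ ≠ 0 := norm_ne_zero_iff.2 hZne
    rw [Complex.div_im, Complex.normSq_eq_norm_sq]
    simp only
    rw [hre, him]
    field_simp
    ring

/-- Sturm comparison for Prüfer angles. -/
lemma pruefer_lt {q₁ q₂ α₁ α₂ : ℝ → ℝ} {T : ℝ} (hT : 0 < T) (c₁ : Continuous q₁)
    (hq : ∀ t, q₂ t < q₁ t) (cα₁ : Continuous α₁) (cα₂ : Continuous α₂)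
    (h₁ : ∀ t ∈ Icc 0 T, HasDerivWithinAt α₁
      (Real.cos (α₁ t) ^ 2 + q₁ t * Real.sin (α₁ t) ^ 2) (Icc 0 T) t)
    (h₂ : ∀ t ∈ Icc 0 T, HasDerivWithinAt α₂
      (Real.cos (α₂ t) ^ 2 + q₂ t * Real.sin (α₂ t) ^ 2) (Icc 0 T) t)
    (h0 : α₁ 0 = α₂ 0) : α₂ T < α₁ T := by
  -- the difference solves a linear equation with non-negative inhomogeneity
  set l : ℝ → ℝ := fun t => (q₁ t - 1) * Real.sin (α₁ t + α₂ t) * Real.sinc (α₁ t - α₂ t) with hl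
  have cl : Continuous l := by
    have := Real.continuous_sinc
    fun_prop
  set L : ℝ → ℝ := fun t => ∫ s in (0 : ℝ)..t, l s
  have hL : ∀ t, HasDerivAt L (l t) t := fun t =>
    intervalIntegral.integral_hasDerivAt_right (cl.intervalIntegrable _ _)
      (cl.stronglyMeasurableAtFilter _ _) cl.continuousAt
  set G : ℝ → ℝ := fun t => (α₁ t - α₂ t) * Real.exp (-L t) with hG
  have cL : Continuous L := continuous_iff_continuousAt.2 fun t => (hL t).continuousAt
  have cG : Continuous G := by fun_prop
  have hd₁ : ∀ t ∈ Ioo 0 T, HasDerivAt α₁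
      (Real.cos (α₁ t) ^ 2 + q₁ t * Real.sin (α₁ t) ^ 2) t := fun t ht =>
    (h₁ t (Ioo_subset_Icc_self ht)).hasDerivAt (Icc_mem_nhds ht.1 ht.2)
  have hd₂ : ∀ t ∈ Ioo 0 T, HasDerivAt α₂
      (Real.cos (α₂ t) ^ 2 + q₂ t * Real.sin (α₂ t) ^ 2) t := fun t ht =>
    (h₂ t (Ioo_subset_Icc_self ht)).hasDerivAt (Icc_mem_nhds ht.1 ht.2)
  have hdG : ∀ t ∈ Ioo 0 T, HasDerivAt G
      ((q₁ t - q₂ t) * Real.sin (α₂ t) ^ 2 * Real.exp (-L t)) t := by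
    intro t ht
    have h := ((hd₁ t ht).sub (hd₂ t ht)).mul (hL t).neg.exp
    refine h.congr_deriv ?_
    have hsinc : Real.sinc (α₁ t - α₂ t) * (α₁ t - α₂ t) = Real.sin (α₁ t - α₂ t) := by
      by_cases hz : α₁ t - α₂ t = 0
      · simp [hz]
      · rw [Real.sinc_of_ne_zero hz, div_mul_cancel₀ _ hz]
    have hss : Real.sin (α₁ t + α₂ t) * Real.sin (α₁ t - α₂ t) =
        Real.sin (α₁ t) ^ 2 - Real.sin (α₂ t) ^ 2 := by
      rw [Real.sin_add, Real.sin_sub]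
      have a := Real.sin_sq_add_cos_sq (α₁ t)
      have b := Real.sin_sq_add_cos_sq (α₂ t)
      linear_combination Real.sin (α₁ t) ^ 2 * b - Real.sin (α₂ t) ^ 2 * a
    have a := Real.sin_sq_add_cos_sq (α₁ t)
    have b := Real.sin_sq_add_cos_sq (α₂ t)
    simp only [Pi.sub_apply, Pi.neg_apply, hl]
    linear_combination (-((q₁ t - 1) * Real.sin (α₁ t + α₂ t) * Real.exp (-L t))) * hsinc -
      (q₁ t - 1) * Real.exp (-L t) * hss + Real.exp (-L t) * (a - b)
  have hmono : MonotoneOn G (Icc 0 T) := by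
    refine monotoneOn_of_deriv_nonneg (convex_Icc _ _) cG.continuousOn ?_ ?_
    · rw [interior_Icc]
      exact fun t ht => (hdG t ht).differentiableAt.differentiableWithinAt
    · rw [interior_Icc]
      intro t ht
      rw [(hdG t ht).deriv]
      have := hq t
      exact mul_nonneg (mul_nonneg (by linarith) (sq_nonneg _)) (Real.exp_pos _).le
  have hG0 : G 0 = 0 := by simp [hG, h0]
  by_contra! hle
  have hGT : G T ≤ 0 := mul_nonpos_of_nonpos_of_nonneg (by linarith) (Real.exp_pos _).le
  have hzero : ∀ t ∈ Icc 0 T, G t = 0 := fun t ht => by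
    have a := hmono (left_mem_Icc.2 hT.le) ht ht.1
    have b := hmono ht (right_mem_Icc.2 hT.le) ht.2
    linarith
  have hsin : ∀ t ∈ Ioo 0 T, Real.sin (α₂ t) = 0 := by
    intro t ht
    have hev : G =ᶠ[𝓝 t] fun _ => 0 := by
      filter_upwards [Icc_mem_nhds ht.1 ht.2] with u hu using hzero u hu
    have h3 := (hdG t ht).unique ((hasDerivAt_const t (0 : ℝ)).congr_of_eventuallyEq hev)
    have h4 := hq t
    have h5 := Real.exp_pos (-L t)
    rcases mul_eq_zero.1 h3 with h6 | h6
    · rcases mul_eq_zero.1 h6 with h7 | h7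
      · linarith
      · exact pow_eq_zero_iff two_ne_zero |>.1 h7
    · linarith
  -- but where the sine vanishes the angle increases with unit speed
  have hm : T / 2 ∈ Ioo 0 T := ⟨by linarith, by linarith⟩
  have hev : (fun t => Real.sin (α₂ t)) =ᶠ[𝓝 (T / 2)] fun _ => 0 := by
    filter_upwards [Ioo_mem_nhds hm.1 hm.2] with u hu using hsin u hu
  have h3 := (hd₂ _ hm).sin.unique ((hasDerivAt_const (T / 2) (0 : ℝ)).congr_of_eventuallyEq hev)
  have h4 := Real.sin_sq_add_cos_sq (α₂ (T / 2))
  rw [hsin _ hm] at h3 h4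
  have h5 : Real.cos (α₂ (T / 2)) ^ 2 = 1 := by linarith
  rw [h5] at h3
  have h6 : Real.cos (α₂ (T / 2)) = 0 := by linarith
  rw [h6] at h5
  norm_num at h5

/-! ### The total angle of `γ_{β,e}` -/

lemma exists_gammaAngle (β : ℝ) {e : ℝ} (he : e ∈ Ico (0 : ℝ) 1) :
    ∃ θ, IsAngle (gammaPath β he) θ ∧ θ 0 = 0 :=
  exists_angle (gammaPath β he) (by simp [linPart_one])

/-- The total angle described by the linear part along `γ_{β,e}`. -/
def totalAngle (β : ℝ) {e : ℝ} (he : e ∈ Ico (0 : ℝ) 1) : ℝ :=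
  (exists_gammaAngle β he).choose 1

/-- The lift of the action of `γ_{β,e}(2π)` on directions that is determined by the path
`γ_{β,e}`. -/
def turn (β : ℝ) {e : ℝ} (he : e ∈ Ico (0 : ℝ) 1) (a : ℝ) : ℝ :=
  rotAngle (monodromy β he) (totalAngle β he) a

section

variable {e : ℝ} (he : e ∈ Ico (0 : ℝ) 1)

lemma linPart_monodromy (β : ℝ) : linPart (monodromy β he) =
    ‖linPart (monodromy β he)‖ * Complex.exp (totalAngle β he * Complex.I) := by
  have := (exists_gammaAngle β he).choose_spec.1.2 1
  rwa [Path.target] at this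

lemma exists_turn (β a : ℝ) :
    ∃ α : ℝ → ℝ, Continuous α ∧ α 0 = a ∧ α (2 * π) = turn β he a ∧
      (∀ t ∈ Icc (0 : ℝ) (2 * π), HasDerivWithinAt α
        (Real.cos (α t) ^ 2 + qfun β e t * Real.sin (α t) ^ 2) (Icc 0 (2 * π)) t) ∧
      ∀ t, act (gammaAt β he t) (Complex.exp (a * Complex.I)) =
        ‖act (gammaAt β he t) (Complex.exp (a * Complex.I))‖ *
          Complex.exp (α t * Complex.I) :=
  exists_pruefer β he (exists_gammaAngle β he).choose_spec.1
    (exists_gammaAngle β he).choose_spec.2 a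

/-- Directions are turned less by `γ_{β,e}` when `β` grows. -/
lemma turn_lt_turn {β₁ β₂ : ℝ} (h : β₁ < β₂) (a : ℝ) : turn β₂ he a < turn β₁ he a := by
  obtain ⟨α₁, c₁, z₁, f₁, d₁, -⟩ := exists_turn he β₁ a
  obtain ⟨α₂, c₂, z₂, f₂, d₂, -⟩ := exists_turn he β₂ a
  rw [← f₁, ← f₂]
  refine pruefer_lt (by positivity) (continuous_qfun β₁ he) (fun t => ?_) c₁ c₂ d₁ d₂
    (z₁.trans z₂.symm)
  have := div_lt_div_of_pos_right h (denom_pos he t)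
  unfold qfun
  linarith

lemma one_sub_le_denom {e : ℝ} (he : e ∈ Ico (0 : ℝ) 1) (t : ℝ) : 1 - e ≤ 1 + e * Real.cos t := by
  nlinarith [Real.neg_one_le_cos t, he.1]

lemma div_denom_le {e : ℝ} (he : e ∈ Ico (0 : ℝ) 1) {β : ℝ} (hβ : 0 ≤ β) (t : ℝ) :
    β / (1 + e * Real.cos t) ≤ β / (1 - e) :=
  div_le_div_of_nonneg_left hβ (by linarith [he.2]) (one_sub_le_denom he t)

/-- The Prüfer angle has derivative between `1 - β/(1-e)` and `1`. -/
lemma turn_bounds {β : ℝ} (hβ : 0 ≤ β) (a : ℝ) :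
    a + (1 - β / (1 - e)) * (2 * π) ≤ turn β he a ∧ turn β he a ≤ a + 2 * π := by
  obtain ⟨α, c, z, f, d, -⟩ := exists_turn he β a
  have hd : ∀ t ∈ Ioo (0 : ℝ) (2 * π), HasDerivAt α
      (Real.cos (α t) ^ 2 + qfun β e t * Real.sin (α t) ^ 2) t := fun t ht =>
    (d t (Ioo_subset_Icc_self ht)).hasDerivAt (Icc_mem_nhds ht.1 ht.2)
  have hb : ∀ t, 1 - β / (1 - e) ≤ Real.cos (α t) ^ 2 + qfun β e t * Real.sin (α t) ^ 2 ∧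
      Real.cos (α t) ^ 2 + qfun β e t * Real.sin (α t) ^ 2 ≤ 1 := by
    intro t
    have h1 := Real.sin_sq_add_cos_sq (α t)
    have h2 := div_denom_le he hβ t
    have h3 : 0 ≤ β / (1 + e * Real.cos t) := div_nonneg hβ (denom_pos he t).le
    have h4 := sq_nonneg (Real.sin (α t))
    have h5 := sq_nonneg (Real.cos (α t))
    unfold qfun
    constructor <;> nlinarith
  have m1 : MonotoneOn (fun t => α t - (1 - β / (1 - e)) * t) (Icc 0 (2 * π)) := by
    refine monotoneOn_of_hasDerivWithinAt_nonneg (convex_Icc _ _) (by fun_prop)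
      (f' := fun t => Real.cos (α t) ^ 2 + qfun β e t * Real.sin (α t) ^ 2 -
        (1 - β / (1 - e)) * 1) ?_ ?_
    · rw [interior_Icc]
      exact fun t ht => ((hd t ht).sub ((hasDerivAt_id t).const_mul _)).hasDerivWithinAt
    · exact fun t _ => by linarith [(hb t).1]
  have m2 : MonotoneOn (fun t => t - α t) (Icc 0 (2 * π)) := by
    refine monotoneOn_of_hasDerivWithinAt_nonneg (convex_Icc _ _) (by fun_prop)
      (f' := fun t => 1 - (Real.cos (α t) ^ 2 + qfun β e t * Real.sin (α t) ^ 2)) ?_ ?_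
    · rw [interior_Icc]
      exact fun t ht => ((hasDerivAt_id t).sub (hd t ht)).hasDerivWithinAt
    · exact fun t _ => by linarith [(hb t).2]
  have k1 := m1 (left_mem_Icc.2 two_pi_nonneg) (right_mem_Icc.2 two_pi_nonneg) two_pi_nonneg
  have k2 := m2 (left_mem_Icc.2 two_pi_nonneg) (right_mem_Icc.2 two_pi_nonneg) two_pi_nonneg
  simp only [z, f] at k1 k2
  constructor <;> linarith

lemma exists_turn_eq (β : ℝ) : ∃ a, turn β he a = a + totalAngle β he := exists_rotAngle_eq _ _

lemma turn_zero (a : ℝ) : turn 0 he a = a + 2 * π := by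
  have := turn_bounds he le_rfl a
  rw [zero_div, sub_zero, one_mul] at this
  exact le_antisymm this.2 this.1

lemma totalAngle_zero : totalAngle 0 he = 2 * π := by
  obtain ⟨a, ha⟩ := exists_turn_eq he 0
  rw [turn_zero] at ha
  linarith

lemma norm_linPart_monodromy_zero : ‖linPart (monodromy 0 he)‖ = 1 := by
  have h : antiPart (monodromy 0 he) = 0 :=
    antiPart_eq_zero_of_rotAngle (φ := totalAngle 0 he) fun a => by
      rw [totalAngle_zero]; rw [← turn_zero he a, turn, totalAngle_zero]
  have := norm_linPart_sq (monodromy 0 he)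
  rw [h] at this
  simp only [norm_zero] at this
  nlinarith [norm_nonneg (linPart (monodromy 0 he))]

/-! ### The case `β = 1` -/

/-- For `β = 1` the function `p = 1 + e cos t` is a solution, and the Wronskian with it is
constant. -/
lemma wronskian_const {e : ℝ} (he : e ∈ Ico (0 : ℝ) 1) {v u : ℝ → ℝ}
    (hv : ∀ t ∈ Icc (0 : ℝ) (2 * π), HasDerivWithinAt v (-(qfun 1 e t) * u t) (Icc 0 (2 * π)) t)
    (hu : ∀ t ∈ Icc (0 : ℝ) (2 * π), HasDerivWithinAt u (v t) (Icc 0 (2 * π)) t) :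
    ∀ t ∈ Icc (0 : ℝ) (2 * π), v t * (1 + e * Real.cos t) + u t * (e * Real.sin t) =
      v 0 * (1 + e) := by
  intro t ht
  have hd : ∀ s ∈ Icc (0 : ℝ) (2 * π), HasDerivWithinAt
      (fun s => v s * (1 + e * Real.cos s) + u s * (e * Real.sin s)) 0 (Icc 0 (2 * π)) s := by
    intro s hs
    have hp := (denom_pos he s).ne'
    have h1 := ((Real.hasDerivAt_cos s).const_mul e).const_add 1
    have h2 := (Real.hasDerivAt_sin s).const_mul e
    have h := ((hv s hs).mul h1.hasDerivWithinAt).add ((hu s hs).mul h2.hasDerivWithinAt)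
    refine h.congr_deriv ?_
    unfold qfun
    field_simp
    ring
  have := constant_of_has_deriv_right_zero (a := 0) (b := 2 * π)
    (fun s hs => (hd s hs).continuousWithinAt)
    (fun s hs => (hd s (Ico_subset_Icc_self hs)).mono_of_mem_nhdsWithin
      (Icc_mem_nhdsGE_of_mem hs)) t ht
  simpa using this

/-- Reduction of order: the quotient of a solution by `1 + e cos t` has an explicit derivative. -/
lemma hasDerivAt_div_denom {e : ℝ} (he : e ∈ Ico (0 : ℝ) 1) {v u : ℝ → ℝ}
    (hv : ∀ t ∈ Icc (0 : ℝ) (2 * π), HasDerivWithinAt v (-(qfun 1 e t) * u t) (Icc 0 (2 * π)) t)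
    (hu : ∀ t ∈ Icc (0 : ℝ) (2 * π), HasDerivWithinAt u (v t) (Icc 0 (2 * π)) t) :
    ∀ t ∈ Icc (0 : ℝ) (2 * π), HasDerivWithinAt (fun t => u t / (1 + e * Real.cos t))
      (v 0 * (1 + e) / (1 + e * Real.cos t) ^ 2) (Icc 0 (2 * π)) t := by
  intro t ht
  have hp := (denom_pos he t).ne'
  have h1 := ((Real.hasDerivAt_cos t).const_mul e).const_add 1
  refine ((hu t ht).div h1.hasDerivWithinAt hp).congr_deriv ?_
  rw [← wronskian_const he hv hu t ht]
  congr 1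
  ring

lemma fundSol_column (β : ℝ) (j : Fin 2) :
    (∀ t ∈ Icc (0 : ℝ) (2 * π), HasDerivWithinAt (fun t => fundSol β he t 0 j)
      (-(qfun β e t) * fundSol β he t 1 j) (Icc 0 (2 * π)) t) ∧
    ∀ t ∈ Icc (0 : ℝ) (2 * π), HasDerivWithinAt (fun t => fundSol β he t 1 j)
      (fundSol β he t 0 j) (Icc 0 (2 * π)) t := by
  refine ⟨fun t ht => ?_, fun t ht => ?_⟩
  · have := (fundSol_spec β he).ode t ht 0 j
    rw [JB_mul] at this
    fin_cases j <;> exact this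
  · have := (fundSol_spec β he).ode t ht 1 j
    rw [JB_mul] at this
    fin_cases j <;> exact this

lemma fundSol_init (β : ℝ) : fundSol β he 0 = 1 := (fundSol_spec β he).init

lemma fundSol_one_one_one {t : ℝ} (ht : t ∈ Icc (0 : ℝ) (2 * π)) :
    fundSol 1 he t 1 1 = (1 + e * Real.cos t) / (1 + e) := by
  obtain ⟨hv, hu⟩ := fundSol_column he 1 1
  have hd := hasDerivAt_div_denom he hv hu
  have h0 : fundSol 1 he 0 0 1 = 0 := by simp [fundSol_init]
  have h1 : fundSol 1 he 0 1 1 = 1 := by simp [fundSol_init]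
  simp only [h0, zero_mul, zero_div] at hd
  have := constant_of_has_deriv_right_zero (a := 0) (b := 2 * π)
    (fun s hs => (hd s hs).continuousWithinAt)
    (fun s hs => (hd s (Ico_subset_Icc_self hs)).mono_of_mem_nhdsWithin
      (Icc_mem_nhdsGE_of_mem hs)) t ht
  simp only [h1, Real.cos_zero, mul_one] at this
  have hp := (denom_pos he t).ne'
  have he1 : 1 + e ≠ 0 := by linarith [he.1]
  field_simp at this ⊢
  linarith

lemma monodromy_one_entries : monodromy 1 he 0 0 = 1 ∧ monodromy 1 he 0 1 = 0 ∧
    0 < monodromy 1 he 1 0 ∧ monodromy 1 he 1 1 = 1 := by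
  have hT : (2 * π) ∈ Icc (0 : ℝ) (2 * π) := ⟨two_pi_nonneg, le_rfl⟩
  have he1 : 0 < 1 + e := by linarith [he.1]
  obtain ⟨hv, hu⟩ := fundSol_column he 1 0
  obtain ⟨hv', hu'⟩ := fundSol_column he 1 1
  have h0 : fundSol 1 he 0 0 0 = 1 := by simp [fundSol_init]
  have h1 : fundSol 1 he 0 1 0 = 0 := by simp [fundSol_init]
  have h0' : fundSol 1 he 0 0 1 = 0 := by simp [fundSol_init]
  have w := wronskian_const he hv hu _ hT
  have w' := wronskian_const he hv' hu' _ hT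
  simp only [h0, h0', Real.cos_two_pi, Real.sin_two_pi, mul_one, mul_zero, add_zero, zero_mul]
    at w w'
  refine ⟨mul_right_cancel₀ he1.ne' w, ?_, ?_, ?_⟩
  · exact (mul_eq_zero.1 w').resolve_right he1.ne'
  · have hd := hasDerivAt_div_denom he hv hu
    have hm : StrictMonoOn (fun t => fundSol 1 he t 1 0 / (1 + e * Real.cos t))
        (Icc 0 (2 * π)) := by
      refine strictMonoOn_of_hasDerivWithinAt_pos (convex_Icc _ _)
        (fun t ht => (hd t ht).continuousWithinAt)
        (fun t ht => (hd t (interior_subset ht)).mono interior_subset) fun t _ => ?_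
      have := denom_pos he t
      rw [h0]
      positivity
    have := hm (left_mem_Icc.2 two_pi_nonneg) hT (by positivity)
    simp only [h1, zero_div, Real.cos_two_pi, mul_one] at this
    exact (div_pos_iff_of_pos_right he1).1 this
  · have := fundSol_one_one_one he hT
    rw [Real.cos_two_pi, mul_one, div_self he1.ne'] at this
    exact this

/-- The solution `1 + e cos t` is positive and periodic, so its Prüfer angle stays in `(0, π)` and
returns to its initial value. -/
lemma turn_one_pi_div_two : turn 1 he (π / 2) = π / 2 := by
  obtain ⟨α, c, z, f, -, hα⟩ := exists_turn he 1 (π / 2)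
  have hexp : Complex.exp ((π / 2 : ℝ) * Complex.I) = Complex.I := by
    push_cast; exact Complex.exp_pi_div_two_mul_I
  rw [hexp] at hα
  have hsin : ∀ t ∈ Icc (0 : ℝ) (2 * π), 0 < Real.sin (α t) := by
    intro t ht
    have h1 := congrArg Complex.im (hα t)
    rw [Complex.im_ofReal_mul, Complex.exp_ofReal_mul_I_im, act_im] at h1
    simp only [Complex.I_re, Complex.I_im, mul_zero, mul_one, zero_add] at h1
    rw [gammaAt_apply 1 he ht, fundSol_one_one_one he ht] at h1
    have h2 : 0 < (1 + e * Real.cos t) / (1 + e) :=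
      div_pos (denom_pos he t) (by linarith [he.1])
    rw [h1] at h2
    exact pos_of_mul_pos_right h2 (norm_nonneg _)
  have hT : (2 * π) ∈ Icc (0 : ℝ) (2 * π) := ⟨two_pi_nonneg, le_rfl⟩
  have hp := Real.pi_pos
  have hlt : turn 1 he (π / 2) < π := by
    by_contra! h
    obtain ⟨t, ht, he'⟩ := intermediate_value_Icc two_pi_nonneg c.continuousOn
      (show π ∈ Icc (α 0) (α (2 * π)) by rw [z, f]; exact ⟨by linarith, h⟩)
    have := hsin t ht
    rw [he', Real.sin_pi] at this
    exact lt_irrefl _ this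
  have hgt : 0 < turn 1 he (π / 2) := by
    by_contra! h
    obtain ⟨t, ht, he'⟩ := intermediate_value_Icc' two_pi_nonneg c.continuousOn
      (show 0 ∈ Icc (α (2 * π)) (α 0) by rw [z, f]; exact ⟨h, by linarith⟩)
    have := hsin t ht
    rw [he', Real.sin_zero] at this
    exact lt_irrefl _ this
  have hcos : Real.cos (turn 1 he (π / 2)) = 0 := by
    have h1 := congrArg Complex.re (hα (2 * π))
    rw [Complex.re_ofReal_mul, Complex.exp_ofReal_mul_I_re, act_re] at h1
    simp only [Complex.I_re, Complex.I_im, mul_zero, mul_one, zero_add] at h1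
    rw [gammaAt_apply 1 he hT] at h1
    have h2 : fundSol 1 he (2 * π) 0 1 = 0 := (monodromy_one_entries he).2.1
    rw [h2, f] at h1
    refine (mul_eq_zero.1 h1.symm).resolve_left ?_
    rw [norm_eq_zero, ← hexp]
    exact act_exp_ne_zero _ _
  rw [← Real.cos_pi_div_two] at hcos
  exact Real.injOn_cos ⟨hgt.le, hlt.le⟩ ⟨by linarith, by linarith⟩ hcos

lemma re_linPart_monodromy_one : (linPart (monodromy 1 he)).re = 1 := by
  obtain ⟨h1, h2, h3, h4⟩ := monodromy_one_entries he
  simp only [linPart, h1, h4]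
  norm_num

lemma im_linPart_monodromy_one : 0 < (linPart (monodromy 1 he)).im := by
  obtain ⟨h1, h2, h3, h4⟩ := monodromy_one_entries he
  simp only [linPart, h2]
  linarith

lemma totalAngle_one : totalAngle 1 he ∈ Ioo 0 (π / 2) := by
  have h := abs_rotAngle_sub_lt (monodromy 1 he) (totalAngle 1 he) (π / 2)
  have h1 : rotAngle (monodromy 1 he) (totalAngle 1 he) (π / 2) = π / 2 := turn_one_pi_div_two he
  rw [h1, abs_lt] at h
  refine ⟨?_, by linarith [h.1]⟩
  have h2 := im_linPart_monodromy_one he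
  rw [im_linPart_eq (linPart_monodromy he 1)] at h2
  have h3 := pos_of_mul_pos_right h2 (norm_nonneg _)
  by_contra! h4
  have := Real.sin_nonpos_of_nonpos_of_neg_pi_le h4 (by linarith [Real.pi_pos, h.2])
  linarith

lemma im_act_mul_conj (M : Sp2) (a : ℝ) :
    (act M (Complex.exp (a * Complex.I)) * Complex.exp ((-a : ℝ) * Complex.I)).im =
      M 1 0 * Real.cos a ^ 2 + (M 1 1 - M 0 0) * (Real.cos a * Real.sin a) -
        M 0 1 * Real.sin a ^ 2 := by
  rw [Complex.mul_im, act_re, act_im, Complex.exp_ofReal_mul_I_re, Complex.exp_ofReal_mul_I_im,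
    Complex.exp_ofReal_mul_I_re, Complex.exp_ofReal_mul_I_im, Real.cos_neg, Real.sin_neg]
  ring

/-- The quadratic form `det (v, M v)` has the sign of the sine of the angle by which `v` is
turned. -/
lemma form_eq_norm_mul_sin (β a : ℝ) :
    monodromy β he 1 0 * Real.cos a ^ 2 +
      (monodromy β he 1 1 - monodromy β he 0 0) * (Real.cos a * Real.sin a) -
        monodromy β he 0 1 * Real.sin a ^ 2 =
    ‖act (monodromy β he) (Complex.exp (a * Complex.I))‖ * Real.sin (turn β he a - a) := by
  rw [← im_act_mul_conj, act_mul_conj (linPart_monodromy he β), Complex.im_ofReal_mul,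
    Complex.exp_ofReal_mul_I_im]
  rfl

lemma norm_act_pos (M : Sp2) (a : ℝ) : 0 < ‖act M (Complex.exp (a * Complex.I))‖ :=
  norm_pos_iff.2 (act_exp_ne_zero M a)

/-- The monodromy at `β = 1` is a shear that fixes the vertical direction and turns the others
counterclockwise. -/
lemma le_turn_one (a : ℝ) : a ≤ turn 1 he a := by
  obtain ⟨h1, h2, h3, h4⟩ := monodromy_one_entries he
  have h := form_eq_norm_mul_sin he 1 a
  rw [h1, h2, h4] at h
  have hs : 0 ≤ Real.sin (turn 1 he a - a) := by
    refine nonneg_of_mul_nonneg_right (a := ‖act (monodromy 1 he) _‖) ?_ (norm_act_pos _ a)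
    rw [← h]
    nlinarith [mul_nonneg h3.le (sq_nonneg (Real.cos a))]
  have hφ := totalAngle_one he
  have hb := abs_lt.1 (abs_rotAngle_sub_lt (monodromy 1 he) (totalAngle 1 he) a)
  change _ < turn 1 he a - a - _ ∧ _ at hb
  by_contra! hlt
  have := Real.sin_neg_of_neg_of_neg_pi_lt (x := turn 1 he a - a) (by linarith)
    (by linarith [hb.1, hφ.1, Real.pi_pos])
  linarith

/-! ### The case `0 < β < 1` -/

lemma turn_sub_mem {β : ℝ} (hβ : β ∈ Ioo (0 : ℝ) 1) (a : ℝ) :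
    turn β he a - a ∈ Ioo 0 (2 * π) := by
  have h1 := turn_lt_turn he hβ.1 a
  have h2 := turn_lt_turn he hβ.2 a
  have h3 := le_turn_one he a
  rw [turn_zero] at h1
  constructor <;> linarith

lemma totalAngle_mem {β : ℝ} (hβ : β ∈ Ioo (0 : ℝ) 1) : totalAngle β he ∈ Ioo 0 (2 * π) := by
  obtain ⟨a, ha⟩ := exists_turn_eq he β
  have := turn_sub_mem he hβ a
  rwa [ha, add_sub_cancel_left] at this

/-- A real part at least `1` would give a direction that is turned by a multiple of `2π`, but all
directions are turned by angles strictly between `0` and `2π`. -/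
lemma re_linPart_lt_one {β : ℝ} (hβ : β ∈ Ioo (0 : ℝ) 1) : (linPart (monodromy β he)).re < 1 := by
  by_contra! h
  obtain ⟨a, k, hk⟩ := exists_rotAngle_eq_two_pi_mul (linPart_monodromy he β) h
  have := turn_sub_mem he hβ a
  change turn β he a - a = _ at hk
  rw [hk] at this
  have hp : 0 < 2 * π := by positivity
  have h1 : (0 : ℝ) < k := pos_of_mul_pos_left this.1 hp.le
  have h2 : (k : ℝ) < 1 := by nlinarith [this.2]
  have h3 : 0 < k := by exact_mod_cast h1
  have h4 : k < 1 := by exact_mod_cast h2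
  omega

/-! ### Continuity in `β` -/

/-- Continuous dependence on `β` at `β = 1`, by Gronwall's inequality. -/
lemma tendsto_fundSol (i j : Fin 2) : Tendsto (fun β => fundSol β he (2 * π) i j) (𝓝 1)
    (𝓝 (fundSol 1 he (2 * π) i j)) := by
  have he1 : 0 < 1 - e := by linarith [he.2]
  obtain ⟨C, hC⟩ := isCompact_Icc.exists_bound_of_continuousOn
    ((fundSol_spec 1 he).continuousOn 1 j)
  set K : ℝ := 1 + 2 / (1 - e)
  have hK : 1 ≤ K := by have : 0 ≤ 2 / (1 - e) := by positivity
                        linarith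
  have hbound : ∀ β ∈ Icc (0 : ℝ) 2, |fundSol β he (2 * π) i j - fundSol 1 he (2 * π) i j| ≤
      gronwallBound 0 K (|1 - β| / (1 - e) * C) (2 * π) := by
    intro β hβ
    obtain ⟨hv, hu⟩ := fundSol_column he β j
    obtain ⟨hv', hu'⟩ := fundSol_column he 1 j
    have hd : ∀ t ∈ Icc (0 : ℝ) (2 * π), HasDerivWithinAt
        (fun t => (fundSol β he t 0 j - fundSol 1 he t 0 j,
          fundSol β he t 1 j - fundSol 1 he t 1 j))
        (-(qfun β e t) * fundSol β he t 1 j - -(qfun 1 e t) * fundSol 1 he t 1 j,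
          fundSol β he t 0 j - fundSol 1 he t 0 j) (Icc 0 (2 * π)) t := fun t ht =>
      ((hv t ht).sub (hv' t ht)).prodMk ((hu t ht).sub (hu' t ht))
    have key := norm_le_gronwallBound_of_norm_deriv_right_le (δ := 0) (K := K)
      (ε := |1 - β| / (1 - e) * C) (a := 0) (b := 2 * π)
      (fun t ht => (hd t ht).continuousWithinAt)
      (fun t ht => (hd t (Ico_subset_Icc_self ht)).mono_of_mem_nhdsWithin
        (Icc_mem_nhdsGE_of_mem ht))
      (by simp [fundSol_init]) ?_ (2 * π) ⟨two_pi_nonneg, le_rfl⟩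
    · rw [sub_zero] at key
      refine le_trans ?_ key
      fin_cases i
      · exact norm_fst_le (fundSol β he (2 * π) 0 j - fundSol 1 he (2 * π) 0 j,
          fundSol β he (2 * π) 1 j - fundSol 1 he (2 * π) 1 j)
      · exact norm_snd_le (fundSol β he (2 * π) 0 j - fundSol 1 he (2 * π) 0 j,
          fundSol β he (2 * π) 1 j - fundSol 1 he (2 * π) 1 j)
    · intro t ht
      have hCt := hC t (Ico_subset_Icc_self ht)
      set V := fundSol β he t 0 j - fundSol 1 he t 0 j
      set U := fundSol β he t 1 j - fundSol 1 he t 1 j with hU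
      have hC0 : 0 ≤ C := (norm_nonneg _).trans hCt
      have hVn : |V| ≤ ‖(V, U)‖ := norm_fst_le (V, U)
      have hUn : |U| ≤ ‖(V, U)‖ := norm_snd_le (V, U)
      have hp := denom_pos he t
      have hpe := one_sub_le_denom he t
      have hq : |qfun β e t| ≤ K := by
        have h1 : 0 ≤ β / (1 + e * Real.cos t) := div_nonneg hβ.1 hp.le
        have h2 : β / (1 + e * Real.cos t) ≤ 2 / (1 - e) :=
          div_le_div₀ (by norm_num) hβ.2 he1 hpe
        rw [abs_le, qfun]
        constructor <;> simp only [K] <;> linarith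
      have hdq : |qfun 1 e t - qfun β e t| ≤ |1 - β| / (1 - e) := by
        have : qfun 1 e t - qfun β e t = -((1 - β) / (1 + e * Real.cos t)) := by
          unfold qfun; field_simp; ring
        rw [this, abs_neg, abs_div, abs_of_pos hp]
        exact div_le_div_of_nonneg_left (abs_nonneg _) he1 hpe
      have hE : -(qfun β e t) * fundSol β he t 1 j - -(qfun 1 e t) * fundSol 1 he t 1 j =
          -(qfun β e t) * U + (qfun 1 e t - qfun β e t) * fundSol 1 he t 1 j := by
        rw [hU]; ring
      rw [hE, Prod.norm_def]
      have hnn : 0 ≤ |1 - β| / (1 - e) * C := by positivity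
      refine max_le ?_ ?_
      · refine (norm_add_le _ _).trans (add_le_add ?_ ?_)
        · rw [norm_mul, norm_neg]
          exact mul_le_mul hq hUn (abs_nonneg _) (by linarith)
        · rw [norm_mul]
          exact mul_le_mul hdq hCt (norm_nonneg _) (by positivity)
      · refine (hVn.trans ?_).trans (le_add_of_nonneg_right hnn)
        exact le_mul_of_one_le_left (norm_nonneg _) hK
  have hlim : Tendsto (fun β : ℝ => gronwallBound 0 K (|1 - β| / (1 - e) * C) (2 * π)) (𝓝 1)
      (𝓝 0) := by
    have hc : Continuous fun β : ℝ => gronwallBound 0 K (|1 - β| / (1 - e) * C) (2 * π) :=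
      (gronwallBound_continuous_ε 0 K (2 * π)).comp (by fun_prop)
    have := hc.tendsto 1
    simpa [gronwallBound_ε0] using this
  rw [tendsto_iff_dist_tendsto_zero]
  refine squeeze_zero' (Eventually.of_forall fun _ => dist_nonneg) ?_ hlim
  filter_upwards [Icc_mem_nhds (show (0 : ℝ) < 1 by norm_num) (show (1 : ℝ) < 2 by norm_num)]
    with β hβ
  rw [Real.dist_eq]
  exact hbound β hβ

lemma tendsto_linPart_monodromy : Tendsto (fun β => (linPart (monodromy β he)).re) (𝓝 1)
      (𝓝 (linPart (monodromy 1 he)).re) ∧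
    Tendsto (fun β => (linPart (monodromy β he)).im) (𝓝 1)
      (𝓝 (linPart (monodromy 1 he)).im) :=
  ⟨((tendsto_fundSol he 0 0).add (tendsto_fundSol he 1 1)).div_const 2,
    ((tendsto_fundSol he 1 0).sub (tendsto_fundSol he 0 1)).div_const 2⟩

end

/-! ### Levels of endpoints -/

lemma eventually_near (φ : ℝ) {α β : ℝ} (h1 : α < φ) (h2 : φ ≤ β) :
    ∀ᶠ ε : ℝ in 𝓝[>] 0, 0 < ε ∧ α < φ - ε ∧ φ - ε < β := by
  filter_upwards [Ioo_mem_nhdsGT (show (0 : ℝ) < φ - α by linarith)] with ε hε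
  exact ⟨hε.1, by linarith [hε.2], by linarith [hε.1]⟩

lemma tendsto_re_left (ρ φ : ℝ) : Tendsto (fun ε => ρ * Real.cos (φ - ε)) (𝓝[>] 0)
    (𝓝 (ρ * Real.cos φ)) := by
  have hc : Continuous fun ε => ρ * Real.cos (φ - ε) := by fun_prop
  have := hc.tendsto 0
  rw [sub_zero] at this
  exact this.mono_left nhdsWithin_le_nhds

section Level

variable {κ ρ φ : ℝ}

/-- An end point on the wall, `κ = ρ cos φ`, counts as lying before it, since the angle is
approached from below. -/
lemma eventually_level_zero (hρ : 0 < ρ) (h0 : 0 < φ) (hφ : φ ≤ π) (hx : κ ≤ ρ * Real.cos φ) :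
    ∀ᶠ ε : ℝ in 𝓝[>] 0, ρ * Real.cos (φ - ε) ≠ κ ∧
      level κ (ρ * Real.cos (φ - ε)) (φ - ε) = 0 := by
  filter_upwards [eventually_near φ h0 hφ] with ε ⟨h1, h2, h3⟩
  have hc : Real.cos φ < Real.cos (φ - ε) :=
    Real.strictAntiOn_cos ⟨h2.le, h3.le⟩ ⟨h0.le, hφ⟩ (by linarith)
  have h4 : κ < ρ * Real.cos (φ - ε) := hx.trans_lt (mul_lt_mul_of_pos_left hc hρ)
  refine ⟨h4.ne', ?_⟩
  rw [level, if_pos h4, round_angle (k := 0) (by push_cast; linarith) (by push_cast; linarith)]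
  rfl

lemma eventually_level_two (hφ : π < φ) (hφ' : φ ≤ 2 * π) (hx : κ < ρ * Real.cos φ) :
    ∀ᶠ ε : ℝ in 𝓝[>] 0, ρ * Real.cos (φ - ε) ≠ κ ∧
      level κ (ρ * Real.cos (φ - ε)) (φ - ε) = 2 := by
  filter_upwards [eventually_near φ hφ hφ', (tendsto_re_left ρ φ).eventually (lt_mem_nhds hx)]
    with ε ⟨h1, h2, h3⟩ h4
  refine ⟨h4.ne', ?_⟩
  rw [level, if_pos h4, round_angle (k := 1) (by push_cast; linarith)
    (by push_cast; linarith [Real.pi_pos])]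
  rfl

lemma eventually_level_one (h0 : 0 < φ) (hφ : φ ≤ 2 * π) (hx : ρ * Real.cos φ < κ) :
    ∀ᶠ ε : ℝ in 𝓝[>] 0, ρ * Real.cos (φ - ε) ≠ κ ∧
      level κ (ρ * Real.cos (φ - ε)) (φ - ε) = 1 := by
  filter_upwards [eventually_near φ h0 hφ, (tendsto_re_left ρ φ).eventually (gt_mem_nhds hx)]
    with ε ⟨h1, h2, h3⟩ h4
  refine ⟨h4.ne, ?_⟩
  rw [level, if_neg (not_lt.2 h4.le), floor_angle (k := 0) (by push_cast; linarith)
    (by push_cast; linarith)]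
  rfl

/-- The same on the part of the wall that is crossed from level one to level two. -/
lemma eventually_level_one' (hρ : 0 < ρ) (h0 : π < φ) (hφ : φ ≤ 2 * π)
    (hx : ρ * Real.cos φ = κ) :
    ∀ᶠ ε : ℝ in 𝓝[>] 0, ρ * Real.cos (φ - ε) ≠ κ ∧
      level κ (ρ * Real.cos (φ - ε)) (φ - ε) = 1 := by
  have hp := Real.pi_pos
  filter_upwards [eventually_near φ h0 hφ] with ε ⟨h1, h2, h3⟩
  have hc : Real.cos (2 * π - (φ - ε)) < Real.cos (2 * π - φ) :=
    Real.strictAntiOn_cos ⟨by linarith, by linarith⟩ ⟨by linarith, by linarith⟩ (by linarith)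
  rw [Real.cos_two_pi_sub, Real.cos_two_pi_sub] at hc
  have h4 : ρ * Real.cos (φ - ε) < κ := hx ▸ mul_lt_mul_of_pos_left hc hρ
  refine ⟨h4.ne, ?_⟩
  rw [level, if_neg (not_lt.2 h4.le), floor_angle (k := 0) (by push_cast; linarith)
    (by push_cast; linarith)]
  rfl

end Level

/-! ### Comparison of traces -/

/-- The coefficients of a positive definite binary quadratic form. -/
lemma posDef_of_forall {A B C : ℝ}
    (h : ∀ a : ℝ, 0 < A * Real.cos a ^ 2 + B * (Real.cos a * Real.sin a) + C * Real.sin a ^ 2) :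
    0 < A ∧ 0 < C ∧ B ^ 2 < 4 * (A * C) := by
  have hA : 0 < A := by simpa using h 0
  have hC : 0 < C := by simpa using h (π / 2)
  refine ⟨hA, hC, ?_⟩
  set z : ℂ := ⟨-B, 2 * A⟩ with hz
  have hz0 : z ≠ 0 := fun h => by
    have := congrArg Complex.im h
    simp [hz] at this
    linarith
  have hr : 0 < ‖z‖ := norm_pos_iff.2 hz0
  have h1 := Complex.norm_mul_cos_arg z
  have h2 := Complex.norm_mul_sin_arg z
  have h3 := mul_pos (pow_pos hr 2) (h z.arg)
  have h4 : ‖z‖ ^ 2 * (A * Real.cos z.arg ^ 2 + B * (Real.cos z.arg * Real.sin z.arg) +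
      C * Real.sin z.arg ^ 2) = A * (‖z‖ * Real.cos z.arg) ^ 2 +
      B * ((‖z‖ * Real.cos z.arg) * (‖z‖ * Real.sin z.arg)) +
      C * (‖z‖ * Real.sin z.arg) ^ 2 := by ring
  rw [h4, h1, h2] at h3
  simp only [hz] at h3
  have h5 : A * (-B) ^ 2 + B * (-B * (2 * A)) + C * (2 * A) ^ 2 = A * (4 * (A * C) - B ^ 2) := by
    ring
  rw [h5] at h3
  linarith [pos_of_mul_pos_right h3 hA.le]

/-- The mixed discriminant of two positive definite binary forms is positive. -/
lemma mixed_pos {A B C A' B' C' : ℝ} (h : 0 < A ∧ 0 < C ∧ B ^ 2 < 4 * (A * C))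
    (h' : 0 < A' ∧ 0 < C' ∧ B' ^ 2 < 4 * (A' * C')) : B * B' < 2 * (A * C' + C * A') := by
  obtain ⟨a, c, b⟩ := h
  obtain ⟨a', c', b'⟩ := h'
  have hac : 0 < A * C' := mul_pos a c'
  have hca : 0 < C * A' := mul_pos c a'
  refine lt_of_pow_lt_pow_left₀ 2 (by positivity) ?_
  have h1 : B ^ 2 * B' ^ 2 ≤ B ^ 2 * (4 * (A' * C')) :=
    mul_le_mul_of_nonneg_left b'.le (sq_nonneg _)
  have h2 : B ^ 2 * (4 * (A' * C')) < 4 * (A * C) * (4 * (A' * C')) :=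
    mul_lt_mul_of_pos_right b (by positivity)
  nlinarith [sq_nonneg (A * C' - C * A')]

/-- Let two matrices of determinant one, `M = m + JT` and `M' = m' + JT'` with `T, T'` positive
definite, be such that `M⁻¹M' = k + JS` with `S` positive definite, that is, `M'` turns each
direction further than `M`. Then `(m - m')(1 + k)` is a positive multiple of the sum of the mixed
discriminants of `T, S` and of `T', S`, and `k > -1`, so `m' < m`. -/
lemma trace_lt_trace {a b c d a' b' c' d' : ℝ} (hM : a * d - b * c = 1)
    (hM' : a' * d' - b' * c' = 1)
    (hT : ∀ s : ℝ, 0 < c * Real.cos s ^ 2 + (d - a) * (Real.cos s * Real.sin s) -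
      b * Real.sin s ^ 2)
    (hT' : ∀ s : ℝ, 0 < c' * Real.cos s ^ 2 + (d' - a') * (Real.cos s * Real.sin s) -
      b' * Real.sin s ^ 2)
    (hS : ∀ s : ℝ, 0 < (a * Real.cos s + b * Real.sin s) * (c' * Real.cos s + d' * Real.sin s) -
      (c * Real.cos s + d * Real.sin s) * (a' * Real.cos s + b' * Real.sin s)) :
    a' + d' < a + d := by
  have t := posDef_of_forall (A := c) (B := d - a) (C := -b) fun s => by linarith [hT s]
  have t' := posDef_of_forall (A := c') (B := d' - a') (C := -b') fun s => by linarith [hT' s]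
  have s := posDef_of_forall (A := a * c' - c * a') (B := a * d' + b * c' - c * b' - d * a')
    (C := b * d' - d * b') fun s => by nlinarith [hS s]
  have m := mixed_pos t s
  have m' := mixed_pos t' s
  set k := d * a' - b * c' - c * b' + a * d' with hk
  have hk1 : -2 < k := by
    have h1 : (a * d' + b * c' - c * b' - d * a') ^ 2 -
        4 * ((a * c' - c * a') * (b * d' - d * b')) = k ^ 2 - 4 := by
      rw [hk]
      linear_combination (-4 * (a' * d' - b' * c')) * hM - 4 * hM'
    nlinarith [s.2.2]
  by_contra! hle
  have key : (a + d - (a' + d')) * (2 + k) =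
      2 * (c * (b * d' - d * b') + -b * (a * c' - c * a')) -
      (d - a) * (a * d' + b * c' - c * b' - d * a') +
      (2 * (c' * (b * d' - d * b') + -b' * (a * c' - c * a')) -
      (d' - a') * (a * d' + b * c' - c * b' - d * a')) := by
    rw [hk]
    linear_combination (2 * (a' + d')) * hM - 2 * (a + d) * hM'
  nlinarith

section

variable {e : ℝ} (he : e ∈ Ico (0 : ℝ) 1)

/-- The determinant of `M₁ v, M₂ v` in terms of the difference of the angles. -/
lemma det_act_eq (β₁ β₂ s : ℝ) :
    (monodromy β₁ he 0 0 * Real.cos s + monodromy β₁ he 0 1 * Real.sin s) *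
      (monodromy β₂ he 1 0 * Real.cos s + monodromy β₂ he 1 1 * Real.sin s) -
    (monodromy β₁ he 1 0 * Real.cos s + monodromy β₁ he 1 1 * Real.sin s) *
      (monodromy β₂ he 0 0 * Real.cos s + monodromy β₂ he 0 1 * Real.sin s) =
    ‖act (monodromy β₁ he) (Complex.exp (s * Complex.I))‖ *
      ‖act (monodromy β₂ he) (Complex.exp (s * Complex.I))‖ *
      Real.sin (turn β₂ he s - turn β₁ he s) := by
  have h : ∀ β, monodromy β he 0 0 * Real.cos s + monodromy β he 0 1 * Real.sin s =
      ‖act (monodromy β he) (Complex.exp (s * Complex.I))‖ * Real.cos (turn β he s) ∧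
      monodromy β he 1 0 * Real.cos s + monodromy β he 1 1 * Real.sin s =
      ‖act (monodromy β he) (Complex.exp (s * Complex.I))‖ * Real.sin (turn β he s) := by
    intro β
    have h1 := act_exp_eq (linPart_monodromy he β) s
    have h2 := congrArg Complex.re h1
    have h3 := congrArg Complex.im h1
    rw [Complex.re_ofReal_mul, Complex.exp_ofReal_mul_I_re, act_re, Complex.exp_ofReal_mul_I_re,
      Complex.exp_ofReal_mul_I_im] at h2
    rw [Complex.im_ofReal_mul, Complex.exp_ofReal_mul_I_im, act_im, Complex.exp_ofReal_mul_I_re,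
      Complex.exp_ofReal_mul_I_im] at h3
    exact ⟨h2, h3⟩
  rw [(h β₁).1, (h β₁).2, (h β₂).1, (h β₂).2, Real.sin_sub]
  ring

lemma re_linPart_lt_of_turn_lt_pi {β₁ β₂ : ℝ} (hβ : β₁ < β₂) (h : ∀ a, turn β₁ he a - a < π)
    (h0 : ∀ a, 0 < turn β₂ he a - a) :
    (linPart (monodromy β₁ he)).re < (linPart (monodromy β₂ he)).re := by
  have hlt := fun a => turn_lt_turn he hβ a
  have := trace_lt_trace (monodromy β₂ he).det_eq (monodromy β₁ he).det_eq
    (fun s => by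
      rw [form_eq_norm_mul_sin]
      exact mul_pos (norm_act_pos _ _) (Real.sin_pos_of_pos_of_lt_pi (h0 s)
        (by linarith [h s, hlt s])))
    (fun s => by
      rw [form_eq_norm_mul_sin]
      exact mul_pos (norm_act_pos _ _) (Real.sin_pos_of_pos_of_lt_pi (by linarith [h0 s, hlt s])
        (h s)))
    (fun s => by
      rw [det_act_eq]
      exact mul_pos (mul_pos (norm_act_pos _ _) (norm_act_pos _ _))
        (Real.sin_pos_of_pos_of_lt_pi (by linarith [hlt s]) (by linarith [h s, h0 s])))
  simp only [linPart]
  linarith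

lemma sin_neg_of_pi_lt {x : ℝ} (h1 : π < x) (h2 : x < 2 * π) : Real.sin x < 0 := by
  rw [← Real.sin_sub_two_pi]
  exact Real.sin_neg_of_neg_of_neg_pi_lt (by linarith) (by linarith)

lemma re_linPart_lt_of_pi_lt_turn {β₁ β₂ : ℝ} (hβ : β₁ < β₂)
    (h : ∀ a, turn β₁ he a - a < 2 * π) (h0 : ∀ a, π < turn β₂ he a - a) :
    (linPart (monodromy β₂ he)).re < (linPart (monodromy β₁ he)).re := by
  have hlt := fun a => turn_lt_turn he hβ a
  -- apply the comparison to the negatives of the matrices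
  have := trace_lt_trace (a := -monodromy β₂ he 0 0) (b := -monodromy β₂ he 0 1)
    (c := -monodromy β₂ he 1 0) (d := -monodromy β₂ he 1 1) (a' := -monodromy β₁ he 0 0)
    (b' := -monodromy β₁ he 0 1) (c' := -monodromy β₁ he 1 0) (d' := -monodromy β₁ he 1 1)
    (by linarith [(monodromy β₂ he).det_eq]) (by linarith [(monodromy β₁ he).det_eq])
    (fun s => by
      have := form_eq_norm_mul_sin he β₂ s
      have := mul_neg_of_pos_of_neg (norm_act_pos (monodromy β₂ he) s)
        (sin_neg_of_pi_lt (h0 s) (by linarith [h s, hlt s]))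
      linarith)
    (fun s => by
      have := form_eq_norm_mul_sin he β₁ s
      have := mul_neg_of_pos_of_neg (norm_act_pos (monodromy β₁ he) s)
        (sin_neg_of_pi_lt (by linarith [h0 s, hlt s]) (h s))
      linarith)
    (fun s => by
      have h1 := det_act_eq he β₂ β₁ s
      have := mul_pos (mul_pos (norm_act_pos (monodromy β₂ he) s)
        (norm_act_pos (monodromy β₁ he) s)) (Real.sin_pos_of_pos_of_lt_pi
          (x := turn β₁ he s - turn β₂ he s) (by linarith [hlt s]) (by linarith [h s, h0 s]))
      linarith)
  simp only [linPart]
  linarith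

/-- The discriminant of the quadratic form `det (v, M v)`. -/
lemma disc_form (M : Sp2) :
    (M 1 1 - M 0 0) ^ 2 - 4 * (M 1 0 * -M 0 1) = 4 * ((linPart M).re ^ 2 - 1) := by
  simp only [linPart]
  linear_combination (-4) * M.det_eq

lemma form_nonneg {A B C : ℝ} (h0 : 0 ≤ A + C) (h : B ^ 2 ≤ 4 * (A * C)) (x y : ℝ) :
    0 ≤ A * x ^ 2 + B * (x * y) + C * y ^ 2 := by
  have hAC : 0 ≤ A * C := by nlinarith [sq_nonneg B]
  have hA : 0 ≤ A := by
    by_contra! hA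
    have : 0 < C := by linarith
    nlinarith
  rcases hA.lt_or_eq with hA | hA
  · have : 0 ≤ 4 * A * (A * x ^ 2 + B * (x * y) + C * y ^ 2) := by
      nlinarith [sq_nonneg (2 * A * x + B * y), sq_nonneg y]
    exact nonneg_of_mul_nonneg_right this (by positivity)
  · rw [← hA] at h h0 ⊢
    have hB : B = 0 := by nlinarith [sq_nonneg B]
    rw [hB]
    have : 0 ≤ C := by linarith
    nlinarith [mul_nonneg this (sq_nonneg y)]

lemma form_pos {A B C : ℝ} (h0 : 0 ≤ A + C) (h : B ^ 2 < 4 * (A * C)) (s : ℝ) :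
    0 < A * Real.cos s ^ 2 + B * (Real.cos s * Real.sin s) + C * Real.sin s ^ 2 := by
  have hAC : 0 < A * C := by nlinarith [sq_nonneg B]
  have hA : 0 < A := by
    by_contra! hA
    have : C < 0 := by nlinarith
    have : A = 0 := by linarith
    rw [this] at hAC
    simp at hAC
  have h1 := Real.sin_sq_add_cos_sq s
  have : 0 < 4 * A * (A * Real.cos s ^ 2 + B * (Real.cos s * Real.sin s) +
      C * Real.sin s ^ 2) := by
    by_cases hs : Real.sin s = 0
    · rw [hs] at h1 ⊢
      have : Real.cos s ^ 2 = 1 := by linarith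
      rw [this]; nlinarith
    · have := sq_pos_of_ne_zero hs
      nlinarith [sq_nonneg (2 * A * Real.cos s + B * Real.sin s)]
  exact pos_of_mul_pos_right this (by positivity)

variable {β β₁ β₂ κ : ℝ}

lemma im_linPart_nonneg (hβ : β ∈ Ioo (0 : ℝ) 1) (hφ : totalAngle β he ≤ π) :
    0 ≤ (linPart (monodromy β he)).im := by
  rw [im_linPart_eq (linPart_monodromy he β)]
  exact mul_nonneg (norm_nonneg _)
    (Real.sin_nonneg_of_nonneg_of_le_pi (totalAngle_mem he hβ).1.le hφ)

lemma turn_sub_le_pi (hβ : β ∈ Ioo (0 : ℝ) 1) (hφ : totalAngle β he ≤ π)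
    (hx : -1 ≤ (linPart (monodromy β he)).re) (a : ℝ) : turn β he a - a ≤ π := by
  by_contra! h
  have h1 := turn_sub_mem he hβ a
  have h2 := form_eq_norm_mul_sin he β a
  have h3 := mul_neg_of_pos_of_neg (norm_act_pos (monodromy β he) a) (sin_neg_of_pi_lt h h1.2)
  have h4 := disc_form (monodromy β he)
  have h5 := im_linPart_nonneg he hβ hφ
  have h6 := re_linPart_lt_one he hβ
  have h7 := form_nonneg (A := monodromy β he 1 0) (B := monodromy β he 1 1 - monodromy β he 0 0)
    (C := -monodromy β he 0 1) (by simp only [linPart] at h5; linarith) (by nlinarith)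
    (Real.cos a) (Real.sin a)
  linarith

lemma turn_sub_lt_pi (hβ : β ∈ Ioo (0 : ℝ) 1) (hφ : totalAngle β he ≤ π)
    (hx : -1 < (linPart (monodromy β he)).re) (a : ℝ) : turn β he a - a < π := by
  refine lt_of_le_of_ne (turn_sub_le_pi he hβ hφ hx.le a) fun h => ?_
  have h2 := form_eq_norm_mul_sin he β a
  rw [h, Real.sin_pi, mul_zero] at h2
  have h4 := disc_form (monodromy β he)
  have h5 := im_linPart_nonneg he hβ hφ
  have h6 := re_linPart_lt_one he hβ
  have h7 := form_pos (A := monodromy β he 1 0) (B := monodromy β he 1 1 - monodromy β he 0 0)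
    (C := -monodromy β he 0 1) (by simp only [linPart] at h5; linarith) (by nlinarith) a
  linarith

lemma pi_lt_turn_sub (hβ : β ∈ Ioo (0 : ℝ) 1) (hφ : π < totalAngle β he)
    (hx : -1 < (linPart (monodromy β he)).re) (a : ℝ) : π < turn β he a - a := by
  by_contra! h
  have h1 := turn_sub_mem he hβ a
  have h2 := form_eq_norm_mul_sin he β a
  have h3 := mul_nonneg (norm_act_pos (monodromy β he) a).le
    (Real.sin_nonneg_of_nonneg_of_le_pi h1.1.le h)
  have h4 := disc_form (monodromy β he)
  have h5 : (linPart (monodromy β he)).im ≤ 0 := by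
    rw [im_linPart_eq (linPart_monodromy he β)]
    exact mul_nonpos_of_nonneg_of_nonpos (norm_nonneg _)
      (sin_neg_of_pi_lt hφ (totalAngle_mem he hβ).2).le
  have h6 := re_linPart_lt_one he hβ
  have h7 := form_pos (A := -monodromy β he 1 0)
    (B := -(monodromy β he 1 1 - monodromy β he 0 0))
    (C := monodromy β he 0 1) (by simp only [linPart] at h5; linarith) (by nlinarith) a
  linarith

/-- If the index vanishes at `β₁`, it vanishes at `β₂ > β₁`. -/
lemma lower_persists (hκ : -1 ≤ κ) (h₁ : β₁ ∈ Ioo (0 : ℝ) 1) (h₂ : β₂ ∈ Ioo (0 : ℝ) 1)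
    (hβ : β₁ < β₂) (hφ : totalAngle β₁ he ≤ π) (hx : κ ≤ (linPart (monodromy β₁ he)).re) :
    totalAngle β₂ he ≤ π ∧ κ ≤ (linPart (monodromy β₂ he)).re := by
  have hle := turn_sub_le_pi he h₁ hφ (hκ.trans hx)
  have hlt : ∀ a, turn β₂ he a - a < π := fun a => by
    linarith [hle a, turn_lt_turn he hβ a]
  refine ⟨?_, ?_⟩
  · obtain ⟨a, ha⟩ := exists_turn_eq he β₂
    linarith [hlt a]
  · rcases (hκ.trans hx).lt_or_eq with h | h
    · exact hx.trans (re_linPart_lt_of_turn_lt_pi he hβ (turn_sub_lt_pi he h₁ hφ h)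
        fun a => (turn_sub_mem he h₂ a).1).le
    · have h4 := disc_form (monodromy β₂ he)
      have h5 := posDef_of_forall (A := monodromy β₂ he 1 0)
        (B := monodromy β₂ he 1 1 - monodromy β₂ he 0 0) (C := -monodromy β₂ he 0 1) fun s => by
          have h6 := form_eq_norm_mul_sin he β₂ s
          have h7 := mul_pos (norm_act_pos (monodromy β₂ he) s)
            (Real.sin_pos_of_pos_of_lt_pi (turn_sub_mem he h₂ s).1 (hlt s))
          linarith
      have h6 : (linPart (monodromy β₂ he)).re ^ 2 < 1 := by linarith [h5.2.2]
      nlinarith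

/-- If the index is two at `β₂`, it is two at `β₁ < β₂`. -/
lemma upper_persists (hκ : -1 ≤ κ) (h₁ : β₁ ∈ Ioo (0 : ℝ) 1) (h₂ : β₂ ∈ Ioo (0 : ℝ) 1)
    (hβ : β₁ < β₂) (hφ : π < totalAngle β₂ he) (hx : κ < (linPart (monodromy β₂ he)).re) :
    π < totalAngle β₁ he ∧ κ < (linPart (monodromy β₁ he)).re := by
  have hgt := pi_lt_turn_sub he h₂ hφ (hκ.trans_lt hx)
  refine ⟨?_, ?_⟩
  · obtain ⟨a, ha⟩ := exists_turn_eq he β₁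
    linarith [hgt a, turn_lt_turn he hβ a]
  · exact hx.trans (re_linPart_lt_of_pi_lt_turn he hβ (fun a => (turn_sub_mem he h₁ a).2) hgt)

/-! ### The indices of `γ_{β,e}` -/

variable {ω : ℂ}

/-- The index of `γ_{β,e}` in terms of the total angle and the modulus of the linear part. -/
lemma isOmegaIndex_gammaPath (hω : ‖ω‖ = 1) {k : ℤ}
    (hk : ∀ᶠ ε : ℝ in 𝓝[>] 0,
      ‖linPart (monodromy β he)‖ * Real.cos (totalAngle β he - ε) ≠ ω.re ∧
      level ω.re (‖linPart (monodromy β he)‖ * Real.cos (totalAngle β he - ε))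
        (totalAngle β he - ε) = k) : IsOmegaIndex ω (gammaPath β he) k :=
  isOmegaIndex_of_eventually hω (exists_gammaAngle β he).choose_spec.1
    (exists_gammaAngle β he).choose_spec.2 hk

lemma norm_linPart_pos (M : Sp2) : 0 < ‖linPart M‖ := norm_pos_iff.2 (linPart_ne_zero M)

lemma isOmegaIndex_zero (hω : ‖ω‖ = 1) (h0 : 0 < totalAngle β he) (hφ : totalAngle β he ≤ π)
    (hx : ω.re ≤ (linPart (monodromy β he)).re) : IsOmegaIndex ω (gammaPath β he) 0 := by
  rw [re_linPart_eq (linPart_monodromy he β)] at hx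
  exact isOmegaIndex_gammaPath he hω (eventually_level_zero (norm_linPart_pos _) h0 hφ hx)

lemma isOmegaIndex_two (hω : ‖ω‖ = 1) (hφ : π < totalAngle β he) (hφ' : totalAngle β he ≤ 2 * π)
    (hx : ω.re < (linPart (monodromy β he)).re) : IsOmegaIndex ω (gammaPath β he) 2 := by
  rw [re_linPart_eq (linPart_monodromy he β)] at hx
  exact isOmegaIndex_gammaPath he hω (eventually_level_two hφ hφ' hx)

lemma isOmegaIndex_one (hω : ‖ω‖ = 1) (h0 : 0 < totalAngle β he)
    (hφ : totalAngle β he ≤ 2 * π) (hx : (linPart (monodromy β he)).re < ω.re) :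
    IsOmegaIndex ω (gammaPath β he) 1 := by
  rw [re_linPart_eq (linPart_monodromy he β)] at hx
  exact isOmegaIndex_gammaPath he hω (eventually_level_one h0 hφ hx)

lemma isOmegaIndex_one' (hω : ‖ω‖ = 1) (h0 : π < totalAngle β he)
    (hφ : totalAngle β he ≤ 2 * π) (hx : (linPart (monodromy β he)).re = ω.re) :
    IsOmegaIndex ω (gammaPath β he) 1 := by
  rw [re_linPart_eq (linPart_monodromy he β)] at hx
  exact isOmegaIndex_gammaPath he hω (eventually_level_one' (norm_linPart_pos _) h0 hφ hx)

lemma isOmegaIndex_at_one (hω : ‖ω‖ = 1) : IsOmegaIndex ω (gammaPath 1 he) 0 := by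
  have h := totalAngle_one he
  refine isOmegaIndex_zero he hω h.1 (by linarith [h.2, Real.pi_pos]) ?_
  rw [re_linPart_monodromy_one]
  exact (re_mem_Icc hω).2

lemma re_linPart_monodromy_zero : (linPart (monodromy 0 he)).re = 1 := by
  rw [re_linPart_eq (linPart_monodromy he 0), norm_linPart_monodromy_zero, totalAngle_zero,
    Real.cos_two_pi, mul_one]

lemma re_lt_one (hω : ‖ω‖ = 1) (hω1 : ω ≠ 1) : ω.re < 1 := by
  refine lt_of_le_of_ne (re_mem_Icc hω).2 fun h => hω1 ?_
  have h1 : ω.re * ω.re + ω.im * ω.im = 1 := by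
    rw [← Complex.normSq_apply, Complex.normSq_eq_norm_sq, hω]; norm_num
  have h2 : ω.im = 0 := by
    rw [h] at h1
    nlinarith
  exact Complex.ext h h2

lemma isOmegaIndex_at_zero (hω : ‖ω‖ = 1) (hω1 : ω ≠ 1) :
    IsOmegaIndex ω (gammaPath 0 he) 2 := by
  refine isOmegaIndex_two he hω ?_ (totalAngle_zero he).le ?_
  · rw [totalAngle_zero]; linarith [Real.pi_pos]
  · rw [re_linPart_monodromy_zero]; exact re_lt_one hω hω1

/-- For `0 < β < 1` the end point has total angle in `(0, 2π)` and real part below `1`, so it lies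
at level one with respect to the wall `{x = 1}`. For `β = 0` it lies on the wall, and the limit is
taken from this component. -/
lemma isOmegaIndex_periodic (hβ : β ∈ Ico (0 : ℝ) 1) :
    IsOmegaIndex 1 (gammaPath β he) 1 := by
  rcases hβ.1.lt_or_eq with h | rfl
  · have hm : β ∈ Ioo (0 : ℝ) 1 := ⟨h, hβ.2⟩
    exact isOmegaIndex_one he (by simp) (totalAngle_mem he hm).1 (totalAngle_mem he hm).2.le
      (by simpa using re_linPart_lt_one he hm)
  · refine isOmegaIndex_one' he (by simp) ?_ (totalAngle_zero he).le ?_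
    · rw [totalAngle_zero]; linarith [Real.pi_pos]
    · rw [re_linPart_monodromy_zero]; simp

/-- For `0 < β < 1` the index takes one of the values `0, 1, 2`, according to the position of the
end point in the universal covering. -/
lemma isOmegaIndex_cases (hω : ‖ω‖ = 1) (hβ : β ∈ Ioo (0 : ℝ) 1) :
    (IsOmegaIndex ω (gammaPath β he) 0 ∧ totalAngle β he ≤ π ∧
      ω.re ≤ (linPart (monodromy β he)).re) ∨
    (IsOmegaIndex ω (gammaPath β he) 2 ∧ π < totalAngle β he ∧
      ω.re < (linPart (monodromy β he)).re) ∨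
    (IsOmegaIndex ω (gammaPath β he) 1 ∧
      ¬ (totalAngle β he ≤ π ∧ ω.re ≤ (linPart (monodromy β he)).re) ∧
      ¬ (π < totalAngle β he ∧ ω.re < (linPart (monodromy β he)).re)) := by
  have hφ := totalAngle_mem he hβ
  rcases lt_trichotomy (linPart (monodromy β he)).re ω.re with h | h | h
  · exact Or.inr (Or.inr ⟨isOmegaIndex_one he hω hφ.1 hφ.2.le h, fun h' => by linarith [h'.2],
      fun h' => by linarith [h'.2]⟩)
  · rcases le_or_gt (totalAngle β he) π with h' | h'
    · exact Or.inl ⟨isOmegaIndex_zero he hω hφ.1 h' h.ge, h', h.ge⟩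
    · exact Or.inr (Or.inr ⟨isOmegaIndex_one' he hω h' hφ.2.le h, fun h'' => by linarith [h''.1],
        fun h'' => by linarith [h''.2]⟩)
  · rcases le_or_gt (totalAngle β he) π with h' | h'
    · exact Or.inl ⟨isOmegaIndex_zero he hω hφ.1 h' h.le, h', h.le⟩
    · exact Or.inr (Or.inl ⟨isOmegaIndex_two he hω h' hφ.2.le h, h', h⟩)

lemma exists_isOmegaIndex (hω : ‖ω‖ = 1) (hβ : β ∈ Icc (0 : ℝ) 1) :
    ∃ k, IsOmegaIndex ω (gammaPath β he) k := by
  rcases hβ.2.lt_or_eq with h1 | rfl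
  · rcases hβ.1.lt_or_eq with h0 | rfl
    · rcases isOmegaIndex_cases he hω ⟨h0, h1⟩ with h | h | h
      exacts [⟨_, h.1⟩, ⟨_, h.1⟩, ⟨_, h.1⟩]
    · by_cases hω1 : ω = 1
      · subst hω1
        exact ⟨_, isOmegaIndex_periodic he ⟨le_rfl, zero_lt_one⟩⟩
      · exact ⟨_, isOmegaIndex_at_zero he hω hω1⟩
  · exact ⟨_, isOmegaIndex_at_one he hω⟩

lemma existsUnique_isOmegaIndex (hω : ‖ω‖ = 1) (hβ : β ∈ Icc (0 : ℝ) 1) :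
    ∃! k, IsOmegaIndex ω (gammaPath β he) k := by
  obtain ⟨k, hk⟩ := exists_isOmegaIndex he hω hβ
  exact ⟨k, hk, fun l hl => hl.unique hω hk⟩

/-- With values in `{0, 1, 2}` on `(0,1)`, the index is non-increasing because the value `0`
persists for larger `β` and the value `2` for smaller `β`. -/
lemma antitoneOn_iGamma (hω : ‖ω‖ = 1) :
    AntitoneOn (fun β : ℝ => iGamma ω β he) (Icc 0 1) := by
  intro β₁ h₁ β₂ h₂ hle
  rcases hle.lt_or_eq with hlt | rfl
  swap
  · exact le_rfl
  have val : ∀ {β : ℝ} {k : ℤ}, IsOmegaIndex ω (gammaPath β he) k → iGamma ω β he = k :=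
    fun h => h.omegaIndex_eq hω
  have hκ := (re_mem_Icc hω).1
  change iGamma ω β₂ he ≤ iGamma ω β₁ he
  rcases h₁.1.lt_or_eq with h10 | rfl
  · have hm₁ : β₁ ∈ Ioo (0 : ℝ) 1 := ⟨h10, hlt.trans_le h₂.2⟩
    rcases h₂.2.lt_or_eq with h21 | rfl
    · have hm₂ : β₂ ∈ Ioo (0 : ℝ) 1 := ⟨h10.trans hlt, h21⟩
      rcases isOmegaIndex_cases he hω hm₁ with ⟨a, b⟩ | ⟨a, b⟩ | ⟨a, b, c⟩ <;>
      rcases isOmegaIndex_cases he hω hm₂ with ⟨a', b'⟩ | ⟨a', b'⟩ | ⟨a', b', c'⟩ <;>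
      rw [val a, val a'] <;> try norm_num
      · have := lower_persists he hκ hm₁ hm₂ hlt b.1 b.2
        linarith [this.1, b'.1]
      · exact b' (lower_persists he hκ hm₁ hm₂ hlt b.1 b.2)
      · exact c (upper_persists he hκ hm₁ hm₂ hlt b'.1 b'.2)
    · rw [val (isOmegaIndex_at_one he hω)]
      rcases isOmegaIndex_cases he hω hm₁ with ⟨a, b⟩ | ⟨a, b⟩ | ⟨a, b, c⟩ <;>
      rw [val a] <;> norm_num
  · by_cases hω1 : ω = 1
    · subst hω1
      rw [val (isOmegaIndex_periodic he (β := 0) ⟨le_rfl, zero_lt_one⟩)]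
      rcases h₂.2.lt_or_eq with h21 | rfl
      · rw [val (isOmegaIndex_periodic he ⟨h₂.1, h21⟩)]
      · rw [val (isOmegaIndex_at_one he hω)]; norm_num
    · rw [val (isOmegaIndex_at_zero he hω hω1)]
      rcases h₂.2.lt_or_eq with h21 | rfl
      · rcases isOmegaIndex_cases he hω ⟨hlt, h21⟩ with ⟨a, b⟩ | ⟨a, b⟩ | ⟨a, b, c⟩ <;>
        rw [val a] <;> norm_num
      · rw [val (isOmegaIndex_at_one he hω)]; norm_num

/-- For small `β` the total angle is at least `2π - 2πβ/(1-e)`, close to `2π`. -/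
lemma eventually_isOmegaIndex_two (hω : ‖ω‖ = 1) (hω1 : ω ≠ 1) :
    ∀ᶠ β in 𝓝[>] (0 : ℝ), IsOmegaIndex ω (gammaPath β he) 2 := by
  have he1 : 0 < 1 - e := by linarith [he.2]
  have hp := Real.pi_pos
  have hc : Continuous fun β : ℝ => β / (1 - e) * (2 * π) := by fun_prop
  have hc' : Continuous fun β : ℝ => Real.cos (β / (1 - e) * (2 * π)) := by fun_prop
  have e1 : ∀ᶠ β in 𝓝[>] (0 : ℝ), β / (1 - e) * (2 * π) < π / 2 :=
    ((hc.tendsto 0).eventually (gt_mem_nhds (by simp; positivity))).filter_mono nhdsWithin_le_nhds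
  have e2 : ∀ᶠ β in 𝓝[>] (0 : ℝ), ω.re < Real.cos (β / (1 - e) * (2 * π)) :=
    ((hc'.tendsto 0).eventually (lt_mem_nhds (by simpa using re_lt_one hω hω1))).filter_mono
      nhdsWithin_le_nhds
  filter_upwards [e1, e2, Ioo_mem_nhdsGT zero_lt_one] with β h1 h2 hβ
  obtain ⟨a, ha⟩ := exists_turn_eq he β
  have hb := (turn_bounds he hβ.1.le a).1
  have hφ := totalAngle_mem he hβ
  have hlow : 2 * π - β / (1 - e) * (2 * π) ≤ totalAngle β he := by linarith
  refine isOmegaIndex_two he hω (by linarith) hφ.2.le (h2.trans_le ?_)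
  have h3 : Real.cos (β / (1 - e) * (2 * π)) ≤ Real.cos (totalAngle β he) := by
    rw [← Real.cos_two_pi_sub (totalAngle β he)]
    exact Real.cos_le_cos_of_nonneg_of_le_pi (by linarith [hφ.2]) (by linarith) (by linarith)
  have h4 : 0 ≤ Real.cos (β / (1 - e) * (2 * π)) := by
    refine Real.cos_nonneg_of_mem_Icc ⟨?_, h1.le⟩
    have : 0 ≤ β / (1 - e) * (2 * π) := by have := hβ.1; positivity
    linarith
  rw [re_linPart_eq (linPart_monodromy he β)]
  exact h3.trans (le_mul_of_one_le_left (h4.trans h3) (one_le_norm_linPart _))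

/-- At `β = 1` the linear part has real part `1 > Re ω` and positive imaginary part, and both
inequalities persist for `β` close to one. -/
lemma eventually_isOmegaIndex_zero (hω : ‖ω‖ = 1) (hω1 : ω ≠ 1) :
    ∀ᶠ β in 𝓝[<] (1 : ℝ), IsOmegaIndex ω (gammaPath β he) 0 := by
  obtain ⟨t1, t2⟩ := tendsto_linPart_monodromy he
  rw [re_linPart_monodromy_one] at t1
  filter_upwards [(t1.eventually (lt_mem_nhds (re_lt_one hω hω1))).filter_mono nhdsWithin_le_nhds,
    (t2.eventually (lt_mem_nhds (im_linPart_monodromy_one he))).filter_mono nhdsWithin_le_nhds,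
    Ioo_mem_nhdsLT zero_lt_one] with β h1 h2 hβ
  have hφ := totalAngle_mem he hβ
  refine isOmegaIndex_zero he hω hφ.1 ?_ h1.le
  by_contra! h
  rw [im_linPart_eq (linPart_monodromy he β)] at h2
  have := pos_of_mul_pos_right h2 (norm_nonneg _)
  linarith [sin_neg_of_pi_lt h hφ.2]

lemma nuGamma_eq_zero (hβ : β ∈ Ioo (0 : ℝ) 1) : nuGamma 1 β he = 0 := by
  have h : (shiftMat 1 (monodromy β he)).det ≠ 0 := by
    intro h
    have h1 := coe_Dfun (ω := 1) (by simp) (monodromy β he)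
    rw [h, mul_zero, Complex.ofReal_eq_zero, Dfun_eq (by simp)] at h1
    have := re_linPart_lt_one he hβ
    rw [Complex.one_re] at h1
    linarith
  rw [nuGamma, nuM, Submodule.finrank_eq_zero, Matrix.ker_toLin'_eq_bot_iff]
  exact fun v hv => Matrix.eq_zero_of_mulVec_eq_zero h hv

end

/-! ### Integration by parts -/

/-- Integration by parts for primitives of integrable functions, by Fubini's theorem. -/
lemma integral_mul_primitive {W h : ℝ → ℂ} (hW : Integrable W muT) (hh : Integrable h muT) :
    ∫ s in (0 : ℝ)..2 * π, W s * ∫ t in (0 : ℝ)..s, h t =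
      (∫ s in (0 : ℝ)..2 * π, W s) * (∫ t in (0 : ℝ)..2 * π, h t) -
        ∫ t in (0 : ℝ)..2 * π, (∫ s in (0 : ℝ)..t, W s) * h t := by
  have hmeas : MeasurableSet {q : ℝ × ℝ | q.2 ≤ q.1} :=
    (isClosed_le continuous_snd continuous_fst).measurableSet
  have hint : Integrable ({q : ℝ × ℝ | q.2 ≤ q.1}.indicator fun q => W q.1 * h q.2)
      (muT.prod muT) := (hW.mul_prod hh).indicator hmeas
  have hsub : ∀ {g : ℝ → ℂ}, Integrable g muT → ∀ t ∈ Ioc (0 : ℝ) (2 * π),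
      IntervalIntegrable g volume 0 t ∧ IntervalIntegrable g volume t (2 * π) := by
    intro g hg t ht
    have h1 : IntervalIntegrable g volume 0 (2 * π) :=
      (intervalIntegrable_iff_integrableOn_Ioc_of_le two_pi_nonneg).2 hg
    have h2 := intervalIntegrable_sub h1 ⟨ht.1.le, ht.2⟩
    exact ⟨h2, h2.symm.trans h1⟩
  have e1 : ∫ s, ∫ t, ({q : ℝ × ℝ | q.2 ≤ q.1}.indicator fun q => W q.1 * h q.2) (s, t) ∂muT ∂muT =
      ∫ s in (0 : ℝ)..2 * π, W s * ∫ t in (0 : ℝ)..s, h t := by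
    rw [intervalIntegral.integral_of_le two_pi_nonneg]
    refine setIntegral_congr_fun measurableSet_Ioc fun s hs => ?_
    have : (fun t => ({q : ℝ × ℝ | q.2 ≤ q.1}.indicator fun q => W q.1 * h q.2) (s, t)) =
        (Iic s).indicator fun t => W s * h t := by
      funext t; simp [indicator]
    rw [this, integral_indicator measurableSet_Iic, Measure.restrict_restrict measurableSet_Iic,
      show Iic s ∩ Ioc 0 (2 * π) = Ioc 0 s by
        ext t; simp only [mem_inter_iff, mem_Iic, mem_Ioc]
        exact ⟨fun h => ⟨h.2.1, h.1⟩, fun h => ⟨h.2, h.1, h.2.trans hs.2⟩⟩,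
      intervalIntegral.integral_of_le hs.1.le, integral_const_mul]
  have e2 : ∫ t, ∫ s, ({q : ℝ × ℝ | q.2 ≤ q.1}.indicator fun q => W q.1 * h q.2) (s, t) ∂muT ∂muT =
      ∫ t in (0 : ℝ)..2 * π, (∫ s in t..2 * π, W s) * h t := by
    rw [intervalIntegral.integral_of_le two_pi_nonneg]
    refine setIntegral_congr_fun measurableSet_Ioc fun t ht => ?_
    have : (fun s => ({q : ℝ × ℝ | q.2 ≤ q.1}.indicator fun q => W q.1 * h q.2) (s, t)) =
        (Ici t).indicator fun s => W s * h t := by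
      funext s; simp [indicator]
    rw [this, integral_indicator measurableSet_Ici, Measure.restrict_restrict measurableSet_Ici,
      show Ici t ∩ Ioc 0 (2 * π) = Icc t (2 * π) by
        ext s; simp only [mem_inter_iff, mem_Ici, mem_Ioc, mem_Icc]
        exact ⟨fun h => ⟨h.1, h.2.2⟩, fun h => ⟨h.1, ht.1.trans_le h.1, h.2⟩⟩,
      intervalIntegral.integral_of_le ht.2, integral_mul_const, integral_Icc_eq_integral_Ioc]
  have hW' : IntervalIntegrable W volume 0 (2 * π) :=
    (intervalIntegrable_iff_integrableOn_Ioc_of_le two_pi_nonneg).2 hW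
  have hh' : IntervalIntegrable h volume 0 (2 * π) :=
    (intervalIntegrable_iff_integrableOn_Ioc_of_le two_pi_nonneg).2 hh
  have hprim : ContinuousOn (fun t => ∫ s in (0 : ℝ)..t, W s) (uIcc 0 (2 * π)) :=
    intervalIntegral.continuousOn_primitive_interval' hW' left_mem_uIcc
  rw [← e1, integral_integral_swap (f := fun s t =>
    ({q : ℝ × ℝ | q.2 ≤ q.1}.indicator fun q => W q.1 * h q.2) (s, t)) hint, e2,
    ← intervalIntegral.integral_const_mul,
    ← intervalIntegral.integral_sub (hh'.const_mul _) (hh'.continuousOn_mul hprim)]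
  rw [intervalIntegral.integral_of_le two_pi_nonneg, intervalIntegral.integral_of_le two_pi_nonneg]
  refine setIntegral_congr_fun measurableSet_Ioc fun t ht => ?_
  have := intervalIntegral.integral_add_adjacent_intervals (hsub hW t ht).1 (hsub hW t ht).2
  rw [← this]
  ring

/-- Integration by parts for functions with integrable weak derivatives. -/
lemma integral_deriv_mul {f f' g g' : ℝ → ℂ} (hf' : IntervalIntegrable f' volume 0 (2 * π))
    (hg' : IntervalIntegrable g' volume 0 (2 * π))
    (hf : ∀ t ∈ Icc (0 : ℝ) (2 * π), f t = f 0 + ∫ s in (0 : ℝ)..t, f' s)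
    (hg : ∀ t ∈ Icc (0 : ℝ) (2 * π), g t = g 0 + ∫ s in (0 : ℝ)..t, g' s) :
    ∫ t in (0 : ℝ)..2 * π, f' t * g t =
      f (2 * π) * g (2 * π) - f 0 * g 0 - ∫ t in (0 : ℝ)..2 * π, f t * g' t := by
  have key := integral_mul_primitive
    ((intervalIntegrable_iff_integrableOn_Ioc_of_le two_pi_nonneg).1 hf')
    ((intervalIntegrable_iff_integrableOn_Ioc_of_le two_pi_nonneg).1 hg')
  have hT : (2 * π) ∈ Icc (0 : ℝ) (2 * π) := ⟨two_pi_nonneg, le_rfl⟩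
  have pf : ContinuousOn (fun t => ∫ s in (0 : ℝ)..t, f' s) (uIcc 0 (2 * π)) :=
    intervalIntegral.continuousOn_primitive_interval' hf' left_mem_uIcc
  have pg : ContinuousOn (fun t => ∫ s in (0 : ℝ)..t, g' s) (uIcc 0 (2 * π)) :=
    intervalIntegral.continuousOn_primitive_interval' hg' left_mem_uIcc
  have e1 : ∫ t in (0 : ℝ)..2 * π, f' t * g t =
      (∫ t in (0 : ℝ)..2 * π, f' t * g 0) +
        ∫ t in (0 : ℝ)..2 * π, f' t * ∫ s in (0 : ℝ)..t, g' s := by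
    rw [← intervalIntegral.integral_add (hf'.mul_const _) (hf'.mul_continuousOn pg)]
    refine intervalIntegral.integral_congr fun t ht => ?_
    rw [uIcc_of_le two_pi_nonneg] at ht
    rw [hg t ht]
    ring
  have e2 : ∫ t in (0 : ℝ)..2 * π, f t * g' t =
      (∫ t in (0 : ℝ)..2 * π, f 0 * g' t) +
        ∫ t in (0 : ℝ)..2 * π, (∫ s in (0 : ℝ)..t, f' s) * g' t := by
    rw [← intervalIntegral.integral_add (hg'.const_mul _) (hg'.continuousOn_mul pf)]
    refine intervalIntegral.integral_congr fun t ht => ?_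
    rw [uIcc_of_le two_pi_nonneg] at ht
    rw [hf t ht]
    ring
  rw [e1, e2, key, intervalIntegral.integral_mul_const, intervalIntegral.integral_const_mul,
    hf _ hT, hg _ hT]
  ring

lemma primitive_conj {f g : ℝ → ℂ}
    (h : ∀ t ∈ Icc (0 : ℝ) (2 * π), f t = f 0 + ∫ s in (0 : ℝ)..t, g s) :
    ∀ t ∈ Icc (0 : ℝ) (2 * π), conj (f t) = conj (f 0) + ∫ s in (0 : ℝ)..t, conj (g s) := by
  intro t ht
  rw [h t ht, map_add, intervalIntegral.integral_of_le ht.1, intervalIntegral.integral_of_le ht.1,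
    integral_conj]

lemma intervalIntegrable_conj {g : ℝ → ℂ} {a b : ℝ} (h : IntervalIntegrable g volume a b) :
    IntervalIntegrable (fun t => conj (g t)) volume a b :=
  ⟨Complex.conjCLE.toContinuousLinearMap.integrable_comp h.1,
    Complex.conjCLE.toContinuousLinearMap.integrable_comp h.2⟩

/-! ### The quadratic form of `A(β,e)` -/

lemma memLp_of_continuousOn {u : ℝ → ℂ} (hu : ContinuousOn u (Icc 0 (2 * π))) :
    MemLp u 2 muT := by
  obtain ⟨C, hC⟩ := isCompact_Icc.exists_bound_of_continuousOn hu
  refine MemLp.of_bound ((hu.mono Ioc_subset_Icc_self).aestronglyMeasurable measurableSet_Ioc) C ?_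
  rw [ae_restrict_iff' measurableSet_Ioc]
  exact ae_of_all _ fun t ht => hC t (Ioc_subset_Icc_self ht)

lemma continuous_potential (β : ℝ) {e : ℝ} (he : e ∈ Ico (0 : ℝ) 1) :
    Continuous fun t => ((β / (1 + e * Real.cos t) : ℝ) : ℂ) :=
  Complex.continuous_ofReal.comp
    (continuous_const.div (by fun_prop) fun t => (denom_pos he t).ne')

section

variable {e : ℝ} {ω : ℂ} {β : ℝ}

/-- Each element of the domain has a representative in `W^{2,2}` with quasi-periodic boundary
values. -/
lemma exists_rep (y : (opA ω β e).domain) : ∃ u v w : ℝ → ℂ, IsW22 u v w ∧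
    u (2 * π) = ω * u 0 ∧ v (2 * π) = ω * v 0 ∧ ((y : L2) : ℝ → ℂ) =ᵐ[muT] u := by
  have h : ((y : L2), opA ω β e y) ∈ (opA ω β e).graph := (opA ω β e).mem_graph y
  rw [opA_graph] at h
  obtain ⟨u, v, w, h1, h2, h3, h4, -⟩ := h
  exact ⟨u, v, w, h1, h2, h3, h4⟩

lemma exists_domain_of_isW22 (he : e ∈ Ico (0 : ℝ) 1) (β : ℝ) {u v w : ℝ → ℂ} (h : IsW22 u v w)
    (hu : u (2 * π) = ω * u 0) (hv : v (2 * π) = ω * v 0) :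
    ∃ y : (opA ω β e).domain, ((y : L2) : ℝ → ℂ) =ᵐ[muT] u ∧
      (opA ω β e y : ℝ → ℂ) =ᵐ[muT]
        fun t => -w t - u t + ((β / (1 + e * Real.cos t) : ℝ) : ℂ) * u t := by
  have m1 : MemLp u 2 muT := memLp_of_continuousOn h.continuousOn_u
  have m2 : MemLp (fun t => ((β / (1 + e * Real.cos t) : ℝ) : ℂ) * u t) 2 muT :=
    memLp_of_continuousOn ((continuous_potential β he).continuousOn.mul h.continuousOn_u)
  have m3 : MemLp (fun t => -w t - u t + ((β / (1 + e * Real.cos t) : ℝ) : ℂ) * u t) 2 muT :=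
    (h.memLp.neg.sub m1).add m2
  have hg : (m1.toLp u, m3.toLp _) ∈ (opA ω β e).graph := by
    rw [opA_graph]
    exact ⟨u, v, w, h, hu, hv, m1.coeFn_toLp, m3.coeFn_toLp⟩
  rw [LinearPMap.mem_graph_iff] at hg
  obtain ⟨y, hy1, hy2⟩ := hg
  refine ⟨y, ?_, ?_⟩
  · rw [hy1]; exact m1.coeFn_toLp
  · rw [hy2]; exact m3.coeFn_toLp

lemma opA_ae (he : e ∈ Ico (0 : ℝ) 1) {u v w : ℝ → ℂ} (h : IsW22 u v w)
    (hu : u (2 * π) = ω * u 0) (hv : v (2 * π) = ω * v 0) (y : (opA ω β e).domain)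
    (hy : ((y : L2) : ℝ → ℂ) =ᵐ[muT] u) :
    (opA ω β e y : ℝ → ℂ) =ᵐ[muT]
      fun t => -w t - u t + ((β / (1 + e * Real.cos t) : ℝ) : ℂ) * u t := by
  obtain ⟨y', h1, h2⟩ := exists_domain_of_isW22 he β h hu hv
  have : y' = y := Subtype.ext (Lp.ext (h1.trans hy.symm))
  rwa [← this]

lemma domain_le (he : e ∈ Ico (0 : ℝ) 1) (β β' : ℝ) : (opA ω β e).domain ≤ (opA ω β' e).domain := by
  intro x hx
  obtain ⟨u, v, w, h, hu, hv, hy⟩ := exists_rep ⟨x, hx⟩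
  obtain ⟨y', h1, -⟩ := exists_domain_of_isW22 he β' h hu hv
  have : (y' : L2) = x := Lp.ext (h1.trans hy.symm)
  rw [← this]
  exact y'.2

lemma inner_eq_integral (f g : L2) {F G : ℝ → ℂ} (hf : (f : ℝ → ℂ) =ᵐ[muT] F)
    (hg : (g : ℝ → ℂ) =ᵐ[muT] G) :
    inner ℂ f g = ∫ t in (0 : ℝ)..2 * π, conj (F t) * G t := by
  rw [L2.inner_def, intervalIntegral.integral_of_le two_pi_nonneg]
  refine integral_congr_ae ?_
  filter_upwards [hf, hg] with t h1 h2
  rw [h1, h2, RCLike.inner_apply, mul_comm]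

lemma conj_mul_self_of_norm (hω : ‖ω‖ = 1) : conj ω * ω = 1 := by
  rw [← Complex.normSq_eq_conj_mul_self, Complex.normSq_eq_norm_sq, hω]; norm_num

/-- The sesquilinear form of `A(β,e)`. -/
lemma inner_opA (he : e ∈ Ico (0 : ℝ) 1) (hω : ‖ω‖ = 1) {u v w u' v' w' : ℝ → ℂ} (h : IsW22 u v w)
    (hu : u (2 * π) = ω * u 0) (hv : v (2 * π) = ω * v 0) (y : (opA ω β e).domain)
    (hy : ((y : L2) : ℝ → ℂ) =ᵐ[muT] u) (h' : IsW22 u' v' w') (hu' : u' (2 * π) = ω * u' 0)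
    {z : L2} (hz : (z : ℝ → ℂ) =ᵐ[muT] u') :
    inner ℂ (opA ω β e y) z = ∫ t in (0 : ℝ)..2 * π,
      (conj (v t) * v' t - (qfun β e t : ℂ) * (conj (u t) * u' t)) := by
  rw [inner_eq_integral _ _ (opA_ae he h hu hv y hy) hz]
  have cu : ContinuousOn u (uIcc 0 (2 * π)) := by
    rw [uIcc_of_le two_pi_nonneg]; exact h.continuousOn_u
  have cv : ContinuousOn v (uIcc 0 (2 * π)) := by
    rw [uIcc_of_le two_pi_nonneg]; exact h.continuousOn_v
  have cu' : ContinuousOn u' (uIcc 0 (2 * π)) := by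
    rw [uIcc_of_le two_pi_nonneg]; exact h'.continuousOn_u
  have cv' : ContinuousOn v' (uIcc 0 (2 * π)) := by
    rw [uIcc_of_le two_pi_nonneg]; exact h'.continuousOn_v
  have cc : Continuous (fun z : ℂ => conj z) := Complex.continuous_conj
  have i1 : IntervalIntegrable (fun t => conj (w t) * u' t) volume 0 (2 * π) :=
    (intervalIntegrable_conj h.intervalIntegrable_w).mul_continuousOn cu'
  have i2 : IntervalIntegrable (fun t => (qfun β e t : ℂ) * (conj (u t) * u' t)) volume
      0 (2 * π) :=
    ((Complex.continuous_ofReal.comp (continuous_qfun β he)).continuousOn.mul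
      ((cc.comp_continuousOn cu).mul cu')).intervalIntegrable
  have i3 : IntervalIntegrable (fun t => conj (v t) * v' t) volume 0 (2 * π) :=
    ((cc.comp_continuousOn cv).mul cv').intervalIntegrable
  have key := integral_deriv_mul (f := fun t => conj (v t))
    (intervalIntegrable_conj h.intervalIntegrable_w)
    h'.intervalIntegrable_v (primitive_conj h.mid_eq) h'.left_eq
  have hb : conj (v (2 * π)) * u' (2 * π) = conj (v 0) * u' 0 := by
    rw [hv, hu', map_mul]
    linear_combination (conj (v 0) * u' 0) * conj_mul_self_of_norm hω
  rw [hb, sub_self, zero_sub] at key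
  rw [intervalIntegral.integral_sub i3 i2, ← neg_eq_iff_eq_neg.2 key,
    ← intervalIntegral.integral_neg, ← intervalIntegral.integral_sub
      (f := fun t => -(conj (w t) * u' t)) i1.neg i2]
  refine intervalIntegral.integral_congr fun t _ => ?_
  simp only [map_add, map_sub, map_neg, map_mul, Complex.conj_ofReal, qfun]
  push_cast
  ring

/-- The quadratic form of `A(β,e)`. -/
lemma re_inner_opA (he : e ∈ Ico (0 : ℝ) 1) (hω : ‖ω‖ = 1) {u v w : ℝ → ℂ} (h : IsW22 u v w)
    (hu : u (2 * π) = ω * u 0) (hv : v (2 * π) = ω * v 0) (y : (opA ω β e).domain)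
    (hy : ((y : L2) : ℝ → ℂ) =ᵐ[muT] u) :
    (inner ℂ (opA ω β e y) (y : L2)).re = ∫ t in (0 : ℝ)..2 * π,
      (‖v t‖ ^ 2 - qfun β e t * ‖u t‖ ^ 2) := by
  rw [inner_opA he hω h hu hv y hy h hu hy]
  have : (fun t => conj (v t) * v t - (qfun β e t : ℂ) * (conj (u t) * u t)) =
      fun t => ((‖v t‖ ^ 2 - qfun β e t * ‖u t‖ ^ 2 : ℝ) : ℂ) := by
    funext t
    rw [Complex.conj_mul', Complex.conj_mul']
    push_cast
    ring
  rw [this, intervalIntegral.integral_ofReal, Complex.ofReal_re]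

end

section Integrable

variable {u v w : ℝ → ℂ}

lemma IsW22.continuousOn_norm_sq_u (h : IsW22 u v w) :
    ContinuousOn (fun t => ‖u t‖ ^ 2) (uIcc 0 (2 * π)) := by
  rw [uIcc_of_le two_pi_nonneg]; exact h.continuousOn_u.norm.pow 2

lemma IsW22.continuousOn_norm_sq_v (h : IsW22 u v w) :
    ContinuousOn (fun t => ‖v t‖ ^ 2) (uIcc 0 (2 * π)) := by
  rw [uIcc_of_le two_pi_nonneg]; exact h.continuousOn_v.norm.pow 2

end Integrable

/-! ### Estimates for Morse indices -/

section Abstract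

variable {H : Type} [NormedAddCommGroup H] [InnerProductSpace ℂ H]

/-- A smaller form on a larger domain has a larger Morse index. -/
lemma morseIndex_mono {T T' : H →ₗ.[ℂ] H} (hd : T.domain ≤ T'.domain)
    (h : ∀ (y : T.domain) (y' : T'.domain), (y' : H) = y →
      (inner ℂ (T' y') (y' : H)).re ≤ (inner ℂ (T y) (y : H)).re) :
    morseIndex T ≤ morseIndex T' := by
  refine iSup_le fun V => ?_
  have hneg : IsNegDef T' (V.1.map (Submodule.inclusion hd)) := by
    rintro _ ⟨y, hy, rfl⟩ hne
    refine (h y _ (Submodule.coe_inclusion hd y)).trans_lt (V.2 y hy fun h0 => hne ?_)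
    rw [h0, map_zero]
  have hr : Module.rank ℂ (V.1.map (Submodule.inclusion hd)) = Module.rank ℂ V.1 :=
    (Submodule.equivMapOfInjective _ (Submodule.inclusion_injective hd) V.1).rank_eq.symm
  rw [← hr]
  exact le_iSup (fun V : {V : Submodule ℂ T'.domain // IsNegDef T' V} =>
    Cardinal.toENat (Module.rank ℂ V.1)) ⟨_, hneg⟩

/-- A form that is nonnegative on a subspace of codimension at most `n` has Morse index at most
`n`. -/
lemma morseIndex_le {T : H →ₗ.[ℂ] H} {n : ℕ} (L : T.domain →ₗ[ℂ] (Fin n → ℂ))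
    (h : ∀ y, L y = 0 → 0 ≤ (inner ℂ (T y) (y : H)).re) : morseIndex T ≤ n := by
  refine iSup_le fun V => ?_
  have hinj : Function.Injective (L.domRestrict V.1) := by
    rw [← LinearMap.ker_eq_bot, LinearMap.ker_eq_bot']
    intro y hy
    by_contra hne
    have h1 := V.2 y.1 y.2 fun h0 => hne (Subtype.ext h0)
    have h2 := h y.1 hy
    linarith
  have := LinearMap.rank_le_of_injective _ hinj
  rw [rank_fin_fun] at this
  simpa using this

/-- A form that is negative on an `n`-dimensional subspace has Morse index at least `n`. -/
lemma le_morseIndex {T : H →ₗ.[ℂ] H} {n : ℕ} (F : (Fin n → ℂ) →ₗ[ℂ] T.domain)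
    (h : ∀ c ≠ 0, (inner ℂ (T (F c)) (F c : H)).re < 0) : (n : ℕ∞) ≤ morseIndex T := by
  have hinj : Function.Injective F := by
    rw [← LinearMap.ker_eq_bot, LinearMap.ker_eq_bot']
    intro c hc
    by_contra hne
    have := h c hne
    rw [hc] at this
    simp at this
  have hneg : IsNegDef T (LinearMap.range F) := by
    rintro _ ⟨c, rfl⟩ hne
    exact h c fun h0 => hne (by rw [h0, map_zero])
  have hr : Module.rank ℂ (LinearMap.range F) = n := by
    rw [← (LinearEquiv.ofInjective F hinj).rank_eq, rank_fin_fun]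
  refine le_trans (le_of_eq ?_) (le_iSup (fun V : {V : Submodule ℂ T.domain // IsNegDef T V} =>
    Cardinal.toENat (Module.rank ℂ V.1)) ⟨_, hneg⟩)
  simp [hr]

end Abstract

/-! ### Exponentials and the Wirtinger inequality -/

/-- The exponential `t ↦ exp(iσt)`. -/
def wave (σ t : ℝ) : ℂ := Complex.exp ((σ * t : ℝ) * Complex.I)

lemma norm_wave (σ t : ℝ) : ‖wave σ t‖ = 1 := Complex.norm_exp_ofReal_mul_I _

lemma conj_wave (σ t : ℝ) : conj (wave σ t) = wave (-σ) t := by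
  rw [wave, wave, ← Complex.exp_conj, map_mul, Complex.conj_ofReal, Complex.conj_I]
  congr 1
  push_cast
  ring

lemma wave_zero_right (σ : ℝ) : wave σ 0 = 1 := by simp [wave]

lemma wave_add (σ τ t : ℝ) : wave (σ + τ) t = wave σ t * wave τ t := by
  rw [wave, wave, wave, ← Complex.exp_add]
  congr 1
  push_cast
  ring

lemma hasDerivAt_wave (σ t : ℝ) : HasDerivAt (wave σ) (σ * Complex.I * wave σ t) t := by
  have h1 : HasDerivAt (fun t : ℝ => ((σ * t : ℝ) : ℂ) * Complex.I) (σ * Complex.I) t := by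
    have := ((hasDerivAt_id t).const_mul σ).ofReal_comp.mul_const Complex.I
    simpa using this
  have := h1.cexp
  rwa [mul_comm] at this

lemma continuous_wave (σ : ℝ) : Continuous (wave σ) :=
  continuous_iff_continuousAt.2 fun t => (hasDerivAt_wave σ t).continuousAt

lemma wave_int_add_two_pi (k : ℤ) (s : ℝ) : wave (k + s) (2 * π) = wave s (2 * π) := by
  rw [wave_add]
  have : wave k (2 * π) = 1 := by
    rw [wave]
    have := Complex.exp_int_mul_two_pi_mul_I k
    rw [← this]
    congr 1
    push_cast
    ring
  rw [this, one_mul]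

lemma primitive_of_hasDerivAt {f g : ℝ → ℂ} (h : ∀ t, HasDerivAt f (g t) t) (hg : Continuous g)
    (t : ℝ) : f t = f 0 + ∫ s in (0 : ℝ)..t, g s := by
  rw [intervalIntegral.integral_eq_sub_of_hasDerivAt (fun x _ => h x) (hg.intervalIntegrable _ _)]
  ring

lemma isW22_of_hasDerivAt {u v w : ℝ → ℂ} (hu : ∀ t, HasDerivAt u (v t) t)
    (hv : ∀ t, HasDerivAt v (w t) t) (hw : Continuous w) : IsW22 u v w :=
  ⟨memLp_of_continuousOn hw.continuousOn,
    fun t _ => primitive_of_hasDerivAt hu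
      (continuous_iff_continuousAt.2 fun t => (hv t).continuousAt) t,
    fun t _ => primitive_of_hasDerivAt hv hw t⟩

lemma isW22_wave (σ : ℝ) : IsW22 (wave σ) (fun t => σ * Complex.I * wave σ t)
    (fun t => σ * Complex.I * (σ * Complex.I * wave σ t)) :=
  isW22_of_hasDerivAt (hasDerivAt_wave σ) (fun t => (hasDerivAt_wave σ t).const_mul _)
    (continuous_const.mul (continuous_const.mul (continuous_wave σ)))

lemma fourierCoeffOn_wave (u : ℝ → ℂ) (s : ℝ) (n : ℤ) :
    fourierCoeffOn Real.two_pi_pos (fun t => wave (-s) t * u t) n =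
      (1 / (2 * π)) • ∫ t in (0 : ℝ)..2 * π, wave (-(n + s)) t * u t := by
  rw [fourierCoeffOn_eq_integral]
  simp only [sub_zero]
  congr 1
  refine intervalIntegral.integral_congr fun t _ => ?_
  have : (-(n + s) : ℝ) = -n + -s := by ring
  rw [this, wave_add, fourier_coe_apply, smul_eq_mul, ← mul_assoc]
  congr 2
  rw [wave]
  congr 1
  have : (π : ℂ) ≠ 0 := by exact_mod_cast Real.pi_ne_zero
  push_cast
  field_simp
  ring

/-- Parseval's identity for the expansion in the exponentials `exp(i(k+s)t)`. -/
lemma hasSum_norm_sq_wave {u : ℝ → ℂ} (hu : ContinuousOn u (Icc 0 (2 * π))) (s : ℝ) :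
    HasSum (fun n : ℤ => ‖∫ t in (0 : ℝ)..2 * π, wave (-(n + s)) t * u t‖ ^ 2)
      (2 * π * ∫ t in (0 : ℝ)..2 * π, ‖u t‖ ^ 2) := by
  have h := (hasSum_sq_fourierCoeffOn (f := fun t => wave (-s) t * u t) Real.two_pi_pos
    (memLp_of_continuousOn ((continuous_wave (-s)).continuousOn.mul hu))).mul_left ((2 * π) ^ 2)
  have hpi := Real.two_pi_pos.ne'
  have e1 : ∀ n : ℤ, (2 * π) ^ 2 *
      ‖fourierCoeffOn Real.two_pi_pos (fun t => wave (-s) t * u t) n‖ ^ 2 =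
      ‖∫ t in (0 : ℝ)..2 * π, wave (-(n + s)) t * u t‖ ^ 2 := fun n => by
    rw [fourierCoeffOn_wave, norm_smul, Real.norm_of_nonneg (by positivity), ← mul_pow,
      ← mul_assoc, mul_one_div_cancel hpi, one_mul]
  have e2 : (2 * π) ^ 2 * ((2 * π - 0)⁻¹ • ∫ t in (0 : ℝ)..2 * π, ‖wave (-s) t * u t‖ ^ 2) =
      2 * π * ∫ t in (0 : ℝ)..2 * π, ‖u t‖ ^ 2 := by
    simp only [norm_mul, norm_wave, one_mul, sub_zero, smul_eq_mul]
    rw [← mul_assoc, sq, mul_assoc (2 * π), mul_inv_cancel₀ hpi, mul_one]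
  rw [e2] at h
  simpa only [e1] using h

/-- **Wirtinger's inequality** for quasi-periodic functions: if `u(2π) = exp(2πis) u(0)` and `u` is
orthogonal to all exponentials `exp(i(k+s)t)` with `|k+s| < 1`, then `∫ |u|² ≤ ∫ |u'|²`. -/
lemma wirtinger {u v : ℝ → ℂ} {s : ℝ} (hv : ContinuousOn v (Icc 0 (2 * π)))
    (h : ∀ t ∈ Icc (0 : ℝ) (2 * π), u t = u 0 + ∫ r in (0 : ℝ)..t, v r)
    (hu : u (2 * π) = wave s (2 * π) * u 0)
    (horth : ∀ k : ℤ, |k + s| < 1 → ∫ t in (0 : ℝ)..2 * π, wave (-(k + s)) t * u t = 0) :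
    ∫ t in (0 : ℝ)..2 * π, ‖u t‖ ^ 2 ≤ ∫ t in (0 : ℝ)..2 * π, ‖v t‖ ^ 2 := by
  have hv' : IntervalIntegrable v volume 0 (2 * π) := by
    apply ContinuousOn.intervalIntegrable
    rwa [uIcc_of_le two_pi_nonneg]
  have hcu : ContinuousOn u (Icc 0 (2 * π)) := continuousOn_of_primitive hv' h
  refine le_of_mul_le_mul_left ?_ Real.two_pi_pos
  refine hasSum_le (fun n => ?_) (hasSum_norm_sq_wave hcu s) (hasSum_norm_sq_wave hv s)
  have hc : Continuous fun t => ((-(n + s) : ℝ) : ℂ) * Complex.I * wave (-(n + s)) t :=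
    (continuous_wave _).const_smul (((-(n + s) : ℝ) : ℂ) * Complex.I)
  have hI := integral_deriv_mul hv' (hc.intervalIntegrable _ _) h
    (fun t _ => primitive_of_hasDerivAt (hasDerivAt_wave (-(n + s))) hc t)
  have hb : u (2 * π) * wave (-(n + s)) (2 * π) - u 0 * wave (-(n + s)) 0 = 0 := by
    have e1 : wave s (2 * π) * wave (-(n + s)) (2 * π) = 1 := by
      rw [← wave_int_add_two_pi n s, ← wave_add, add_neg_cancel, wave]
      simp
    rw [hu, wave_zero_right]
    linear_combination u 0 * e1
  have key : ∫ t in (0 : ℝ)..2 * π, wave (-(n + s)) t * v t =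
      ((n + s : ℝ) : ℂ) * Complex.I * ∫ t in (0 : ℝ)..2 * π, wave (-(n + s)) t * u t := by
    rw [hb, zero_sub, ← intervalIntegral.integral_neg] at hI
    rw [← intervalIntegral.integral_const_mul]
    calc _ = ∫ t in (0 : ℝ)..2 * π, v t * wave (-(n + s)) t := by simp only [mul_comm]
      _ = _ := hI
      _ = _ := intervalIntegral.integral_congr fun t _ => by
        push_cast
        ring
  rw [key, norm_mul, norm_mul, Complex.norm_I, mul_one, Complex.norm_real, mul_pow,
    Real.norm_eq_abs]
  rcases lt_or_ge |(n + s : ℝ)| 1 with h1 | h1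
  · rw [horth n h1]; simp
  · have : 1 ≤ |(n + s : ℝ)| ^ 2 := one_le_pow₀ h1
    exact le_mul_of_one_le_left (by positivity) this

/-! ### Monotonicity and bounds for the Morse index of `A(β,e)` -/

section

variable {e : ℝ} {ω : ℂ} {β : ℝ}

lemma intervalIntegrable_form (he : e ∈ Ico (0 : ℝ) 1) (β : ℝ) {u v w : ℝ → ℂ}
    (h : IsW22 u v w) : IntervalIntegrable (fun t => ‖v t‖ ^ 2 - qfun β e t * ‖u t‖ ^ 2)
      volume 0 (2 * π) :=
  (h.continuousOn_norm_sq_v.sub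
    ((continuous_qfun β he).continuousOn.mul h.continuousOn_norm_sq_u)).intervalIntegrable

lemma antitone_phi (he : e ∈ Ico (0 : ℝ) 1) (hω : ‖ω‖ = 1) : Antitone fun β => phi ω β e := by
  intro β β' hβ
  refine morseIndex_mono (domain_le he β' β) fun y y' hyy' => ?_
  obtain ⟨u, v, w, h, hu, hv, hy⟩ := exists_rep y
  rw [re_inner_opA he hω h hu hv y hy]
  rw [re_inner_opA he hω h hu hv y' (by rw [hyy']; exact hy)]
  refine intervalIntegral.integral_mono_on two_pi_nonneg (intervalIntegrable_form he _ h)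
    (intervalIntegrable_form he _ h) fun t _ => ?_
  have hq : qfun β' e t ≤ qfun β e t := by
    have := div_le_div_of_nonneg_right hβ (denom_pos he t).le
    simp only [qfun]
    linarith
  have := mul_le_mul_of_nonneg_right hq (sq_nonneg ‖u t‖)
  linarith

/-- For `β = 0` the form is `∫ |u'|² - |u|²`, which is nonnegative on the orthogonal complement of
the exponentials `exp(i(k+s)t)` with `|k+s| < 1`. -/
lemma phi_zero_le (he : e ∈ Ico (0 : ℝ) 1) {s : ℝ} {n : ℕ} (κ : Fin n → ℤ)
    (hκ : ∀ k : ℤ, |k + s| < 1 → ∃ j, κ j = k) : phi (wave s (2 * π)) 0 e ≤ n := by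
  have hm : ∀ σ : ℝ, MemLp (wave σ) 2 muT := fun σ =>
    memLp_of_continuousOn (continuous_wave σ).continuousOn
  refine morseIndex_le (LinearMap.pi fun j =>
    (innerSL ℂ ((hm (κ j + s)).toLp _)).toLinearMap ∘ₗ
      (opA (wave s (2 * π)) 0 e).domain.subtype) fun y hy => ?_
  obtain ⟨u, v, w, h, hu, hv, hyu⟩ := exists_rep y
  rw [re_inner_opA he (norm_wave _ _) h hu hv y hyu]
  have hW := wirtinger h.continuousOn_v h.left_eq hu fun k hk => by
    obtain ⟨j, rfl⟩ := hκ k hk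
    have hj := congrFun hy j
    simp only [LinearMap.pi_apply, LinearMap.comp_apply, Submodule.subtype_apply,
      ContinuousLinearMap.coe_coe, innerSL_apply_apply, Pi.zero_apply] at hj
    rw [inner_eq_integral _ _ (hm _).coeFn_toLp hyu] at hj
    simpa only [conj_wave] using hj
  have : ∀ t, qfun 0 e t = 1 := fun t => by simp [qfun]
  simp only [this, one_mul]
  rw [intervalIntegral.integral_sub h.continuousOn_norm_sq_v.intervalIntegrable
    h.continuousOn_norm_sq_u.intervalIntegrable]
  linarith

lemma IsW22.sum {n : ℕ} {U V W : Fin n → ℝ → ℂ} (h : ∀ j, IsW22 (U j) (V j) (W j))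
    (c : Fin n → ℂ) : IsW22 (∑ j, c j • U j) (∑ j, c j • V j) (∑ j, c j • W j) := by
  have : ∀ S : Finset (Fin n),
      IsW22 (∑ j ∈ S, c j • U j) (∑ j ∈ S, c j • V j) (∑ j ∈ S, c j • W j) := by
    intro S
    induction S using Finset.induction_on with
    | empty => simpa using IsW22.zero
    | insert a S ha ih =>
      rw [Finset.sum_insert ha, Finset.sum_insert ha, Finset.sum_insert ha]
      exact ((h a).smul (c a)).add ih
  exact this Finset.univ

/-- Functions spanning a negative definite subspace bound the Morse index from below. -/
lemma le_phi (he : e ∈ Ico (0 : ℝ) 1) (hω : ‖ω‖ = 1) {n : ℕ} {U V W : Fin n → ℝ → ℂ}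
    (h : ∀ j, IsW22 (U j) (V j) (W j)) (hU : ∀ j, U j (2 * π) = ω * U j 0)
    (hV : ∀ j, V j (2 * π) = ω * V j 0)
    (hneg : ∀ c : Fin n → ℂ, c ≠ 0 → ∫ t in (0 : ℝ)..2 * π,
      (‖∑ j, c j * V j t‖ ^ 2 - qfun β e t * ‖∑ j, c j * U j t‖ ^ 2) < 0) :
    (n : ℕ∞) ≤ phi ω β e := by
  choose y hy _ using fun j => exists_domain_of_isW22 he β (h j) (hU j) (hV j)
  refine le_morseIndex (Fintype.linearCombination ℂ y) fun c hc => ?_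
  have hrep : (((Fintype.linearCombination ℂ y c : (opA ω β e).domain) : L2) : ℝ → ℂ) =ᵐ[muT]
      ∑ j, c j • U j := by
    have h1 : ((Fintype.linearCombination ℂ y c : (opA ω β e).domain) : L2) =
        ∑ j, c j • (y j : L2) := by
      rw [Fintype.linearCombination_apply, Submodule.coe_sum]
      rfl
    rw [h1]
    have h2 : ∀ S : Finset (Fin n), ((∑ j ∈ S, c j • (y j : L2) : L2) : ℝ → ℂ) =ᵐ[muT]
        ∑ j ∈ S, c j • U j := by
      intro S
      induction S using Finset.induction_on with
      | empty => simpa using Lp.coeFn_zero ℂ 2 muT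
      | insert a S ha ih =>
        rw [Finset.sum_insert ha, Finset.sum_insert ha]
        refine (Lp.coeFn_add _ _).trans (EventuallyEq.add ?_ ih)
        filter_upwards [Lp.coeFn_smul (c a) (y a : L2), hy a] with t e1 e2
        rw [e1, Pi.smul_apply, e2, Pi.smul_apply]
    exact h2 Finset.univ
  rw [re_inner_opA he hω (IsW22.sum h c) _ _ _ hrep]
  · simpa using hneg c hc
  · simp only [Finset.sum_apply, Pi.smul_apply, smul_eq_mul, hU, Finset.mul_sum]
    exact Finset.sum_congr rfl fun j _ => by ring
  · simp only [Finset.sum_apply, Pi.smul_apply, smul_eq_mul, hV, Finset.mul_sum]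
    exact Finset.sum_congr rfl fun j _ => by ring

end

/-! ### The periodic case -/

section

variable {e : ℝ} {ω : ℂ} {β : ℝ}

lemma wave_zero_left (t : ℝ) : wave 0 t = 1 := by simp [wave]

/-- The profile `1 + e cos t`, which `A(β,e)` maps to the constant `β - 1`. -/
lemma isW22_profile (e : ℝ) : IsW22 (fun t => ((1 + e * Real.cos t : ℝ) : ℂ))
    (fun t => ((-(e * Real.sin t) : ℝ) : ℂ)) (fun t => ((-(e * Real.cos t) : ℝ) : ℂ)) := by
  refine isW22_of_hasDerivAt (fun t => ?_) (fun t => ?_)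
    (Complex.continuous_ofReal.comp (by fun_prop))
  · have := ((Real.hasDerivAt_cos t).const_mul e).const_add 1
    refine HasDerivAt.ofReal_comp ?_
    exact this.congr_deriv (by ring)
  · exact (((Real.hasDerivAt_sin t).const_mul e).neg).ofReal_comp

/-- The form is `2π(β - 1)` at `1 + e cos t`. -/
lemma one_le_phi_one (he : e ∈ Ico (0 : ℝ) 1) (hβ : β < 1) : 1 ≤ phi 1 β e := by
  have := le_phi (β := β) he norm_one (n := 1) (fun _ => isW22_profile e) (by simp) (by simp)
    fun c hc => by
      have hc0 : c 0 ≠ 0 := fun h => hc (funext fun j => by rw [Subsingleton.elim j 0, h]; rfl)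
      have e1 : ∀ t, ‖∑ j, c j * ((-(e * Real.sin t) : ℝ) : ℂ)‖ ^ 2 -
          qfun β e t * ‖∑ j, c j * ((1 + e * Real.cos t : ℝ) : ℂ)‖ ^ 2 =
          ‖c 0‖ ^ 2 * (e ^ 2 * (Real.sin t ^ 2 - Real.cos t ^ 2) + (β - 2) * e * Real.cos t +
            (β - 1)) := fun t => by
        simp only [Fin.sum_univ_one, norm_mul, Complex.norm_real, Real.norm_eq_abs, mul_pow, sq_abs,
          qfun]
        have hp := (denom_pos he t).ne'
        field_simp
        ring
      simp only [e1]
      have hd : ∀ t : ℝ, HasDerivAt (fun t => -(e ^ 2 * (Real.sin t * Real.cos t)) +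
          (β - 2) * e * Real.sin t + (β - 1) * t)
          (e ^ 2 * (Real.sin t ^ 2 - Real.cos t ^ 2) + (β - 2) * e * Real.cos t + (β - 1)) t := by
        intro t
        have h1 := ((Real.hasDerivAt_sin t).mul (Real.hasDerivAt_cos t)).const_mul (e ^ 2)
        have h2 := (h1.neg.add ((Real.hasDerivAt_sin t).const_mul ((β - 2) * e))).add
          ((hasDerivAt_id t).const_mul (β - 1))
        exact h2.congr_deriv (by ring)
      rw [intervalIntegral.integral_const_mul, intervalIntegral.integral_eq_sub_of_hasDerivAt
        (fun t _ => hd t) (Continuous.intervalIntegrable (by fun_prop) _ _)]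
      simp only [Real.sin_two_pi, Real.cos_two_pi, Real.sin_zero]
      have : 0 < ‖c 0‖ ^ 2 := by positivity
      have hpi := Real.two_pi_pos
      have h3 : 0 < (1 - β) * (2 * π) := mul_pos (by linarith) hpi
      nlinarith [mul_pos this h3]
  simpa using this

lemma phi_one (he : e ∈ Ico (0 : ℝ) 1) (hβ : β ∈ Ico (0 : ℝ) 1) : phi 1 β e = 1 := by
  refine le_antisymm ((antitone_phi he norm_one hβ.1).trans ?_) (one_le_phi_one he hβ.2)
  have := phi_zero_le he (s := 0) (n := 1) (fun _ => 0) fun k hk => ⟨0, by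
    rw [add_zero, ← Int.cast_abs] at hk
    have : |k| < 1 := by exact_mod_cast hk
    exact (Int.abs_lt_one_iff.1 this).symm⟩
  rw [wave_zero_left] at this
  simpa using this

lemma integral_norm_sq_eq_zero {u : ℝ → ℂ} (y : L2) (hy : (y : ℝ → ℂ) =ᵐ[muT] u)
    (h : ∫ t in (0 : ℝ)..2 * π, ‖u t‖ ^ 2 ≤ 0) : y = 0 := by
  have h1 := inner_eq_integral y y hy hy
  have h2 : (fun t => conj (u t) * u t) = fun t => ((‖u t‖ ^ 2 : ℝ) : ℂ) := by
    funext t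
    rw [Complex.conj_mul']
    push_cast
    rfl
  rw [h2, intervalIntegral.integral_ofReal, inner_self_eq_norm_sq_to_K] at h1
  have h3 : ‖y‖ ^ 2 = ∫ t in (0 : ℝ)..2 * π, ‖u t‖ ^ 2 := Complex.ofReal_injective (by
    rw [← h1]; exact Complex.ofReal_pow _ _)
  have h4 : ‖y‖ = 0 := by nlinarith [sq_nonneg ‖y‖]
  exact norm_eq_zero.1 h4

/-- A periodic solution of `A(β,e) y = 0` is orthogonal to `A(β,e)(1 + e cos t) = β - 1`, so it has
mean zero and Wirtinger's inequality makes its energy positive unless it vanishes. -/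
lemma nuA_one (he : e ∈ Ico (0 : ℝ) 1) (hβ : β ∈ Ioo (0 : ℝ) 1) : nuA 1 β e = 0 := by
  have hker : LinearMap.ker (opA 1 β e).toFun = ⊥ := by
    rw [LinearMap.ker_eq_bot']
    intro y hy
    have hy0 : opA 1 β e y = 0 := hy
    obtain ⟨u, v, w, h, hu, hv, hyu⟩ := exists_rep y
    obtain ⟨P, hP1, hP2⟩ := exists_domain_of_isW22 (ω := 1) he β (isW22_profile e)
      (by simp) (by simp)
    have hmean : ∫ t in (0 : ℝ)..2 * π, u t = 0 := by
      have e1 := inner_opA he norm_one (isW22_profile e) (by simp) (by simp) P hP1 h hu hyu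
      have e2 := inner_opA he norm_one h hu hv y hyu (isW22_profile e) (by simp) hP1
      rw [hy0, inner_zero_left] at e2
      have e3 : inner ℂ (opA 1 β e P) (y : L2) =
          conj (∫ t in (0 : ℝ)..2 * π, (conj (v t) * ((-(e * Real.sin t) : ℝ) : ℂ) -
            (qfun β e t : ℂ) * (conj (u t) * ((1 + e * Real.cos t : ℝ) : ℂ)))) := by
        rw [e1, intervalIntegral.integral_of_le two_pi_nonneg,
          intervalIntegral.integral_of_le two_pi_nonneg, ← integral_conj]
        refine integral_congr_ae (ae_of_all _ fun t => ?_)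
        simp only [map_sub, map_mul, Complex.conj_conj, Complex.conj_ofReal]
        ring
      rw [← e2, map_zero] at e3
      have hconst : ∀ t, -((-(e * Real.cos t) : ℝ) : ℂ) - ((1 + e * Real.cos t : ℝ) : ℂ) +
          ((β / (1 + e * Real.cos t) : ℝ) : ℂ) * ((1 + e * Real.cos t : ℝ) : ℂ) =
          ((β - 1 : ℝ) : ℂ) := fun t => by
        have hp := (denom_pos he t).ne'
        rw [← Complex.ofReal_mul, div_mul_cancel₀ _ hp]
        push_cast
        ring
      simp only [hconst] at hP2
      rw [inner_eq_integral _ _ hP2 hyu, intervalIntegral.integral_const_mul] at e3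
      refine (mul_eq_zero.1 e3).resolve_left ?_
      rw [Complex.conj_ofReal]
      exact_mod_cast (sub_neg.2 hβ.2).ne
    have hW := wirtinger (s := 0) h.continuousOn_v h.left_eq (by rw [hu, wave_zero_left])
      fun k hk => by
        have hk0 : k = 0 := by
          rw [add_zero, ← Int.cast_abs] at hk
          exact Int.abs_lt_one_iff.1 (by exact_mod_cast hk)
        simpa [hk0, wave_zero_left] using hmean
    have hform := re_inner_opA he norm_one h hu hv y hyu
    rw [hy0, inner_zero_left, Complex.zero_re] at hform
    have iu := h.continuousOn_norm_sq_u.intervalIntegrable (μ := volume)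
    have iv := h.continuousOn_norm_sq_v.intervalIntegrable (μ := volume)
    have hle : ∫ t in (0 : ℝ)..2 * π, (‖v t‖ ^ 2 - ‖u t‖ ^ 2 + β / 2 * ‖u t‖ ^ 2) ≤ 0 := by
      refine le_trans ?_ hform.ge
      refine intervalIntegral.integral_mono_on two_pi_nonneg ((iv.sub iu).add (iu.const_mul _))
        (intervalIntegrable_form he β h) fun t _ => ?_
      have hp : 1 + e * Real.cos t ≤ 2 := by nlinarith [Real.cos_le_one t, he.1, he.2]
      have : β / 2 ≤ β / (1 + e * Real.cos t) :=
        div_le_div_of_nonneg_left hβ.1.le (denom_pos he t) hp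
      have := mul_le_mul_of_nonneg_right this (sq_nonneg ‖u t‖)
      simp only [qfun]
      linarith
    rw [intervalIntegral.integral_add (iv.sub iu) (iu.const_mul _),
      intervalIntegral.integral_sub iv iu, intervalIntegral.integral_const_mul] at hle
    refine Subtype.ext (integral_norm_sq_eq_zero _ hyu ?_)
    have : β / 2 * ∫ t in (0 : ℝ)..2 * π, ‖u t‖ ^ 2 ≤ 0 := by linarith
    by_contra hcon
    push Not at hcon
    have := mul_pos (half_pos hβ.1) hcon
    linarith
  rw [nuA, nullity, hker]
  simp

/-! ### The Morse index for `ω ≠ 1` and small `β` -/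

lemma exists_wave_eq (hω : ‖ω‖ = 1) (hω1 : ω ≠ 1) :
    ∃ s ∈ Ioo (0 : ℝ) 1, ω = wave s (2 * π) := by
  have hpi := Real.pi_pos
  have h1 : ω = wave (ω.arg / (2 * π)) (2 * π) := by
    rw [wave, div_mul_cancel₀ _ Real.two_pi_pos.ne']
    conv_lhs => rw [← Complex.norm_mul_exp_arg_mul_I ω, hω]
    simp
  have h0 : ω.arg ≠ 0 := fun h => hω1 (by rw [h1, h, zero_div, wave_zero_left])
  have hlt := Complex.neg_pi_lt_arg ω
  have hle := Complex.arg_le_pi ω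
  rcases lt_or_gt_of_ne h0 with h | h
  · refine ⟨(1 : ℤ) + ω.arg / (2 * π), ⟨?_, ?_⟩, ?_⟩
    · have : -1 < ω.arg / (2 * π) := by
        rw [lt_div_iff₀ Real.two_pi_pos]; linarith
      push_cast
      linarith
    · have := div_neg_of_neg_of_pos h Real.two_pi_pos
      push_cast
      linarith
    · rw [wave_int_add_two_pi]; exact h1
  · exact ⟨_, ⟨by positivity, by rw [div_lt_one Real.two_pi_pos]; linarith⟩, h1⟩

lemma norm_sq_add_wave (a b : ℂ) (s t : ℝ) :
    ‖a * wave s t + b * wave (s - 1) t‖ ^ 2 =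
      ‖a‖ ^ 2 + ‖b‖ ^ 2 + 2 * ((a * conj b).re * Real.cos t - (a * conj b).im * Real.sin t) := by
  have h1 : a * wave s t * conj (b * wave (s - 1) t) = a * conj b * wave 1 t := by
    have : wave 1 t = wave s t * wave (-(s - 1)) t := by rw [← wave_add]; congr 1; ring
    rw [map_mul, conj_wave, this]
    ring
  have h2 : (wave 1 t).re = Real.cos t ∧ (wave 1 t).im = Real.sin t := by
    rw [wave, one_mul]
    exact ⟨Complex.exp_ofReal_mul_I_re t, Complex.exp_ofReal_mul_I_im t⟩
  rw [← Complex.normSq_eq_norm_sq, Complex.normSq_add, h1, Complex.normSq_eq_norm_sq,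
    Complex.normSq_eq_norm_sq, norm_mul, norm_mul, norm_wave, norm_wave, mul_one, mul_one,
    Complex.mul_re (a * conj b), h2.1, h2.2]

/-- The form is negative on the span of `exp(ist)` and `exp(i(s-1)t)`, which for `β = 0` are
eigenfunctions for the eigenvalues `s² - 1` and `(s-1)² - 1`. -/
lemma two_le_phi (he : e ∈ Ico (0 : ℝ) 1) {s : ℝ} (hβ : 0 ≤ β)
    (h0 : s ^ 2 + 2 * (β / (1 - e)) < 1) (h1 : (s - 1) ^ 2 + 2 * (β / (1 - e)) < 1) :
    2 ≤ phi (wave s (2 * π)) β e := by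
  have hs1 : wave (s - 1) (2 * π) = wave s (2 * π) := by
    have := wave_int_add_two_pi (-1) s
    rw [← this]; congr 1; push_cast; ring
  have hbase := le_phi (β := β) he (norm_wave s (2 * π)) (n := 2)
    (U := ![wave s, wave (s - 1)])
    (V := ![fun t => s * Complex.I * wave s t, fun t => (s - 1 : ℝ) * Complex.I * wave (s - 1) t])
    (W := ![_, _])
    (by rw [Fin.forall_fin_two]; exact ⟨isW22_wave s, isW22_wave (s - 1)⟩)
    (by
      rw [Fin.forall_fin_two]
      simp [wave_zero_right, hs1])
    (by
      rw [Fin.forall_fin_two]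
      simp only [Matrix.cons_val_zero, Matrix.cons_val_one, wave_zero_right, hs1]
      constructor <;> ring)
    fun c hc => ?_
  · exact_mod_cast hbase
  set δ := β / (1 - e)
  set a := ‖c 0‖ ^ 2
  set b := ‖c 1‖ ^ 2
  set x := (c 0 * conj (c 1)).re
  set y := (c 0 * conj (c 1)).im
  set K := (s ^ 2 - 1 + 2 * δ) * a + ((s - 1) ^ 2 - 1 + 2 * δ) * b
  set m := 2 * (s * (s - 1) - 1)
  have ha : 0 ≤ a := sq_nonneg _
  have hb : 0 ≤ b := sq_nonneg _
  have hK : K < 0 := by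
    have hab : 0 < a ∨ 0 < b := by
      by_contra hcon
      push Not at hcon
      refine hc (funext fun j => ?_)
      have e1 : ‖c 0‖ = 0 := pow_eq_zero_iff two_ne_zero |>.1 (le_antisymm hcon.1 ha)
      have e2 : ‖c 1‖ = 0 := pow_eq_zero_iff two_ne_zero |>.1 (le_antisymm hcon.2 hb)
      revert j
      rw [Fin.forall_fin_two]
      exact ⟨norm_eq_zero.1 e1, norm_eq_zero.1 e2⟩
    have e1 : s ^ 2 - 1 + 2 * δ < 0 := by linarith
    have e2 : (s - 1) ^ 2 - 1 + 2 * δ < 0 := by linarith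
    rcases hab with h | h
    · have := mul_neg_of_neg_of_pos e1 h
      have := mul_nonpos_of_nonpos_of_nonneg e2.le hb
      simp only [K]; linarith
    · have := mul_neg_of_neg_of_pos e2 h
      have := mul_nonpos_of_nonpos_of_nonneg e1.le ha
      simp only [K]; linarith
  have hpt : ∀ t : ℝ, ‖∑ j, c j * (![fun t => s * Complex.I * wave s t,
      fun t => (s - 1 : ℝ) * Complex.I * wave (s - 1) t] : Fin 2 → ℝ → ℂ) j t‖ ^ 2 -
      qfun β e t * ‖∑ j, c j * (![wave s, wave (s - 1)] : Fin 2 → ℝ → ℂ) j t‖ ^ 2 ≤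
      K + m * (x * Real.cos t - y * Real.sin t) := by
    intro t
    have e1 : ∑ j, c j * (![fun t => s * Complex.I * wave s t,
        fun t => (s - 1 : ℝ) * Complex.I * wave (s - 1) t] : Fin 2 → ℝ → ℂ) j t =
        (c 0 * (s * Complex.I)) * wave s t +
          (c 1 * ((s - 1 : ℝ) * Complex.I)) * wave (s - 1) t := by
      simp only [Fin.sum_univ_two, Matrix.cons_val_zero, Matrix.cons_val_one]
      ring
    have e2 : ∑ j, c j * (![wave s, wave (s - 1)] : Fin 2 → ℝ → ℂ) j t =
        c 0 * wave s t + c 1 * wave (s - 1) t := by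
      simp only [Fin.sum_univ_two, Matrix.cons_val_zero, Matrix.cons_val_one]
    have e3 : c 0 * (s * Complex.I) * conj (c 1 * ((s - 1 : ℝ) * Complex.I)) =
        ((s * (s - 1) : ℝ) : ℂ) * (c 0 * conj (c 1)) := by
      simp only [map_mul, Complex.conj_ofReal, Complex.conj_I]
      push_cast
      linear_combination (-(s * (s - 1) * c 0 * conj (c 1))) * Complex.I_mul_I
    have e4 : ‖c 0 * wave s t + c 1 * wave (s - 1) t‖ ^ 2 ≤ 2 * (a + b) := by
      have := norm_add_le (c 0 * wave s t) (c 1 * wave (s - 1) t)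
      rw [norm_mul, norm_mul, norm_wave, norm_wave, mul_one, mul_one] at this
      have h2 := pow_le_pow_left₀ (norm_nonneg _) this 2
      nlinarith [sq_nonneg (‖c 0‖ - ‖c 1‖)]
    have e5 : β / (1 + e * Real.cos t) * ‖c 0 * wave s t + c 1 * wave (s - 1) t‖ ^ 2 ≤
        δ * (2 * (a + b)) :=
      mul_le_mul (div_denom_le he hβ t) e4 (sq_nonneg _)
        (div_nonneg hβ (sub_nonneg.2 he.2.le))
    rw [e1, e2]
    have e6 := norm_sq_add_wave (c 0) (c 1) s t
    rw [norm_sq_add_wave, e3, Complex.re_ofReal_mul, Complex.im_ofReal_mul, norm_mul, norm_mul,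
      norm_mul, norm_mul, Complex.norm_I, Complex.norm_real, Complex.norm_real, mul_one, mul_one,
      mul_pow, mul_pow, Real.norm_eq_abs, Real.norm_eq_abs, sq_abs, sq_abs]
    have e7 : qfun β e t * ‖c 0 * wave s t + c 1 * wave (s - 1) t‖ ^ 2 =
        (a + b + 2 * (x * Real.cos t - y * Real.sin t)) -
          β / (1 + e * Real.cos t) * ‖c 0 * wave s t + c 1 * wave (s - 1) t‖ ^ 2 := by
      rw [← e6, qfun]; ring
    rw [e7]
    simp only [K, m]
    linarith
  have hd : ∀ t : ℝ, HasDerivAt (fun t => K * t + m * (x * Real.sin t + y * Real.cos t))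
      (K + m * (x * Real.cos t - y * Real.sin t)) t := by
    intro t
    have := ((hasDerivAt_id t).const_mul K).add
      ((((Real.hasDerivAt_sin t).const_mul x).add ((Real.hasDerivAt_cos t).const_mul y)).const_mul
        m)
    exact this.congr_deriv (by ring)
  have hcont : Continuous fun t => K + m * (x * Real.cos t - y * Real.sin t) := by fun_prop
  have hI : ∫ t in (0 : ℝ)..2 * π, (K + m * (x * Real.cos t - y * Real.sin t)) = K * (2 * π) := by
    rw [intervalIntegral.integral_eq_sub_of_hasDerivAt (fun t _ => hd t)
      (hcont.intervalIntegrable _ _)]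
    simp
  refine lt_of_le_of_lt (intervalIntegral.integral_mono_on two_pi_nonneg ?_
    (hcont.intervalIntegrable _ _) fun t _ => hpt t) ?_
  · refine Continuous.intervalIntegrable ?_ _ _
    have c1 := continuous_wave s
    have c2 := continuous_wave (s - 1)
    have c3 := continuous_qfun β he
    simp only [Fin.sum_univ_two, Matrix.cons_val_zero, Matrix.cons_val_one]
    fun_prop
  · rw [hI]
    exact mul_neg_of_neg_of_pos hK Real.two_pi_pos

lemma phi_zero_le_two (he : e ∈ Ico (0 : ℝ) 1) {s : ℝ} (hs : s ∈ Ioo (0 : ℝ) 1) :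
    phi (wave s (2 * π)) 0 e ≤ 2 := by
  refine phi_zero_le he (n := 2) ![0, -1] fun k hk => ?_
  rw [abs_lt] at hk
  have h1 : (k : ℝ) < (1 : ℤ) := by push_cast; linarith [hs.1]
  have h2 : ((-2 : ℤ) : ℝ) < k := by push_cast; linarith [hs.2]
  rw [Int.cast_lt] at h1 h2
  have : k = 0 ∨ k = -1 := by omega
  rcases this with rfl | rfl
  · exact ⟨0, rfl⟩
  · exact ⟨1, rfl⟩

lemma phi_at_zero (he : e ∈ Ico (0 : ℝ) 1) (hω : ‖ω‖ = 1) (hω1 : ω ≠ 1) : phi ω 0 e = 2 := by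
  obtain ⟨s, hs, rfl⟩ := exists_wave_eq hω hω1
  refine le_antisymm (phi_zero_le_two he hs) (two_le_phi he le_rfl ?_ ?_)
  · rw [zero_div]; nlinarith [hs.1, hs.2]
  · rw [zero_div]; nlinarith [hs.1, hs.2]

lemma eventually_phi_eq_two (he : e ∈ Ico (0 : ℝ) 1) (hω : ‖ω‖ = 1) (hω1 : ω ≠ 1) :
    ∀ᶠ β in 𝓝[>] (0 : ℝ), phi ω β e = 2 := by
  obtain ⟨s, hs, rfl⟩ := exists_wave_eq hω hω1
  have hev : ∀ a : ℝ, a < 1 → ∀ᶠ β in 𝓝[>] (0 : ℝ), a + 2 * (β / (1 - e)) < 1 := by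
    intro a ha
    have hc : Continuous fun β : ℝ => a + 2 * (β / (1 - e)) := by fun_prop
    exact (hc.continuousAt.eventually_lt continuousAt_const (by simpa using ha)).filter_mono
      nhdsWithin_le_nhds
  filter_upwards [hev (s ^ 2) (by nlinarith [hs.1, hs.2]),
    hev ((s - 1) ^ 2) (by nlinarith [hs.1, hs.2]), self_mem_nhdsWithin] with β h0 h1 hβ
  have hβ' : 0 ≤ β := le_of_lt hβ
  exact le_antisymm ((antitone_phi he hω hβ').trans (phi_zero_le_two he hs))
    (two_le_phi he hβ' h0 h1)

end

/-! ### The Morse index for `ω ≠ 1` and `β` close to one -/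

lemma hasDerivAt_of_primitive {f g : ℝ → ℂ} (hg : ContinuousOn g (Icc 0 (2 * π)))
    (h : ∀ t ∈ Icc (0 : ℝ) (2 * π), f t = f 0 + ∫ s in (0 : ℝ)..t, g s) {t : ℝ}
    (ht : t ∈ Ioo (0 : ℝ) (2 * π)) : HasDerivAt f (g t) t := by
  have hI : IntervalIntegrable g volume 0 t := by
    refine (hg.mono ?_).intervalIntegrable
    rw [uIcc_of_le ht.1.le]
    exact Icc_subset_Icc_right ht.2.le
  have hm : StronglyMeasurableAtFilter g (𝓝 t) :=
    (hg.mono Ioo_subset_Icc_self).stronglyMeasurableAtFilter isOpen_Ioo t ht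
  have hc : ContinuousAt g t := hg.continuousAt (Icc_mem_nhds ht.1 ht.2)
  have := (intervalIntegral.integral_hasDerivAt_right hI hm hc).const_add (f 0)
  refine this.congr_of_eventuallyEq ?_
  filter_upwards [Icc_mem_nhds ht.1 ht.2] with x hx using h x hx

/-- The Cauchy–Schwarz inequality against the constant `1`, from the variance of `g`. -/
lemma sq_integral_le {g : ℝ → ℝ} (hg : ContinuousOn g (Icc 0 (2 * π))) :
    (∫ t in (0 : ℝ)..2 * π, g t) ^ 2 ≤ 2 * π * ∫ t in (0 : ℝ)..2 * π, g t ^ 2 := by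
  have hpi := Real.two_pi_pos
  rw [← uIcc_of_le two_pi_nonneg] at hg
  set m := ∫ t in (0 : ℝ)..2 * π, g t with hm
  have i1 : IntervalIntegrable (fun t => g t ^ 2) volume 0 (2 * π) :=
    (hg.pow 2).intervalIntegrable
  have i2 : IntervalIntegrable (fun t => 2 * (m / (2 * π)) * g t) volume 0 (2 * π) :=
    hg.intervalIntegrable.const_mul _
  have h0 : 0 ≤ ∫ t in (0 : ℝ)..2 * π, (g t - m / (2 * π)) ^ 2 :=
    intervalIntegral.integral_nonneg two_pi_nonneg fun t _ => sq_nonneg _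
  have h1 : ∀ t, (g t - m / (2 * π)) ^ 2 =
      g t ^ 2 - 2 * (m / (2 * π)) * g t + (m / (2 * π)) ^ 2 := fun t => by ring
  simp only [h1] at h0
  rw [intervalIntegral.integral_add (i1.sub i2) intervalIntegrable_const,
    intervalIntegral.integral_sub i1 i2, intervalIntegral.integral_const_mul, ← hm,
    intervalIntegral.integral_const, sub_zero, smul_eq_mul] at h0
  have h2 : 2 * π * (2 * (m / (2 * π)) * m - 2 * π * (m / (2 * π)) ^ 2) = m ^ 2 := by
    field_simp
    ring
  rw [← h2]
  exact mul_le_mul_of_nonneg_left (by linarith) hpi.le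

section

variable {e : ℝ} {ω : ℂ} {β : ℝ}

/-- The logarithmic derivative of the profile `1 + e cos t`. -/
def logSlope (e t : ℝ) : ℝ := -(e * Real.sin t) / (1 + e * Real.cos t)

lemma continuous_logSlope (he : e ∈ Ico (0 : ℝ) 1) : Continuous (logSlope e) :=
  Continuous.div (by fun_prop) (by fun_prop) fun t => (denom_pos he t).ne'

lemma hasDerivAt_profile (e t : ℝ) :
    HasDerivAt (fun t => 1 + e * Real.cos t) (-(e * Real.sin t)) t :=
  (((Real.hasDerivAt_cos t).const_mul e).const_add 1).congr_deriv (by ring)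

lemma hasDerivAt_logSlope (he : e ∈ Ico (0 : ℝ) 1) (t : ℝ) :
    HasDerivAt (logSlope e) (-qfun 1 e t - logSlope e t ^ 2) t := by
  have hp := (denom_pos he t).ne'
  refine ((((Real.hasDerivAt_sin t).const_mul e).neg.div (hasDerivAt_profile e t) hp)).congr_deriv
    ?_
  simp only [qfun, logSlope, Pi.neg_apply]
  field_simp
  ring

/-- Jacobi's factorization of the form of `A(1,e)`, whose kernel contains `1 + e cos t`. -/
lemma integral_jacobi (he : e ∈ Ico (0 : ℝ) 1) {u v w : ℝ → ℂ} (h : IsW22 u v w) :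
    ∫ t in (0 : ℝ)..2 * π, ‖v t - logSlope e t * u t‖ ^ 2 =
      ∫ t in (0 : ℝ)..2 * π, (‖v t‖ ^ 2 - qfun 1 e t * ‖u t‖ ^ 2) := by
  set G : ℝ → ℝ := fun t => logSlope e t * ‖u t‖ ^ 2 with hG
  have cr := continuous_logSlope he
  have cu := h.continuousOn_u
  have cv := h.continuousOn_v
  have hcG : ContinuousOn G (Icc 0 (2 * π)) := cr.continuousOn.mul (cu.norm.pow 2)
  set g : ℝ → ℝ := fun t => ‖v t‖ ^ 2 - qfun 1 e t * ‖u t‖ ^ 2 -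
    ‖v t - logSlope e t * u t‖ ^ 2 with hg
  have c1 : ContinuousOn (fun t => ‖v t - logSlope e t * u t‖ ^ 2) (uIcc 0 (2 * π)) := by
    rw [uIcc_of_le two_pi_nonneg]
    exact (cv.sub ((Complex.continuous_ofReal.comp cr).continuousOn.mul cu)).norm.pow 2
  have i1 := c1.intervalIntegrable (μ := volume)
  have i2 := intervalIntegrable_form he 1 h
  have hd : ∀ t ∈ Ioo (0 : ℝ) (2 * π), HasDerivAt G (g t) t := by
    intro t ht
    have hut := hasDerivAt_of_primitive cv h.left_eq ht
    refine ((hasDerivAt_logSlope he t).mul hut.norm_sq).congr_deriv ?_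
    have e1 : ‖v t - logSlope e t * u t‖ ^ 2 = ‖v t‖ ^ 2 -
        2 * logSlope e t * (inner ℝ (u t) (v t)) + logSlope e t ^ 2 * ‖u t‖ ^ 2 := by
      rw [← Complex.real_smul, norm_sub_sq_real, real_inner_smul_right, norm_smul, mul_pow,
        Real.norm_eq_abs, sq_abs, real_inner_comm]
      ring
    simp only [hg, e1]
    ring
  have hFTC := intervalIntegral.integral_eq_sub_of_hasDerivAt_of_le two_pi_nonneg hcG hd
    (i2.sub i1)
  -- The logarithmic derivative of the profile vanishes at both ends, so no boundary condition
  -- on `u` is needed.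
  have hbd : G (2 * π) - G 0 = 0 := by simp [hG, logSlope]
  rw [hbd, hg, intervalIntegral.integral_sub i2 i1] at hFTC
  linarith

/-- For `ω ≠ 1` the form of `A(1,e)` is coercive: with `p = 1 + e cos t` and `f = u' - (p'/p) u`,
the quotient `u/p` has derivative `f/p`, and its size is controlled by that derivative because
`(ω - 1) (u/p)(0)` is the integral of `f/p`. -/
lemma exists_coercive (he : e ∈ Ico (0 : ℝ) 1) (hω1 : ω ≠ 1) :
    ∃ C > 0, ∀ u v w : ℝ → ℂ, IsW22 u v w → u (2 * π) = ω * u 0 →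
      ∫ t in (0 : ℝ)..2 * π, ‖u t‖ ^ 2 / (1 + e * Real.cos t) ≤
        C * ∫ t in (0 : ℝ)..2 * π, (‖v t‖ ^ 2 - qfun 1 e t * ‖u t‖ ^ 2) := by
  have hpi := Real.two_pi_pos
  have h1e : 0 < 1 - e := sub_pos.2 he.2
  have hω1' : 0 < ‖ω - 1‖ := norm_pos_iff.2 (sub_ne_zero.2 hω1)
  set κ := (1 / ‖ω - 1‖ + 1) / (1 - e) with hκ
  have hκ0 : 0 < κ := by positivity
  refine ⟨2 * π * (2 * (κ ^ 2 * (2 * π))), by positivity, fun u v w h hu => ?_⟩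
  rw [← integral_jacobi he h]
  have cr := continuous_logSlope he
  have cu := h.continuousOn_u
  have cv := h.continuousOn_v
  have cp : Continuous fun t => 1 + e * Real.cos t := by fun_prop
  have cpi : Continuous fun t => (1 + e * Real.cos t)⁻¹ :=
    cp.inv₀ fun t => (denom_pos he t).ne'
  set f : ℝ → ℂ := fun t => v t - logSlope e t * u t with hf
  have cf : ContinuousOn f (Icc 0 (2 * π)) :=
    cv.sub ((Complex.continuous_ofReal.comp cr).continuousOn.mul cu)
  set z : ℝ → ℂ := fun t => (((1 + e * Real.cos t)⁻¹ : ℝ) : ℂ) * u t with hz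
  set g : ℝ → ℂ := fun t => (((1 + e * Real.cos t)⁻¹ : ℝ) : ℂ) * f t with hg
  have cz : ContinuousOn z (Icc 0 (2 * π)) :=
    (Complex.continuous_ofReal.comp cpi).continuousOn.mul cu
  have cg : ContinuousOn g (Icc 0 (2 * π)) :=
    (Complex.continuous_ofReal.comp cpi).continuousOn.mul cf
  have hdz : ∀ t ∈ Ioo (0 : ℝ) (2 * π), HasDerivAt z (g t) t := by
    intro t ht
    have hp := (denom_pos he t).ne'
    have h1 := ((hasDerivAt_profile e t).inv hp).ofReal_comp
    refine (h1.mul (hasDerivAt_of_primitive cv h.left_eq ht)).congr_deriv ?_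
    have e1 : -(-(e * Real.sin t)) / (1 + e * Real.cos t) ^ 2 =
        -((1 + e * Real.cos t)⁻¹ * logSlope e t) := by
      rw [logSlope]; field_simp
    simp only [hg, hf, e1, Pi.inv_apply]
    push_cast
    ring
  -- `M` bounds every increment of `u/p`.
  set M := (1 - e)⁻¹ * ∫ t in (0 : ℝ)..2 * π, ‖f t‖ with hM
  have hgf : ∀ t, ‖g t‖ ≤ (1 - e)⁻¹ * ‖f t‖ := fun t => by
    rw [hg, norm_mul, Complex.norm_real, Real.norm_of_nonneg (inv_nonneg.2 (denom_pos he t).le)]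
    exact mul_le_mul_of_nonneg_right (inv_anti₀ h1e (one_sub_le_denom he t)) (norm_nonneg _)
  have ifn : IntervalIntegrable (fun t => ‖f t‖) volume 0 (2 * π) := by
    apply ContinuousOn.intervalIntegrable
    rw [uIcc_of_le two_pi_nonneg]
    exact cf.norm
  have hinc : ∀ t ∈ Icc (0 : ℝ) (2 * π), ‖z t - z 0‖ ≤ M := by
    intro t ht
    have hsub : Icc 0 t ⊆ Icc 0 (2 * π) := Icc_subset_Icc_right ht.2
    have ig : IntervalIntegrable g volume 0 t := by
      apply ContinuousOn.intervalIntegrable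
      rw [uIcc_of_le ht.1]
      exact cg.mono hsub
    have := intervalIntegral.integral_eq_sub_of_hasDerivAt_of_le ht.1 (cz.mono hsub)
      (fun x hx => hdz x ⟨hx.1, hx.2.trans_le ht.2⟩) ig
    rw [← this]
    have if' : IntervalIntegrable (fun t => ‖f t‖) volume 0 t :=
      ifn.mono_set (by
        rw [uIcc_of_le ht.1, uIcc_of_le two_pi_nonneg]; exact hsub)
    calc ‖∫ s in (0 : ℝ)..t, g s‖ ≤ ∫ s in (0 : ℝ)..t, ‖g s‖ :=
          intervalIntegral.norm_integral_le_integral_norm ht.1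
      _ ≤ ∫ s in (0 : ℝ)..t, (1 - e)⁻¹ * ‖f s‖ :=
          intervalIntegral.integral_mono_on ht.1 ig.norm (if'.const_mul _) fun s _ => hgf s
      _ ≤ M := by
          rw [intervalIntegral.integral_const_mul]
          refine mul_le_mul_of_nonneg_left ?_ (inv_nonneg.2 h1e.le)
          exact intervalIntegral.integral_mono_interval le_rfl ht.1 ht.2
            (ae_of_all _ fun s => norm_nonneg _) ifn
  have hz0 : ‖z 0‖ ≤ 1 / ‖ω - 1‖ * M := by
    have h1 := hinc (2 * π) ⟨two_pi_nonneg, le_rfl⟩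
    have h2 : z (2 * π) - z 0 = (ω - 1) * z 0 := by
      simp only [hz, hu, Real.cos_two_pi, Real.cos_zero]
      ring
    rw [h2, norm_mul] at h1
    rw [one_div_mul_eq_div, le_div_iff₀ hω1']
    linarith
  have hzt : ∀ t ∈ Icc (0 : ℝ) (2 * π), ‖z t‖ ≤ κ * ∫ t in (0 : ℝ)..2 * π, ‖f t‖ := by
    intro t ht
    have h1 := hinc t ht
    have h2 : ‖z t‖ ≤ ‖z 0‖ + ‖z t - z 0‖ := by
      have := norm_add_le (z 0) (z t - z 0)
      rwa [add_sub_cancel] at this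
    have h3 : κ * ∫ t in (0 : ℝ)..2 * π, ‖f t‖ = 1 / ‖ω - 1‖ * M + M := by
      rw [hκ, hM]; ring
    linarith
  have hsq := sq_integral_le cf.norm
  have hpt : ∀ t ∈ Icc (0 : ℝ) (2 * π), ‖u t‖ ^ 2 / (1 + e * Real.cos t) ≤
      2 * (κ ^ 2 * (2 * π)) * ∫ t in (0 : ℝ)..2 * π, ‖f t‖ ^ 2 := by
    intro t ht
    have hp := denom_pos he t
    have hp2 : 1 + e * Real.cos t ≤ 2 := by nlinarith [Real.cos_le_one t, he.1, he.2]
    have e1 : ‖u t‖ ^ 2 / (1 + e * Real.cos t) = (1 + e * Real.cos t) * ‖z t‖ ^ 2 := by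
      rw [hz, norm_mul, Complex.norm_real, Real.norm_of_nonneg (inv_nonneg.2 hp.le)]
      field_simp
    have e2 := pow_le_pow_left₀ (norm_nonneg _) (hzt t ht) 2
    rw [mul_pow] at e2
    have e3 : κ ^ 2 * (∫ t in (0 : ℝ)..2 * π, ‖f t‖) ^ 2 ≤
        κ ^ 2 * (2 * π * ∫ t in (0 : ℝ)..2 * π, ‖f t‖ ^ 2) :=
      mul_le_mul_of_nonneg_left hsq (sq_nonneg κ)
    rw [e1]
    calc _ ≤ 2 * ‖z t‖ ^ 2 := mul_le_mul_of_nonneg_right hp2 (sq_nonneg _)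
      _ ≤ _ := by linarith
  have hcd : ContinuousOn (fun t => ‖u t‖ ^ 2 / (1 + e * Real.cos t)) (uIcc 0 (2 * π)) :=
    h.continuousOn_norm_sq_u.div cp.continuousOn fun t _ => (denom_pos he t).ne'
  refine (intervalIntegral.integral_mono_on two_pi_nonneg hcd.intervalIntegrable
    intervalIntegrable_const hpt).trans (le_of_eq ?_)
  rw [intervalIntegral.integral_const, sub_zero, smul_eq_mul]
  ring

/-- The form of `A(β,e)` is that of `A(1,e)` minus `(1-β) ∫ |u|²/(1 + e cos t)`, so coercivity
makes it nonnegative for `β` close to one. -/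
lemma exists_phi_eq_zero (he : e ∈ Ico (0 : ℝ) 1) (hω : ‖ω‖ = 1) (hω1 : ω ≠ 1) :
    ∃ C > 0, ∀ β ≤ 1, (1 - β) * C ≤ 1 → phi ω β e = 0 := by
  obtain ⟨C, hC0, hC⟩ := exists_coercive he hω1
  refine ⟨C, hC0, fun β hβ hβC => ?_⟩
  rw [← nonpos_iff_eq_zero]
  refine morseIndex_le (n := 0) 0 fun y _ => ?_
  obtain ⟨u, v, w, h, hu, hv, hyu⟩ := exists_rep y
  rw [re_inner_opA he hω h hu hv y hyu]
  have h1 := hC u v w h hu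
  set I := ∫ t in (0 : ℝ)..2 * π, ‖u t‖ ^ 2 / (1 + e * Real.cos t)
  set Q := ∫ t in (0 : ℝ)..2 * π, (‖v t‖ ^ 2 - qfun 1 e t * ‖u t‖ ^ 2)
  have hI0 : 0 ≤ I := intervalIntegral.integral_nonneg two_pi_nonneg fun t _ =>
    div_nonneg (sq_nonneg _) (denom_pos he t).le
  have cd : ContinuousOn (fun t => ‖u t‖ ^ 2 / (1 + e * Real.cos t)) (uIcc 0 (2 * π)) :=
    h.continuousOn_norm_sq_u.div (by fun_prop) fun t _ => (denom_pos he t).ne'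
  have h2 : ∫ t in (0 : ℝ)..2 * π, (‖v t‖ ^ 2 - qfun β e t * ‖u t‖ ^ 2) = Q - (1 - β) * I := by
    rw [← intervalIntegral.integral_const_mul, ← intervalIntegral.integral_sub
      (intervalIntegrable_form he 1 h) (cd.intervalIntegrable.const_mul _)]
    refine intervalIntegral.integral_congr fun t _ => ?_
    simp only [qfun]
    ring
  rw [h2]
  have h3 : (1 - β) * I ≤ (1 - β) * C * Q := by
    rw [mul_assoc]
    exact mul_le_mul_of_nonneg_left h1 (sub_nonneg.2 hβ)
  have hQ0 : 0 ≤ Q := nonneg_of_mul_nonneg_right (hI0.trans h1) hC0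
  have := mul_le_mul_of_nonneg_right hβC hQ0
  linarith

lemma phi_at_one (he : e ∈ Ico (0 : ℝ) 1) (hω : ‖ω‖ = 1) (hω1 : ω ≠ 1) : phi ω 1 e = 0 := by
  obtain ⟨C, -, h⟩ := exists_phi_eq_zero he hω hω1
  exact h 1 le_rfl (by simp)

lemma eventually_phi_eq_zero (he : e ∈ Ico (0 : ℝ) 1) (hω : ‖ω‖ = 1) (hω1 : ω ≠ 1) :
    ∀ᶠ β in 𝓝[<] (1 : ℝ), phi ω β e = 0 := by
  obtain ⟨C, -, h⟩ := exists_phi_eq_zero he hω hω1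
  have hc : Continuous fun β : ℝ => (1 - β) * C := by fun_prop
  have hev : ∀ᶠ β in 𝓝[<] (1 : ℝ), (1 - β) * C < 1 :=
    (hc.continuousAt.eventually_lt continuousAt_const (by simp)).filter_mono nhdsWithin_le_nhds
  filter_upwards [hev, self_mem_nhdsWithin] with β h1 h2
  exact h β (le_of_lt h2) h1.le

end

end SturmIndex

end

theorem corollary2p3 (e : ℝ) (he : e ∈ Set.Ico (0 : ℝ) 1) :
    -- the `ω`-index is well defined
    (∀ ω : ℂ, ‖ω‖ = 1 → ∀ β ∈ Set.Icc (0 : ℝ) 1,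
      ∃! k : ℤ, SturmIndex.IsOmegaIndex ω (SturmIndex.gammaPath β he) k) ∧
    -- monotonicity
    (∀ ω : ℂ, ‖ω‖ = 1 →
      AntitoneOn (fun β : ℝ => SturmIndex.phi ω β e) (Set.Icc 0 1) ∧
      AntitoneOn (fun β : ℝ => SturmIndex.iGamma ω β he) (Set.Icc 0 1)) ∧
    -- the case `ω = 1`
    (∀ β ∈ Set.Ico (0 : ℝ) 1,
      SturmIndex.phi 1 β e = 1 ∧ SturmIndex.iGamma 1 β he = 1) ∧
    (∀ β ∈ Set.Ioo (0 : ℝ) 1,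
      SturmIndex.nuA 1 β e = 0 ∧ SturmIndex.nuGamma 1 β he = 0) ∧
    -- the case `ω ≠ 1`
    (∀ ω : ℂ, ‖ω‖ = 1 → ω ≠ 1 →
      (SturmIndex.phi ω 0 e = 2 ∧ SturmIndex.iGamma ω 0 he = 2) ∧
      (∀ᶠ β in nhdsWithin (0 : ℝ) (Set.Ioi 0),
        SturmIndex.phi ω β e = 2 ∧ SturmIndex.iGamma ω β he = 2) ∧
      (∀ᶠ β in nhdsWithin (1 : ℝ) (Set.Iio 1),
        SturmIndex.phi ω β e = 0 ∧ SturmIndex.iGamma ω β he = 0) ∧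
      (SturmIndex.phi ω 1 e = 0 ∧ SturmIndex.iGamma ω 1 he = 0)) := by
  refine ⟨fun ω hω β hβ => SturmIndex.existsUnique_isOmegaIndex he hω hβ,
    fun ω hω => ⟨(SturmIndex.antitone_phi he hω).antitoneOn _,
      SturmIndex.antitoneOn_iGamma he hω⟩,
    fun β hβ => ⟨SturmIndex.phi_one he hβ,
      (SturmIndex.isOmegaIndex_periodic he hβ).omegaIndex_eq norm_one⟩,
    fun β hβ => ⟨SturmIndex.nuA_one he hβ, SturmIndex.nuGamma_eq_zero he hβ⟩,
    fun ω hω hω1 => ⟨⟨SturmIndex.phi_at_zero he hω hω1,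
      (SturmIndex.isOmegaIndex_at_zero he hω hω1).omegaIndex_eq hω⟩, ?_, ?_,
      ⟨SturmIndex.phi_at_one he hω hω1,
        (SturmIndex.isOmegaIndex_at_one he hω).omegaIndex_eq hω⟩⟩⟩
  · filter_upwards [SturmIndex.eventually_phi_eq_two he hω hω1,
      SturmIndex.eventually_isOmegaIndex_two he hω hω1] with β h1 h2
    exact ⟨h1, h2.omegaIndex_eq hω⟩
  · filter_upwards [SturmIndex.eventually_phi_eq_zero he hω hω1,
      SturmIndex.eventually_isOmegaIndex_zero he hω hω1] with β h1 h2
    exact ⟨h1, h2.omegaIndex_eq hω⟩
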